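/- **Setting.** *Spartan terms* over a signature of operations are $$t ::= x \mid a \mid \mathsf{new}\ a \multimap t\ \mathsf{in}\ t \mid \mathsf{bind}\ x \to t\ \mathsf{in}\ t \mid \vec y.t \mid \phi(\vec t;\vec s),$$ where $x$ ranges over variables and $a$ over atoms, and each operation $\phi$ is active or passive and has an arity $(m; n_1,\dots,n_p)$: it takes $m$ eager arguments and $p$ deferred arguments, the $j$-th of which is a thunk binding $n_j$ variables. A judgement $\vec x\mid\vec a\vdash t:\tau$ has distinct variables $\vec x$, distinct atoms $\vec a$ and a type $\tau$, which is $\star$, or $T^n(\star)$ for a thunk $\vec y.t$ with $|\vec y|=n$ (the binders are fresh). The arguments of $\mathsf{new}$, $\mathsf{bind}$ and the eager arguments of $\phi$ have type $\star$, the $j$-th deferred argument of $\phi$ has type $T^{n_j}(\star)$. A derivable judgement is translated inductively to a hypernet $(\vec x\mid\vec a\vdash t:\tau)^\dagger:\tau\Rightarrow\star^{\otimes|\vec x|}\otimes\diamond^{\otimes|\vec a|}$, i.e. to a finite directed hypergraph, up to isomorphism, with ordered input and output vertices, in which each vertex is a source of at most one edge and a target of at most one edge, the inputs (outputs) are exactly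 the vertices that are a target (source) of no edge, and the edges are labelled by operations, atoms, instances, contractions, weakenings, tokens ($?$, $\checkmark$ or ⚡) and boxes that contain hypernets; thunks become boxes, and shared variables and atoms are joined by contractions and weakenings. *Contexts* are hypernets which may also have typed hole edges, each hole label appearing at most once, at any depth; a hypernet can be plugged into a hole of its type. A context is *binding-free* if at no depth there is a path from a source of a contraction, atom, box or hole edge to a source of a hole edge. The universal abstract machine acts on *states*, i.e. hypernets $\star\Rightarrow\epsilon$ without holes and with exactly one token edge, which is shallow, not a self-loop, and not at once from an input to an output. Its transitions are the search transitions (moving the token; a search token at a contraction becomes a rewrite token), the copy transitions (copying an instance, or an operation with its boxes, that is below a tree of contractions and weakenings), and the compute transitions, given by an arbitrary set $B_{\mathbb O}$ of pairs of states such that in the first state of each pair a rewrite token points to an active operation edge, and in the second state the token is a search token. Final states are those of the form $\checkmark;G$. For hypernets $H_1,H_2$ of the same type and a set $\mathbb C$ of contexts, $B_{\mathbb O}\models H_1\preceq^{\mathbb C}_{\mathbb N\times\mathbb N}H_2$ means: for every context $\mathcal C[\chi]\in\mathbb C$ with exactly one hole, of the type of the $H_i$, such that both $?;\mathcal C[H_1]$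 and $?;\mathcal C[H_2]$ are states, if a final state is reachable from $?;\mathcal C[H_1]$, then a final state is reachable from $?;\mathcal C[H_2]$. The relation $\simeq^{\mathbb C}_{\mathbb N\times\mathbb N}$ is $\preceq^{\mathbb C}_{\mathbb N\times\mathbb N}$ in both directions. For derivable judgements $\vec x\mid\vec a\vdash t_i:\star$ ($i=1,2$), write $\vec x\mid\vec a\vdash t_1\preceq^{\dagger_{\mathrm{all}}}t_2:\star$ if $B_{\mathbb O}\models(\vec x\mid\vec a\vdash t_1:\star)^\dagger\preceq^{\mathbb C}_{\mathbb N\times\mathbb N}(\vec x\mid\vec a\vdash t_2:\star)^\dagger$ with $\mathbb C$ the set of all token-free contexts, and $\vec x\mid\vec a\vdash t_1\preceq^{\dagger_{\mathrm{bf}}}t_2:\star$ for the same with $\mathbb C$ the set of all token-free binding-free contexts. The relations $\simeq^{\dagger_{\mathrm{all}}}$ and $\simeq^{\dagger_{\mathrm{bf}}}$ are defined in the same way from $\simeq^{\mathbb C}_{\mathbb N\times\mathbb N}$. *Term-contexts* are $$C ::= [\,] \mid \mathsf{new}\ a\multimap t\ \mathsf{in}\ C \mid \mathsf{bind}\ x\to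 t\ \mathsf{in}\ C \mid \mathsf{new}\ a\multimap C\ \mathsf{in}\ t \mid \mathsf{bind}\ x\to C\ \mathsf{in}\ t \mid \vec y.C \mid \phi(\vec t,C,\vec t';\vec s) \mid \phi(\vec t;\vec s,C,\vec s'),$$ and the *binding-free* ones are those built without $\mathsf{new}\ a\multimap C\ \mathsf{in}\ t$ and $\mathsf{bind}\ x\to C\ \mathsf{in}\ t$. They are typed by the rules for terms and the axiom $\vec x\mid\vec a\vdash[\,]_{\vec x\mid\vec a}:\star$ for the hole, which is annotated with $\vec x\mid\vec a$. $C[t]$ is $C$ with the hole replaced by $t$ (variables and atoms may be captured). **Lemma.** Let $B_{\mathbb O}$ be as above. Let $\vec x\mid\vec a\vdash t_1:\star$ and $\vec x\mid\vec a\vdash t_2:\star$ be derivable judgements. Let $C$ be a term-context, $\vec x'$ a sequence of variables and $\vec a'$ a sequence of atoms such that $\vec x'\mid\vec a'\vdash C[\,]_{\vec x\mid\vec a}:\star$ is derivable. 1. If $\vec x\mid\vec a\vdash t_1\preceq^{\dagger_{\mathrm{all}}}t_2:\star$, then $\vec x'\mid\vec a'\vdash C[t_1]\preceq^{\dagger_{\mathrm{all}}}C[t_2]:\star$.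 2. If $\vec x\mid\vec a\vdash t_1\simeq^{\dagger_{\mathrm{all}}}t_2:\star$, then $\vec x'\mid\vec a'\vdash C[t_1]\simeq^{\dagger_{\mathrm{all}}}C[t_2]:\star$. 3. If $\vec x\mid\vec a\vdash t_1\preceq^{\dagger_{\mathrm{bf}}}t_2:\star$ and $C$ is binding-free, then $\vec x'\mid\vec a'\vdash C[t_1]\preceq^{\dagger_{\mathrm{bf}}}C[t_2]:\star$. 4. If $\vec x\mid\vec a\vdash t_1\simeq^{\dagger_{\mathrm{bf}}}t_2:\star$ and $C$ is binding-free, then $\vec x'\mid\vec a'\vdash C[t_1]\simeq^{\dagger_{\mathrm{bf}}}C[t_2]:\star$. In particular, the judgements $\vec x'\mid\vec a'\vdash C[t_i]:\star$ are derivable. -/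

import Mathlib

namespace Spartan

universe u v w

/-! ## Signatures, terms and the type system -/

/-- A set of operations, split into active ones and passive ones, each with an arity
`(m; n₁, …, n_p)`: `m` eager arguments and `p` deferred arguments, the `j`-th of which is a thunk
that binds `n_j` variables. -/
structure Sig where
  Op : Type u
  active : Op → Bool
  eager : Op → ℕ
  deferred : Op → List ℕ

/-- Terms over variables `X` and atoms `A`. An operation is applied to as many eager and deferred
arguments as its arity says (no other application is typable). -/
inductive Term (S : Sig.{u}) (X : Type v) (A : Type w) : Type (max u v w)
  | var (x : X)
  | atom (a : A)
  /-- `new a` bound to the first term, in the second term -/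
  | new (a : A) (s t : Term S X A)
  /-- `bind x` to the first term, in the second term -/
  | bind (x : X) (s t : Term S X A)
  | thunk (ys : List X) (t : Term S X A)
  | op (φ : S.Op) (ts : Fin (S.eager φ) → Term S X A)
      (ss : Fin (S.deferred φ).length → Term S X A)

/-- The two vertex labels `⋆` and `⋄` that can be shared. -/
inductive Wire
  | star
  | diam

/-- Vertex labels: `⋆`, `⋄` and `T^n(⋆)`. The labels `⋆` and `T^n(⋆)` are also the types of terms. -/
inductive VLab
  | wire (c : Wire)
  | thunk (n : ℕ)

abbrev star : VLab := VLab.wire Wire.star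

abbrev diam : VLab := VLab.wire Wire.diam

section Typing

variable {S : Sig.{u}} {X : Type v} {A : Type w}

/-- The rules for judgements `xs | as ⊢ t : τ`. -/
inductive HasTy : List X → List A → Term S X A → VLab → Prop
  | var {xs : List X} {as : List A} {x : X} (h : x ∈ xs) : HasTy xs as (.var x) star
  | atom {xs : List X} {as : List A} {a : A} (h : a ∈ as) : HasTy xs as (.atom a) star
  | bind {xs : List X} {as : List A} {x : X} {s t : Term S X A} (h : x ∉ xs)
      (hs : HasTy xs as s star) (ht : HasTy (xs ++ [x]) as t star) :
      HasTy xs as (.bind x s t) star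
  | new {xs : List X} {as : List A} {a : A} {s t : Term S X A} (h : a ∉ as)
      (hs : HasTy xs as s star) (ht : HasTy xs (a :: as) t star) :
      HasTy xs as (.new a s t) star
  | thunk {xs : List X} {as : List A} {ys : List X} {t : Term S X A} (hn : ys.Nodup)
      (h : ys.Disjoint xs) (ht : HasTy (ys ++ xs) as t star) :
      HasTy xs as (.thunk ys t) (.thunk ys.length)
  | op {xs : List X} {as : List A} {φ : S.Op} {ts : Fin (S.eager φ) → Term S X A}
      {ss : Fin (S.deferred φ).length → Term S X A}
      (hts : ∀ i, HasTy xs as (ts i) star)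
      (hss : ∀ j, HasTy xs as (ss j) (.thunk ((S.deferred φ).get j))) :
      HasTy xs as (.op φ ts ss) star

/-- A derivable judgement `xs | as ⊢ t : τ`: the variables, and the atoms, are distinct. -/
def Derivable (xs : List X) (as : List A) (t : Term S X A) (τ : VLab) : Prop :=
  xs.Nodup ∧ as.Nodup ∧ HasTy xs as t τ

end Typing

/-- Term-contexts. In `newBody`, `bindBody` the hole is in the scope of the binder; in `newArg`,
`bindArg` it is in the bound term. In `opEager`, `opDeferred` the hole is in the `i`-th eager,
respectively `j`-th deferred, argument, and the other arguments are terms. -/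
inductive TermCtx (S : Sig.{u}) (X : Type v) (A : Type w) : Type (max u v w)
  | hole
  | newBody (a : A) (s : Term S X A) (C : TermCtx S X A)
  | bindBody (x : X) (s : Term S X A) (C : TermCtx S X A)
  | newArg (a : A) (C : TermCtx S X A) (t : Term S X A)
  | bindArg (x : X) (C : TermCtx S X A) (t : Term S X A)
  | thunk (ys : List X) (C : TermCtx S X A)
  | opEager (φ : S.Op) (i : Fin (S.eager φ)) (C : TermCtx S X A)
      (ts : {k : Fin (S.eager φ) // k ≠ i} → Term S X A)
      (ss : Fin (S.deferred φ).length → Term S X A)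
  | opDeferred (φ : S.Op) (j : Fin (S.deferred φ).length) (C : TermCtx S X A)
      (ts : Fin (S.eager φ) → Term S X A)
      (ss : {k : Fin (S.deferred φ).length // k ≠ j} → Term S X A)

section TermContexts

variable {S : Sig.{u}} {X : Type v} {A : Type w}

/-- `C[t]`: the hole is replaced by `t`, with capture. -/
def TermCtx.fill (t : Term S X A) : TermCtx S X A → Term S X A
  | .hole => t
  | .newBody a s C => .new a s (C.fill t)
  | .bindBody x s C => .bind x s (C.fill t)
  | .newArg a C s => .new a (C.fill t) s
  | .bindArg x C s => .bind x (C.fill t) s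
  | .thunk ys C => .thunk ys (C.fill t)
  | .opEager φ i C ts ss => .op φ (fun k => if h : k = i then C.fill t else ts ⟨k, h⟩) ss
  | .opDeferred φ j C ts ss => .op φ ts (fun k => if h : k = j then C.fill t else ss ⟨k, h⟩)

/-- Binding-free term-contexts: the hole is not in a bound position. -/
def TermCtx.BindingFree : TermCtx S X A → Prop
  | .hole => True
  | .newBody _ _ C => C.BindingFree
  | .bindBody _ _ C => C.BindingFree
  | .newArg _ _ _ => False
  | .bindArg _ _ _ => False
  | .thunk _ C => C.BindingFree
  | .opEager _ _ C _ _ => C.BindingFree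
  | .opDeferred _ _ C _ _ => C.BindingFree

/-- `HasTyCtx xs as xs' as' C τ`: the rules for `xs' | as' ⊢ C : τ`, where the hole of `C` is
annotated with `xs | as`. -/
inductive HasTyCtx (xs : List X) (as : List A) : List X → List A → TermCtx S X A → VLab → Prop
  | hole : HasTyCtx xs as xs as .hole star
  | newBody {xs' : List X} {as' : List A} {a : A} {s : Term S X A} {C : TermCtx S X A}
      (h : a ∉ as') (hs : HasTy xs' as' s star) (hC : HasTyCtx xs as xs' (a :: as') C star) :
      HasTyCtx xs as xs' as' (.newBody a s C) star
  | bindBody {xs' : List X} {as' : List A} {x : X} {s : Term S X A} {C : TermCtx S X A}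
      (h : x ∉ xs') (hs : HasTy xs' as' s star) (hC : HasTyCtx xs as (xs' ++ [x]) as' C star) :
      HasTyCtx xs as xs' as' (.bindBody x s C) star
  | newArg {xs' : List X} {as' : List A} {a : A} {C : TermCtx S X A} {t : Term S X A}
      (h : a ∉ as') (hC : HasTyCtx xs as xs' as' C star) (ht : HasTy xs' (a :: as') t star) :
      HasTyCtx xs as xs' as' (.newArg a C t) star
  | bindArg {xs' : List X} {as' : List A} {x : X} {C : TermCtx S X A} {t : Term S X A}
      (h : x ∉ xs') (hC : HasTyCtx xs as xs' as' C star) (ht : HasTy (xs' ++ [x]) as' t star) :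
      HasTyCtx xs as xs' as' (.bindArg x C t) star
  | thunk {xs' : List X} {as' : List A} {ys : List X} {C : TermCtx S X A} (hn : ys.Nodup)
      (h : ys.Disjoint xs') (hC : HasTyCtx xs as (ys ++ xs') as' C star) :
      HasTyCtx xs as xs' as' (.thunk ys C) (.thunk ys.length)
  | opEager {xs' : List X} {as' : List A} {φ : S.Op} {i : Fin (S.eager φ)} {C : TermCtx S X A}
      {ts : {k : Fin (S.eager φ) // k ≠ i} → Term S X A}
      {ss : Fin (S.deferred φ).length → Term S X A}
      (hC : HasTyCtx xs as xs' as' C star)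
      (hts : ∀ k, HasTy xs' as' (ts k) star)
      (hss : ∀ j, HasTy xs' as' (ss j) (.thunk ((S.deferred φ).get j))) :
      HasTyCtx xs as xs' as' (.opEager φ i C ts ss) star
  | opDeferred {xs' : List X} {as' : List A} {φ : S.Op} {j : Fin (S.deferred φ).length}
      {C : TermCtx S X A} {ts : Fin (S.eager φ) → Term S X A}
      {ss : {k : Fin (S.deferred φ).length // k ≠ j} → Term S X A}
      (hC : HasTyCtx xs as xs' as' C (.thunk ((S.deferred φ).get j)))
      (hts : ∀ i, HasTy xs' as' (ts i) star)
      (hss : ∀ k, HasTy xs' as' (ss k) (.thunk ((S.deferred φ).get k.1))) :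
      HasTyCtx xs as xs' as' (.opDeferred φ j C ts ss) star

/-- A derivable judgement `xs' | as' ⊢ C[ ] : τ`, the hole being annotated with `xs | as`. -/
def DerivableCtx (xs : List X) (as : List A) (xs' : List X) (as' : List A)
    (C : TermCtx S X A) (τ : VLab) : Prop :=
  xs'.Nodup ∧ as'.Nodup ∧ HasTyCtx xs as xs' as' C τ

end TermContexts

/-! ## Hypernets -/

/-- Token labels: search `?`, value `✓`, rewrite `⚡`. -/
inductive Token
  | search
  | value
  | rewrite

/-- A typed hole label `χ : ins ⇒ outs`. -/
structure Hole where
  name : ℕ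
  ins : List VLab
  outs : List VLab

/-- Edge labels. A box edge is labelled by `box m cs os`, where `m` is its number of bound
variables, `cs` the output type of its content and `os` its own output type; the content itself
is a separate component of a hypernet. -/
inductive Lab (S : Sig.{u}) : Type u
  | op (φ : S.Op)
  | inst
  | atom
  | weak (c : Wire)
  | contr (c : Wire)
  | tok (t : Token)
  | hole (χ : Hole)
  | box (m : ℕ) (cs os : List VLab)

/-- The source type of an edge label. -/
def Lab.dom {S : Sig.{u}} : Lab S → List VLab
  | .op _ => [star]
  | .inst => [star]
  | .atom => [diam]
  | .weak _ => []
  | .contr c => [.wire c, .wire c]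
  | .tok _ => [star]
  | .hole χ => χ.ins
  | .box m _ _ => [.thunk m]

/-- The target type of an edge label. -/
def Lab.cod {S : Sig.{u}} : Lab S → List VLab
  | .op φ => List.replicate (S.eager φ) star ++ (S.deferred φ).map VLab.thunk
  | .inst => [diam]
  | .atom => [star]
  | .weak c => [.wire c]
  | .contr c => [.wire c]
  | .tok _ => [star]
  | .hole χ => χ.outs
  | .box _ _ os => os

/-- The type `⋆^k ⊗ ⋄^h`. -/
def ctxTy (k h : ℕ) : List VLab := List.replicate k star ++ List.replicate h diam

theorem ctxTy_length (k h : ℕ) : (ctxTy k h).length = k + h := by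
  simp [ctxTy]

theorem cod_op_length {S : Sig.{u}} (φ : S.Op) :
    (Lab.cod (.op φ : Lab S)).length = S.eager φ + (S.deferred φ).length := by
  simp [Lab.cod]

/-- Vertices of a hypergraph `ins ⇒ outs`: inner ones (ranging over `V`), inputs and outputs. -/
inductive Vtx (V : Type) (ins outs : List VLab) : Type
  | inner (v : V)
  | inp (i : Fin ins.length)
  | out (j : Fin outs.length)

/-- The data of a nested hypergraph of type `ins ⇒ outs`: inner vertices `V` with labels,
edges `E` with labels, the content of each box edge, and the source list and the target list of
each edge. The conditions that make it a hypernet are in `Net.IsHypernet`. -/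
inductive Net (S : Sig.{u}) : List VLab → List VLab → Type (max 1 u)
  | mk {ins outs : List VLab} (V E : Type) (vlab : V → VLab) (lab : E → Lab S)
      (content : (e : E) → (m : ℕ) → (cs os : List VLab) → lab e = .box m cs os →
        Net S [star] cs)
      (src : (e : E) → Fin (lab e).dom.length → Vtx V ins outs)
      (tgt : (e : E) → Fin (lab e).cod.length → Vtx V ins outs) : Net S ins outs

section Hypernets

variable {S : Sig.{u}} {I O : List VLab}

/-- The inner vertices. -/
def Net.V : Net S I O → Type
  | .mk V _ _ _ _ _ _ => V

/-- The (shallow) edges. -/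
def Net.E : Net S I O → Type
  | .mk _ E _ _ _ _ _ => E

/-- All vertices. -/
abbrev Net.Vert (G : Net S I O) : Type := Vtx G.V I O

/-- The labels of inner vertices. -/
def Net.vlab : (G : Net S I O) → G.V → VLab
  | .mk _ _ l _ _ _ _ => l

/-- The edge labels. -/
def Net.lab : (G : Net S I O) → G.E → Lab S
  | .mk _ _ _ l _ _ _ => l

/-- The contents of the box edges. -/
def Net.content : (G : Net S I O) → (e : G.E) → (m : ℕ) → (cs os : List VLab) →
    G.lab e = .box m cs os → Net S [star] cs
  | .mk _ _ _ _ c _ _ => c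

/-- The source lists. -/
def Net.src : (G : Net S I O) → (e : G.E) → Fin (G.lab e).dom.length → G.Vert
  | .mk _ _ _ _ _ s _ => s

/-- The target lists. -/
def Net.tgt : (G : Net S I O) → (e : G.E) → Fin (G.lab e).cod.length → G.Vert
  | .mk _ _ _ _ _ _ t => t

/-- The label of a vertex. -/
def Net.vertLab (G : Net S I O) : G.Vert → VLab
  | .inner v => G.vlab v
  | .inp i => I.get i
  | .out j => O.get j

/-- A property of hypergraphs holds at every depth: of `G`, of the contents of its boxes, and so
on. -/
inductive Net.Everywhere (P : (I O : List VLab) → Net S I O → Prop) :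
    {I O : List VLab} → Net S I O → Prop
  | intro {I O : List VLab} {G : Net S I O} (here : P I O G)
      (deep : ∀ e m cs os h, Net.Everywhere P (G.content e m cs os h)) : Net.Everywhere P G

/-- The conditions on one level of a hypernet. -/
structure Net.IsLevel (G : Net S I O) : Prop where
  finiteV : Finite G.V
  finiteE : Finite G.E
  /-- edges are well typed -/
  src_lab : ∀ e i, G.vertLab (G.src e i) = (G.lab e).dom.get i
  tgt_lab : ∀ e i, G.vertLab (G.tgt e i) = (G.lab e).cod.get i
  /-- source lists consist of distinct vertices, and no vertex is a source of two edges -/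
  src_inj : Function.Injective fun p : (Σ e, Fin (G.lab e).dom.length) => G.src p.1 p.2
  tgt_inj : Function.Injective fun p : (Σ e, Fin (G.lab e).cod.length) => G.tgt p.1 p.2
  /-- the inputs are exactly the vertices that are a target of no edge -/
  input_iff : ∀ v : G.Vert, (∃ i, v = .inp i) ↔ ¬ ∃ e j, G.tgt e j = v
  /-- the outputs are exactly the vertices that are a source of no edge -/
  output_iff : ∀ v : G.Vert, (∃ j, v = .out j) ↔ ¬ ∃ e i, G.src e i = v
  /-- a box edge has type `T^m(⋆) ⇒ ⋆^k ⊗ ⋄^h` and content of type `⋆ ⇒ ⋆^(m+k) ⊗ ⋄^h` -/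
  box_ty : ∀ e m cs os, G.lab e = .box m cs os →
    ∃ k h, os = ctxTy k h ∧ cs = ctxTy (m + k) h

/-- (Holed) hypernets. -/
def Net.IsHypernet (G : Net S I O) : Prop := Net.Everywhere (fun _ _ G => G.IsLevel) G

/-- No token edge at any depth. -/
def Net.FocusFree (G : Net S I O) : Prop :=
  Net.Everywhere (fun _ _ G => ∀ e t, G.lab e ≠ .tok t) G

/-- No hole edge at any depth. -/
def Net.HoleFree (G : Net S I O) : Prop :=
  Net.Everywhere (fun _ _ G => ∀ e χ, G.lab e ≠ .hole χ) G

/-- There is a single token edge; it is shallow, self-acyclic and not exposed. -/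
def Net.Focussed (G : Net S I O) : Prop :=
  (∃ e t, G.lab e = .tok t ∧ (∀ e' t', G.lab e' = .tok t' → e' = e) ∧
    (∀ i j, G.src e i ≠ G.tgt e j) ∧
    ¬ ((∀ i, ∃ n, G.src e i = .inp n) ∧ ∀ j, ∃ n, G.tgt e j = .out n)) ∧
  ∀ e m cs os h, (G.content e m cs os h).FocusFree

/-- The action of a map of inner vertices. -/
def Vtx.map {V W : Type} (f : V → W) : Vtx V I O → Vtx W I O
  | .inner v => .inner (f v)
  | .inp i => .inp i
  | .out j => .out j

/-- Isomorphism of nested hypergraphs of the same type, respecting the order of interfaces.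
Hypernets are considered up to isomorphism. -/
inductive Net.Iso : {I O : List VLab} → Net S I O → Net S I O → Prop
  | intro {I O : List VLab} {G H : Net S I O} (fV : G.V ≃ H.V) (fE : G.E ≃ H.E)
      (hV : ∀ v, H.vlab (fV v) = G.vlab v)
      (hE : ∀ e, H.lab (fE e) = G.lab e)
      (hsrc : ∀ e i i', i.val = i'.val → H.src (fE e) i' = (G.src e i).map fV)
      (htgt : ∀ e i i', i.val = i'.val → H.tgt (fE e) i' = (G.tgt e i).map fV)
      (hbox : ∀ e m cs os h h',
        Net.Iso (G.content e m cs os h) (H.content (fE e) m cs os h')) : Net.Iso G H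

/-- There is an edge from `a` to `b`. The paths from `a` to `b` are the non-empty chains. -/
def Net.Step (G : Net S I O) (a b : G.Vert) : Prop :=
  ∃ e i j, G.src e i = a ∧ G.tgt e j = b

/-! ### Contexts and plugging -/

/-- The occurrences of a hole label at any depth. -/
inductive Net.Occ (χ : Hole) : {I O : List VLab} → Net S I O → Type (max 1 u)
  | here {I O : List VLab} {G : Net S I O} (e : G.E) (h : G.lab e = .hole χ) : Net.Occ χ G
  | deep {I O : List VLab} {G : Net S I O} (e : G.E) (m : ℕ) (cs os : List VLab)
      (h : G.lab e = .box m cs os) (o : Net.Occ χ (G.content e m cs os h)) : Net.Occ χ G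

/-- Contexts: holed hypernets in which each hole label appears at most once, at any depth. -/
def Net.IsContext (G : Net S I O) : Prop :=
  G.IsHypernet ∧ ∀ χ, Subsingleton (Net.Occ χ G)

/-- A context `C[χ]`, i.e. `χ` is the one and only hole label that appears. -/
def Net.IsContextOf (χ : Hole) (G : Net S I O) : Prop :=
  G.IsContext ∧ ∀ χ', Nonempty (Net.Occ χ' G) ↔ χ' = χ

/-- A simple context `C[χ]`: it has a single hole, which is shallow. -/
def Net.IsSimpleContextOf (χ : Hole) (G : Net S I O) : Prop :=
  G.IsContextOf χ ∧ ∃ e, G.lab e = .hole χ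

/-- Plugging: every hole edge `e` of `C` labelled with `χ`, at any depth, is replaced by (a copy
of) `H`, each input (output) of `H` being identified with the corresponding source (target) of
`e`. A context has at most one such edge. (Recursion on `C`: `plugged` are the results for the
contents of its boxes.) -/
noncomputable def Net.plug (χ : Hole) (H : Net S χ.ins χ.outs) {I O : List VLab}
    (C : Net S I O) : Net S I O :=
  Net.rec (motive := fun I O _ => Net S I O)
    (fun {I O} V E vlab lab _ src tgt plugged =>
      let emb : Vtx V I O → Vtx (V ⊕ ({e : E // lab e = .hole χ} × H.V)) I O := Vtx.map Sum.inl
      let g : {e : E // lab e = .hole χ} → H.Vert →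
          Vtx (V ⊕ ({e : E // lab e = .hole χ} × H.V)) I O := fun e v =>
        match v with
        | .inner v => .inner (.inr (e, v))
        | .inp i => emb (src e.1 (i.cast (by rw [e.2]; rfl)))
        | .out j => emb (tgt e.1 (j.cast (by rw [e.2]; rfl)))
      .mk (V ⊕ ({e : E // lab e = .hole χ} × H.V))
        ({e : E // lab e ≠ .hole χ} ⊕ ({e : E // lab e = .hole χ} × H.E))
        (fun v => match v with
          | .inl v => vlab v
          | .inr v => H.vlab v.2)
        (fun e => match e with
          | .inl e => lab e.1
          | .inr e => H.lab e.2)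
        (fun e => match e with
          | .inl e => fun m cs os h => plugged e.1 m cs os h
          | .inr e => fun m cs os h => H.content e.2 m cs os h)
        (fun e => match e with
          | .inl e => fun i => emb (src e.1 i)
          | .inr e => fun i => g e.1 (H.src e.2 i))
        (fun e => match e with
          | .inl e => fun i => emb (tgt e.1 i)
          | .inr e => fun i => g e.1 (H.tgt e.2 i)))
    C

/-- Labels of contraction (including weakening), atom, box and hole edges. -/
def Lab.IsBinding : Lab S → Prop
  | .contr _ => True
  | .weak _ => True
  | .atom => True
  | .box _ _ _ => True
  | .hole _ => True
  | _ => False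

/-- Sets of holed hypernets (of all types). -/
abbrev ContextSet (S : Sig.{u}) : Type (max 1 u) := (I O : List VLab) → Net S I O → Prop

/-- All focus-free contexts. -/
def AllContexts : ContextSet S := fun _ _ C => C.IsContext ∧ C.FocusFree

/-- Binding-free contexts: at no depth is there a path from a source of a contraction, atom, box
or hole edge to a source of a hole edge. -/
def BindingFreeContexts : ContextSet S := fun _ _ C =>
  (C.IsContext ∧ C.FocusFree) ∧
    Net.Everywhere (fun _ _ G => ∀ e e' i j χ, (G.lab e).IsBinding → G.lab e' = .hole χ →
      ¬ Relation.TransGen G.Step (G.src e i) (G.src e' j)) C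

/-! ### Basic constructions -/

/-- The hypernet that consists of one (non-box) edge. -/
def Net.edge (l : Lab S) (hl : ∀ m cs os, l ≠ .box m cs os) : Net S l.dom l.cod :=
  .mk Empty Unit (fun v => v.elim) (fun _ => l) (fun _ m cs os h => (hl m cs os h).elim)
    (fun _ i => .inp i) (fun _ j => .out j)

/-- `t ;_i G`: a token edge is connected to the `i`-th input. -/
def Net.tokenIn (t : Token) (i : Fin I.length) (G : Net S I O) : Net S I O :=
  let emb : G.Vert → Vtx (G.V ⊕ Unit) I O := fun v =>
    match v with
    | .inner v => .inner (.inl v)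
    | .inp k => if k = i then .inner (.inr ()) else .inp k
    | .out j => .out j
  .mk (G.V ⊕ Unit) (G.E ⊕ Unit)
    (fun v => match v with
      | .inl v => G.vlab v
      | .inr _ => star)
    (fun e => match e with
      | .inl e => G.lab e
      | .inr _ => .tok t)
    (fun e => match e with
      | .inl e => fun m cs os h => G.content e m cs os h
      | .inr _ => fun _ _ _ h => nomatch h)
    (fun e => match e with
      | .inl e => fun k => emb (G.src e k)
      | .inr _ => fun _ => .inp i)
    (fun e => match e with
      | .inl e => fun k => emb (G.tgt e k)
      | .inr _ => fun _ => .inner (.inr ()))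

/-- `G ;_j t`: a token edge is connected to the `j`-th output. -/
def Net.tokenOut (t : Token) (j : Fin O.length) (G : Net S I O) : Net S I O :=
  let emb : G.Vert → Vtx (G.V ⊕ Unit) I O := fun v =>
    match v with
    | .inner v => .inner (.inl v)
    | .inp i => .inp i
    | .out k => if k = j then .inner (.inr ()) else .out k
  .mk (G.V ⊕ Unit) (G.E ⊕ Unit)
    (fun v => match v with
      | .inl v => G.vlab v
      | .inr _ => star)
    (fun e => match e with
      | .inl e => G.lab e
      | .inr _ => .tok t)
    (fun e => match e with
      | .inl e => fun m cs os h => G.content e m cs os h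
      | .inr _ => fun _ _ _ h => nomatch h)
    (fun e => match e with
      | .inl e => fun k => emb (G.src e k)
      | .inr _ => fun _ => .inner (.inr ()))
    (fun e => match e with
      | .inl e => fun k => emb (G.tgt e k)
      | .inr _ => fun _ => .out j)

/-- Sequential composition: the outputs of `G` are identified with the inputs of `H`. -/
def Net.seq {M : List VLab} (G : Net S I M) (H : Net S M O) : Net S I O :=
  let embG : G.Vert → Vtx (G.V ⊕ H.V ⊕ Fin M.length) I O := fun v =>
    match v with
    | .inner v => .inner (.inl v)
    | .inp i => .inp i
    | .out j => .inner (.inr (.inr j))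
  let embH : H.Vert → Vtx (G.V ⊕ H.V ⊕ Fin M.length) I O := fun v =>
    match v with
    | .inner v => .inner (.inr (.inl v))
    | .inp i => .inner (.inr (.inr i))
    | .out j => .out j
  .mk (G.V ⊕ H.V ⊕ Fin M.length) (G.E ⊕ H.E)
    (fun v => match v with
      | .inl v => G.vlab v
      | .inr (.inl v) => H.vlab v
      | .inr (.inr i) => M.get i)
    (fun e => match e with
      | .inl e => G.lab e
      | .inr e => H.lab e)
    (fun e => match e with
      | .inl e => fun m cs os h => G.content e m cs os h
      | .inr e => fun m cs os h => H.content e m cs os h)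
    (fun e => match e with
      | .inl e => fun i => embG (G.src e i)
      | .inr e => fun i => embH (H.src e i))
    (fun e => match e with
      | .inl e => fun i => embG (G.tgt e i)
      | .inr e => fun i => embH (H.tgt e i))

/-- The wire at position `p` of `⋆^k ⊗ ⋄^h`. -/
def ctxWire (k p : ℕ) : Wire := if p < k then .star else .diam

/-- Closing by distributors. Given a hypergraph `G` with inputs `I` and, for each position `p` of
`⋆^k ⊗ ⋄^h`, a list `feed p` of `mult p` vertices of `G`, the outputs `⋆^k ⊗ ⋄^h` are added, and
the vertices `feed p` are contracted into the output `p` by a copy of the distributor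
`D_{1, mult p}`. The distributor `D_{1,m}` is the contraction tree with one weakening edge given by
`D_{1,0} = weakening` and `D_{1,m+1} = contraction ∘ (id ⊗ D_{1,m})`: its contraction edge number
`c` has sources `feed c` and `node (c+1)` and target `node c`, and the weakening edge has target
`node m`, where `node 0` is the output and `node 1, …, node m` are inner vertices. -/
def Net.distribute (k h : ℕ) (G : Net S I []) (mult : Fin (ctxTy k h).length → ℕ)
    (feed : (p : Fin (ctxTy k h).length) → Fin (mult p) → G.Vert) : Net S I (ctxTy k h) :=
  let W : Type := Σ p, Fin (mult p)
  let emb : G.Vert → Vtx (G.V ⊕ W) I (ctxTy k h) := fun v =>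
    match v with
    | .inner v => .inner (.inl v)
    | .inp i => .inp i
    | .out j => j.elim0
  let node : (p : Fin (ctxTy k h).length) → (c : ℕ) → c ≤ mult p →
      Vtx (G.V ⊕ W) I (ctxTy k h) := fun p c hc =>
    match c, hc with
    | 0, _ => .out p
    | c + 1, hc => .inner (.inr ⟨p, ⟨c, hc⟩⟩)
  .mk (G.V ⊕ W) (G.E ⊕ W ⊕ Fin (ctxTy k h).length)
    (fun v => match v with
      | .inl v => G.vlab v
      | .inr w => .wire (ctxWire k w.1.val))
    (fun e => match e with
      | .inl e => G.lab e
      | .inr (.inl w) => .contr (ctxWire k w.1.val)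
      | .inr (.inr p) => .weak (ctxWire k p.val))
    (fun e => match e with
      | .inl e => fun m cs os h => G.content e m cs os h
      | .inr (.inl _) => fun _ _ _ h => nomatch h
      | .inr (.inr _) => fun _ _ _ h => nomatch h)
    (fun e => match e with
      | .inl e => fun i => emb (G.src e i)
      | .inr (.inl w) => fun i =>
        if i.val = 0 then emb (feed w.1 w.2) else node w.1 (w.2.val + 1) w.2.isLt
      | .inr (.inr _) => fun i => i.elim0)
    (fun e => match e with
      | .inl e => fun i => emb (G.tgt e i)
      | .inr (.inl w) => fun _ => node w.1 w.2.val w.2.isLt.le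
      | .inr (.inr p) => fun _ => node p (mult p) le_rfl)

end Hypernets

/-! ## From terms to hypernets -/

section Translation

variable {S : Sig.{u}} {X : Type v} {A : Type w}

open Classical in
/-- A variable: the input is distributed to the output of the variable, and the other outputs are
weakened. -/
noncomputable def varNet (τ : VLab) (xs : List X) (as : List A) (x : X) :
    Net S [τ] (ctxTy xs.length as.length) :=
  Net.distribute xs.length as.length
    (.mk Empty Empty (fun v => v.elim) (fun e => e.elim) (fun e => e.elim)
      (fun e => e.elim) (fun e => e.elim))
    (fun p => if xs[p.val]? = some x then 1 else 0)
    (fun _ _ => .inp ⟨0, Nat.one_pos⟩)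

open Classical in
/-- An atom: an instance edge, whose target is distributed to the output of the atom. -/
noncomputable def atomNet (τ : VLab) (xs : List X) (as : List A) (a : A) :
    Net S [τ] (ctxTy xs.length as.length) :=
  Net.distribute xs.length as.length
    (.mk Unit Unit (fun _ => diam) (fun _ => .inst) (fun _ _ _ _ h => nomatch h)
      (fun _ _ => .inp ⟨0, Nat.one_pos⟩) (fun _ _ => .inner ()))
    (fun p => if xs.length ≤ p.val ∧ as[p.val - xs.length]? = some a then 1 else 0)
    (fun _ _ => .inner ())

/-- Removal of the position `k`. -/
def dropPos (k : ℕ) {N M : ℕ} (hk : k ≤ M) (hN : N = M + 1) (p : Fin N) : Option (Fin M) :=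
  if h₁ : p.val < k then some ⟨p.val, h₁.trans_le hk⟩
  else if h₂ : p.val = k then none
  else some ⟨p.val - 1, by have := p.isLt; omega⟩

/-- The binders. The output `k` of the body `G` is identified with the vertex `top`, the input of
the bound term `K` is identified with the vertex `bot`, and an atom edge goes from `top` to `bot`
for each element of `Y` (for variables `top = bot` and there is none; for atoms there is one). The
other outputs of `G`, and the outputs of `K`, are contracted by distributors. -/
def linkNet {I O : List VLab} (k h : ℕ) (J Y : Type) (jlab : J → VLab) (top bot : J)
    (G : Net S I O) (hO : O.length = (ctxTy k h).length + 1) (K : Net S [star] (ctxTy k h)) :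
    Net S I (ctxTy k h) :=
  let V : Type := G.V ⊕ K.V ⊕ J ⊕ (Fin (ctxTy k h).length × Fin 2)
  let embG : G.Vert → Vtx V I [] := fun v =>
    match v with
    | .inner v => .inner (.inl v)
    | .inp i => .inp i
    | .out j => match dropPos k (by simp [ctxTy_length]) hO j with
      | none => .inner (.inr (.inr (.inl top)))
      | some p => .inner (.inr (.inr (.inr (p, 0))))
  let embK : K.Vert → Vtx V I [] := fun v =>
    match v with
    | .inner v => .inner (.inr (.inl v))
    | .inp _ => .inner (.inr (.inr (.inl bot)))
    | .out p => .inner (.inr (.inr (.inr (p, 1))))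
  Net.distribute k h
    (.mk V (G.E ⊕ K.E ⊕ Y)
      (fun v => match v with
        | .inl v => G.vlab v
        | .inr (.inl v) => K.vlab v
        | .inr (.inr (.inl j)) => jlab j
        | .inr (.inr (.inr (p, _))) => (ctxTy k h).get p)
      (fun e => match e with
        | .inl e => G.lab e
        | .inr (.inl e) => K.lab e
        | .inr (.inr _) => .atom)
      (fun e => match e with
        | .inl e => fun m cs os h => G.content e m cs os h
        | .inr (.inl e) => fun m cs os h => K.content e m cs os h
        | .inr (.inr _) => fun _ _ _ h => nomatch h)
      (fun e => match e with
        | .inl e => fun i => embG (G.src e i)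
        | .inr (.inl e) => fun i => embK (K.src e i)
        | .inr (.inr _) => fun _ => .inner (.inr (.inr (.inl top))))
      (fun e => match e with
        | .inl e => fun i => embG (G.tgt e i)
        | .inr (.inl e) => fun i => embK (K.tgt e i)
        | .inr (.inr _) => fun _ => .inner (.inr (.inr (.inl bot)))))
    (fun _ => 2)
    (fun p c => .inner (.inr (.inr (.inr (p, c)))))

/-- An operation: the targets of the operation edge are identified with the inputs of the hypernets
of the arguments, which are placed side by side, and whose outputs are contracted by
distributors. -/
def opNet (τ : VLab) (k h : ℕ) (φ : S.Op) (G : Fin (S.eager φ) → Net S [star] (ctxTy k h))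
    (K : (j : Fin (S.deferred φ).length) → Net S [.thunk ((S.deferred φ).get j)] (ctxTy k h)) :
    Net S [τ] (ctxTy k h) :=
  let R : Type := Fin (Lab.cod (.op φ : Lab S)).length
  let N : Type := Fin (S.eager φ + (S.deferred φ).length)
  let V : Type := (Σ i, (G i).V) ⊕ (Σ j, (K j).V) ⊕ R ⊕ (Fin (ctxTy k h).length × N)
  let embG : (i : Fin (S.eager φ)) → (G i).Vert → Vtx V [τ] [] := fun i v =>
    match v with
    | .inner v => .inner (.inl ⟨i, v⟩)
    | .inp _ => .inner (.inr (.inr (.inl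
        ((Fin.castAdd (S.deferred φ).length i).cast (cod_op_length φ).symm))))
    | .out p => .inner (.inr (.inr (.inr (p, Fin.castAdd (S.deferred φ).length i))))
  let embK : (j : Fin (S.deferred φ).length) → (K j).Vert → Vtx V [τ] [] := fun j v =>
    match v with
    | .inner v => .inner (.inr (.inl ⟨j, v⟩))
    | .inp _ => .inner (.inr (.inr (.inl
        ((Fin.natAdd (S.eager φ) j).cast (cod_op_length φ).symm))))
    | .out p => .inner (.inr (.inr (.inr (p, Fin.natAdd (S.eager φ) j))))
  Net.distribute k h
    (.mk V (Unit ⊕ (Σ i, (G i).E) ⊕ (Σ j, (K j).E))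
      (fun v => match v with
        | .inl v => (G v.1).vlab v.2
        | .inr (.inl v) => (K v.1).vlab v.2
        | .inr (.inr (.inl r)) => (Lab.cod (.op φ : Lab S)).get r
        | .inr (.inr (.inr (p, _))) => (ctxTy k h).get p)
      (fun e => match e with
        | .inl _ => .op φ
        | .inr (.inl e) => (G e.1).lab e.2
        | .inr (.inr e) => (K e.1).lab e.2)
      (fun e => match e with
        | .inl _ => fun _ _ _ h => nomatch h
        | .inr (.inl e) => fun m cs os h => (G e.1).content e.2 m cs os h
        | .inr (.inr e) => fun m cs os h => (K e.1).content e.2 m cs os h)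
      (fun e => match e with
        | .inl _ => fun _ => .inp ⟨0, Nat.one_pos⟩
        | .inr (.inl e) => fun i => embG e.1 ((G e.1).src e.2 i)
        | .inr (.inr e) => fun i => embK e.1 ((K e.1).src e.2 i))
      (fun e => match e with
        | .inl _ => fun r => .inner (.inr (.inr (.inl r)))
        | .inr (.inl e) => fun i => embG e.1 ((G e.1).tgt e.2 i)
        | .inr (.inr e) => fun i => embK e.1 ((K e.1).tgt e.2 i)))
    (fun _ => S.eager φ + (S.deferred φ).length)
    (fun p c => .inner (.inr (.inr (.inr (p, c)))))

/-- A thunk: a single box edge, with content `G`. -/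
def thunkNet (τ : VLab) (m : ℕ) {cs : List VLab} (os : List VLab) (G : Net S [star] cs) :
    Net S [τ] os :=
  .mk Empty Unit (fun v => v.elim) (fun _ => .box m cs os)
    (fun _ _ cs' _ h => (show cs = cs' by injection h) ▸ G)
    (fun _ _ => .inp ⟨0, Nat.one_pos⟩) (fun _ j => .out j)

/-- The hypernet `(xs | as ⊢ t : τ)†`, of type `τ ⇒ ⋆^|xs| ⊗ ⋄^|as|`. -/
noncomputable def translate : Term S X A → (τ : VLab) → (xs : List X) → (as : List A) →
    Net S [τ] (ctxTy xs.length as.length)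
  | .var x, τ, xs, as => varNet τ xs as x
  | .atom a, τ, xs, as => atomNet τ xs as a
  | .bind x s t, τ, xs, as =>
    linkNet xs.length as.length Unit Empty (fun _ => star) () ()
      (translate t τ (xs ++ [x]) as) (by simp [ctxTy_length]; omega)
      (translate s star xs as)
  | .new a s t, τ, xs, as =>
    linkNet xs.length as.length Bool Unit (fun b => if b then star else diam) false true
      (translate t τ xs (a :: as)) (by simp [ctxTy_length]; omega)
      (translate s star xs as)
  | .thunk ys t, τ, xs, as =>
    thunkNet τ ys.length (ctxTy xs.length as.length) (translate t star (ys ++ xs) as)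
  | .op φ ts ss, τ, xs, as =>
    opNet τ xs.length as.length φ (fun i => translate (ts i) star xs as)
      (fun j => translate (ss j) (.thunk ((S.deferred φ).get j)) xs as)

end Translation

/-! ## The universal abstract machine -/

section Machine

variable {S : Sig.{u}}

/-- Hypernets of the type `⋆ ⇒ ε` of states and programs. -/
abbrev Prog (S : Sig.{u}) : Type (max 1 u) := Net S [star] []

/-- States: focussed hypernets of type `⋆ ⇒ ε`. -/
def IsState (G : Prog S) : Prop := G.IsHypernet ∧ G.HoleFree ∧ G.Focussed

/-- `t ; G` for `G : ⋆ ⇒ ε`. -/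
def withToken (t : Token) (G : Prog S) : Prog S := G.tokenIn t ⟨0, Nat.one_pos⟩

/-- Final states: those of the form `✓ ; G`. -/
def IsFinal (N : Prog S) : Prop :=
  IsState N ∧ ∃ G : Prog S, G.FocusFree ∧ Net.Iso N (withToken .value G)

/-- The hypernet of a single operation edge. -/
def opEdge (φ : S.Op) : Net S [star] (Lab.cod (.op φ : Lab S)) :=
  Net.edge (.op φ) (fun _ _ _ h => nomatch h)

/-- The hypernet of a single contraction edge of type `⋆ ⊗ ⋆ ⇒ ⋆`. -/
def contrEdge : Net S [star, star] [star] :=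
  Net.edge (.contr .star) (fun _ _ _ h => nomatch h)

/-- The hypernet of a single instance edge. -/
def instEdge : Net S [star] [diam] :=
  Net.edge .inst (fun _ _ _ h => nomatch h)

/-- The `i`-th eager argument, as a target of the operation. -/
def eagerPos (φ : S.Op) (i : ℕ) (h : i < S.eager φ) : Fin (Lab.cod (.op φ : Lab S)).length :=
  ⟨i, by rw [cod_op_length]; omega⟩

/-- The token that results when an operation has all its eager arguments evaluated. -/
def resultToken (φ : S.Op) : Token := if S.active φ then .rewrite else .value

/-- The interaction rules. -/
inductive InteractionRule : (I O : List VLab) → Net S I O → Net S I O → Prop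
  /-- a search token at either branch of a contraction triggers copying -/
  | contr (i : Fin 2) : InteractionRule [star, star] [star]
      (contrEdge.tokenIn .search i) (contrEdge.tokenIn .rewrite i)
  /-- an instance edge is a value -/
  | inst : InteractionRule [star] [diam]
      (instEdge.tokenIn .search ⟨0, Nat.one_pos⟩) (instEdge.tokenIn .value ⟨0, Nat.one_pos⟩)
  /-- the search proceeds to the first eager argument -/
  | first (φ : S.Op) (h : 0 < S.eager φ) : InteractionRule [star] (Lab.cod (.op φ : Lab S))
      ((opEdge φ).tokenIn .search ⟨0, Nat.one_pos⟩)
      ((opEdge φ).tokenOut .search (eagerPos φ 0 h))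
  /-- after one eager argument, the search proceeds to the next one -/
  | next (φ : S.Op) (i : ℕ) (h : i + 1 < S.eager φ) : InteractionRule [star] (Lab.cod (.op φ : Lab S))
      ((opEdge φ).tokenOut .value (eagerPos φ i (by omega)))
      ((opEdge φ).tokenOut .search (eagerPos φ (i + 1) h))
  /-- after the last eager argument -/
  | last (φ : S.Op) (i : ℕ) (h : i + 1 = S.eager φ) : InteractionRule [star] (Lab.cod (.op φ : Lab S))
      ((opEdge φ).tokenOut .value (eagerPos φ i (by omega)))
      ((opEdge φ).tokenIn (resultToken φ) ⟨0, Nat.one_pos⟩)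
  /-- an operation without eager arguments -/
  | none (φ : S.Op) (h : S.eager φ = 0) : InteractionRule [star] (Lab.cod (.op φ : Lab S))
      ((opEdge φ).tokenIn .search ⟨0, Nat.one_pos⟩)
      ((opEdge φ).tokenIn (resultToken φ) ⟨0, Nat.one_pos⟩)

/-- Contraction trees `⋆^n ⇒ ⋆`: hypernets of contraction and weakening edges, in which the output
is reachable from each vertex. -/
def IsContractionTree {n : ℕ} (C : Net S (List.replicate n star) [star]) : Prop :=
  C.IsHypernet ∧ (∀ e, C.lab e = .contr .star ∨ C.lab e = .weak .star) ∧
    ∀ v : C.Vert, Relation.ReflTransGen C.Step v (.out ⟨0, Nat.one_pos⟩)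

/-- Copyable hypernets `⋆ ⇒ ⋆^k ⊗ ⋄^h`: either a single instance edge, or an operation edge with
a box edge at each of its deferred arguments. (The incidence relation is forced by the typing: the
source of the operation edge is the input, and the sources of the boxes are the targets
`T^n(⋆)` of the operation edge.) -/
def IsCopyable {k h : ℕ} (H : Net S [star] (ctxTy k h)) : Prop :=
  H.IsHypernet ∧ H.FocusFree ∧
    ((∃ e, H.lab e = .inst ∧ ∀ e', e' = e) ∨
      ∃ e φ, H.lab e = .op φ ∧ ∀ e', e' ≠ e → ∃ m cs os, H.lab e' = .box m cs os)

/-- The right-hand side of the contraction rule, without its token. The input `0` of the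
contraction tree `C` is replaced by a weakening edge; one copy of `H` is put at the input `0`,
another one below the output of `C`; and the corresponding outputs of the two copies are contracted
by distributors. -/
def copyNet {n k h : ℕ} (C : Net S (List.replicate (n + 1) star) [star])
    (H : Net S [star] (ctxTy k h)) : Net S (List.replicate (n + 1) star) (ctxTy k h) :=
  let I := List.replicate (n + 1) star
  -- the two elements of the third summand: the weakened vertex, and the output of the tree
  let V : Type := C.V ⊕ (Fin 2 × H.V) ⊕ Fin 2 ⊕ (Fin (ctxTy k h).length × Fin 2)
  let embC : C.Vert → Vtx V I [] := fun v =>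
    match v with
    | .inner v => .inner (.inl v)
    | .inp i => if i.val = 0 then .inner (.inr (.inr (.inl 0))) else .inp i
    | .out _ => .inner (.inr (.inr (.inl 1)))
  let embH : Fin 2 → H.Vert → Vtx V I [] := fun c v =>
    match v with
    | .inner v => .inner (.inr (.inl (c, v)))
    | .inp _ => if c = 0 then .inp ⟨0, by simp [I]⟩ else .inner (.inr (.inr (.inl 1)))
    | .out p => .inner (.inr (.inr (.inr (p, c))))
  Net.distribute k h
    (.mk V (C.E ⊕ (Fin 2 × H.E) ⊕ Unit)
      (fun v => match v with
        | .inl v => C.vlab v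
        | .inr (.inl v) => H.vlab v.2
        | .inr (.inr (.inl _)) => star
        | .inr (.inr (.inr (p, _))) => (ctxTy k h).get p)
      (fun e => match e with
        | .inl e => C.lab e
        | .inr (.inl e) => H.lab e.2
        | .inr (.inr _) => .weak .star)
      (fun e => match e with
        | .inl e => fun m cs os h => C.content e m cs os h
        | .inr (.inl e) => fun m cs os h => H.content e.2 m cs os h
        | .inr (.inr _) => fun _ _ _ h => nomatch h)
      (fun e => match e with
        | .inl e => fun i => embC (C.src e i)
        | .inr (.inl e) => fun i => embH e.1 (H.src e.2 i)
        | .inr (.inr _) => fun i => i.elim0)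
      (fun e => match e with
        | .inl e => fun i => embC (C.tgt e i)
        | .inr (.inl e) => fun i => embH e.1 (H.tgt e.2 i)
        | .inr (.inr _) => fun _ => .inner (.inr (.inr (.inl 0)))))
    (fun _ => 2)
    (fun p c => .inner (.inr (.inr (.inr (p, c)))))

/-- The contraction rules: a copyable hypernet `H` below a contraction tree `C` is copied to the
input of `C` where the rewrite token is. -/
inductive ContractionRule : (I O : List VLab) → Net S I O → Net S I O → Prop
  | copy {n k h : ℕ} (C : Net S (List.replicate (n + 1) star) [star])
      (H : Net S [star] (ctxTy k h)) (hC : IsContractionTree C) (hH : IsCopyable H) :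
      ContractionRule _ _ ((C.seq H).tokenIn .rewrite ⟨0, by simp⟩)
        ((copyNet C H).tokenIn .search ⟨0, by simp⟩)

/-- The transitions on states that are given by local rules, applied in focus-free simple
contexts. -/
def LocalTransition
    (rule : (I O : List VLab) → Net S I O → Net S I O → Prop) (N N' : Prog S) : Prop :=
  ∃ (χ : Hole) (G G' : Net S χ.ins χ.outs) (C : Prog S),
    rule χ.ins χ.outs G G' ∧ C.IsSimpleContextOf χ ∧ C.FocusFree ∧
    IsState (Net.plug χ G C) ∧ IsState (Net.plug χ G' C) ∧
    Net.Iso N (Net.plug χ G C) ∧ Net.Iso N' (Net.plug χ G' C)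

/-- The behaviour of the operations: an arbitrary set of pairs of states (extrinsic, or compute,
transitions) such that the first state has a rewrite token that is an incoming edge of an active
operation edge, and the second state has a search token. -/
structure Behaviour (S : Sig.{u}) where
  rel : Prog S → Prog S → Prop
  state_left : ∀ {N N'}, rel N N' → IsState N
  state_right : ∀ {N N'}, rel N N' → IsState N'
  rewrite : ∀ {N N'}, rel N N' → ∃ e e' i j φ, N.lab e = .tok .rewrite ∧ N.lab e' = .op φ ∧
    S.active φ = true ∧ N.tgt e i = N.src e' j
  search : ∀ {N N'}, rel N N' → ∃ e, N'.lab e = .tok .search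

/-- The transitions of the machine: search, copy and compute transitions. (Hypernets are
considered up to isomorphism.) -/
def Transition (B : Behaviour S) (N N' : Prog S) : Prop :=
  LocalTransition InteractionRule N N' ∨ LocalTransition ContractionRule N N' ∨
    ∃ M M', B.rel M M' ∧ Net.Iso N M ∧ Net.Iso N' M'

/-- `N →^k N'`. -/
def Transitions (B : Behaviour S) : ℕ → Prog S → Prog S → Prop
  | 0, N, N' => N = N'
  | k + 1, N, N' => ∃ M, Transition B N M ∧ Transitions B k M N'

/-! ## Refinement and equivalence -/

/-- `N₁` refines `N₂` up to `Q`. -/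
def StateRefines (B : Behaviour S) (Q : ℕ → ℕ → Prop) (N₁ N₂ : Prog S) : Prop :=
  ∀ k₁ M₁, Transitions B k₁ N₁ M₁ → IsFinal M₁ →
    ∃ k₂ M₂, Q k₁ k₂ ∧ Transitions B k₂ N₂ M₂ ∧ IsFinal M₂

/-- `H₁` contextually refines `H₂` in the set `𝒞` of contexts, up to `Q`. -/
def CtxRefines (B : Behaviour S) (𝒞 : ContextSet S)
    (Q : ℕ → ℕ → Prop) {I O : List VLab} (H₁ H₂ : Net S I O) : Prop :=
  ∀ (n : ℕ) (C : Prog S), 𝒞 _ _ C → C.IsContextOf ⟨n, I, O⟩ →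
    IsState (withToken .search (Net.plug ⟨n, I, O⟩ H₁ C)) →
    IsState (withToken .search (Net.plug ⟨n, I, O⟩ H₂ C)) →
    StateRefines B Q (withToken .search (Net.plug ⟨n, I, O⟩ H₁ C))
      (withToken .search (Net.plug ⟨n, I, O⟩ H₂ C))

/-- `H₁` and `H₂` are contextually equivalent in `𝒞` up to `Q`. -/
def CtxEquiv (B : Behaviour S) (𝒞 : ContextSet S)
    (Q : ℕ → ℕ → Prop) {I O : List VLab} (H₁ H₂ : Net S I O) : Prop :=
  CtxRefines B 𝒞 Q H₁ H₂ ∧ CtxRefines B 𝒞 Q H₂ H₁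

variable {X : Type v} {A : Type w}

/-- Observational refinement `xs | as ⊢ t₁ ≼ t₂ : ⋆` of derivable judgements, in the contexts `𝒞`
and up to the universal relation on natural numbers. -/
def TermRefines (B : Behaviour S) (𝒞 : ContextSet S)
    (xs : List X) (as : List A) (t₁ t₂ : Term S X A) : Prop :=
  Derivable xs as t₁ star ∧ Derivable xs as t₂ star ∧
    CtxRefines B 𝒞 (fun _ _ => True) (translate t₁ star xs as) (translate t₂ star xs as)

/-- Observational equivalence `xs | as ⊢ t₁ ≃ t₂ : ⋆`. -/
def TermEquiv (B : Behaviour S) (𝒞 : ContextSet S)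
    (xs : List X) (as : List A) (t₁ t₂ : Term S X A) : Prop :=
  Derivable xs as t₁ star ∧ Derivable xs as t₂ star ∧
    CtxEquiv B 𝒞 (fun _ _ => True) (translate t₁ star xs as) (translate t₂ star xs as)

end Machine

end Spartan

/-! Refinement is quantified over all contexts of a class, so it is a congruence as soon as the
class is closed under composition with the contexts that term-contexts denote. Let `D` be the
hypernet with a hole obtained by translating one constructor of `C` with a hole edge in place of the
argument. If `M₁`, `M₂` are the translations of the two fillings and `T₁`, `T₂` those of the
argument, then `D[Tᵢ] ≅ Mᵢ`. For a surrounding context `E`, associativity of plugging gives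
`E[D][Tᵢ] ≅ E[D[Tᵢ]] ≅ E[Mᵢ]`. Hence the hypothesis on `T₁`, `T₂`, used in the context `E[D]`, is
the claim for `M₁`, `M₂` in the context `E` (`CtxRefines.of_context`), and induction on the typing
of `C` finishes the proof (`HasTyCtx.ctxRefines`). Equalities hold only up to isomorphism, so
states, final states and transitions must first be shown to be invariant under it.

A context with its holes and a term constructor with its arguments are the same thing: a hypergraph
in which some edges are placeholders for hypernets of given types. This is a skeleton (`Skel`), and
both plugging and the translation of binders and operations are isomorphic to the gluing of a
skeleton. Congruence (`Skel.glue_congr`), commutation with plugging (`Skel.plug_glue`) and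
well-formedness (`Skel.glue_isHypernet`) are proved once for gluing; associativity (`Net.plug_plug`)
and the isomorphism `D[Tᵢ] ≅ Mᵢ` follow. Thunks are treated apart, since their argument lies inside
a box. That `D` is a context requires the other arguments to translate to hypernets without holes
and tokens, which is where typing and the distinctness of variables and atoms enter
(`HasTy.translate_isPlain`).

For binding-free contexts, `E[D]` must again be binding-free (`Net.bindingFreeLevel_plug`). A path
of `E[D]` to the hole of `D` either stays in `D` or arrives through a source of the hole of `E`. It
cannot leave `D` and come back, since that would be a cycle of `E` through its hole, and hole edges
count as binding. Moreover `D` itself has to be binding-free: its hole is at the input (body of a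
binder), below a single operation edge at the input (arguments of an operation), or alone in a box
(thunk). For the bound term of a binder this fails in general, and binding-free term-contexts
exclude that position. -/

namespace Spartan

universe u v w

/-! ### Isomorphism of hypernets and what it preserves -/

section IsoBasics

variable {S : Sig.{u}} {I O : List VLab}

theorem Vtx.map_id {V : Type} (x : Vtx V I O) : x.map id = x := by cases x <;> rfl

theorem Vtx.map_map {U V W : Type} (f : U → V) (g : V → W) (x : Vtx U I O) :
    (x.map f).map g = x.map (g ∘ f) := by cases x <;> rfl

theorem Vtx.map_injective {V W : Type} {f : V → W} (hf : Function.Injective f) :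
    Function.Injective (Vtx.map f : Vtx V I O → Vtx W I O) := by
  intro x y h
  cases x <;> cases y <;> simp_all [Vtx.map]
  exact hf h

theorem Vtx.map_eq_inp {V W : Type} {f : V → W} {x : Vtx V I O} {i : Fin I.length} :
    x.map f = .inp i ↔ x = .inp i := by cases x <;> simp [Vtx.map]

theorem Vtx.map_eq_out {V W : Type} {f : V → W} {x : Vtx V I O} {i : Fin O.length} :
    x.map f = .out i ↔ x = .out i := by cases x <;> simp [Vtx.map]

theorem Vtx.map_equiv_symm {V W : Type} (f : V ≃ W) (x : Vtx V I O) :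
    (x.map f).map f.symm = x := by cases x <;> simp [Vtx.map]

theorem Vtx.map_equiv_apply {V W : Type} (f : V ≃ W) (x : Vtx W I O) :
    (x.map f.symm).map f = x := by cases x <;> simp [Vtx.map]

theorem Net.Iso.refl (G : Net S I O) : Net.Iso G G := by
  induction G with
  | mk V E vlab lab content src tgt ih =>
    refine .intro (Equiv.refl _) (Equiv.refl _) (fun _ => rfl) (fun _ => rfl) ?_ ?_ ?_
    · intro e i i' h
      obtain rfl : i = i' := Fin.ext h
      exact (Vtx.map_id _).symm
    · intro e i i' h
      obtain rfl : i = i' := Fin.ext h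
      exact (Vtx.map_id _).symm
    · intro e m cs os h h'
      exact ih e m cs os h

theorem Net.Iso.symm {G H : Net S I O} (h : Net.Iso G H) : Net.Iso H G := by
  induction h with
  | @intro I O G H fV fE hV hE hsrc htgt hbox ih =>
    refine .intro fV.symm fE.symm ?_ ?_ ?_ ?_ ?_
    · intro v
      rw [← hV, Equiv.apply_symm_apply]
    · intro e
      rw [← hE, Equiv.apply_symm_apply]
    · intro e i i' h
      obtain ⟨e, rfl⟩ := fE.surjective e
      -- The types of `i` and `i'` depend on the edge, so `fE.symm (fE e)` is first replaced by a
      -- variable.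
      have hx : fE.symm (fE e) = e := fE.symm_apply_apply e
      generalize fE.symm (fE e) = x at *
      subst hx
      rw [hsrc x i' i h.symm, Vtx.map_equiv_symm]
    · intro e i i' h
      obtain ⟨e, rfl⟩ := fE.surjective e
      have hx : fE.symm (fE e) = e := fE.symm_apply_apply e
      generalize fE.symm (fE e) = x at *
      subst hx
      rw [htgt x i' i h.symm, Vtx.map_equiv_symm]
    · intro e m cs os h h'
      obtain ⟨e, rfl⟩ := fE.surjective e
      have hx : fE.symm (fE e) = e := fE.symm_apply_apply e
      generalize fE.symm (fE e) = x at *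
      subst hx
      exact ih x m cs os h' h

theorem Net.Iso.trans {G H K : Net S I O} (h : Net.Iso G H) (h' : Net.Iso H K) :
    Net.Iso G K := by
  induction h with
  | @intro I O G H fV fE hV hE hsrc htgt hbox ih =>
    cases h' with
    | intro fV' fE' hV' hE' hsrc' htgt' hbox' =>
      refine .intro (fV.trans fV') (fE.trans fE') ?_ ?_ ?_ ?_ ?_
      · intro v
        exact (hV' _).trans (hV v)
      · intro e
        exact (hE' _).trans (hE e)
      · intro e i i' h
        have h1 := hsrc e i (i.cast (by rw [hE])) rfl
        have h2 := hsrc' (fE e) (i.cast (by rw [hE])) i' h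
        rw [h1, Vtx.map_map] at h2
        exact h2
      · intro e i i' h
        have h1 := htgt e i (i.cast (by rw [hE])) rfl
        have h2 := htgt' (fE e) (i.cast (by rw [hE])) i' h
        rw [h1, Vtx.map_map] at h2
        exact h2
      · intro e m cs os h h'
        have h'' : H.lab (fE e) = .box m cs os := (hE e).trans h
        exact ih e m cs os h h'' (hbox' (fE e) m cs os h'' h')

theorem Net.Everywhere.here {P : (I O : List VLab) → Net S I O → Prop} {G : Net S I O}
    (h : Net.Everywhere P G) : P I O G := by
  cases h with
  | intro here deep => exact here

theorem Net.Everywhere.deep {P : (I O : List VLab) → Net S I O → Prop} {G : Net S I O}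
    (h : Net.Everywhere P G) : ∀ e m cs os h, Net.Everywhere P (G.content e m cs os h) := by
  cases h with
  | intro here deep => exact deep

theorem Net.Everywhere.imp {P Q : (I O : List VLab) → Net S I O → Prop}
    (hPQ : ∀ I O G, P I O G → Q I O G) {G : Net S I O}
    (h : Net.Everywhere P G) : Net.Everywhere Q G := by
  induction h with
  | intro here deep ih => exact .intro (hPQ _ _ _ here) ih

/-- An isomorphism matches boxes with boxes and their contents up to isomorphism, so invariance at
one level propagates to all depths. Hypernets and all conditions on labels are instances. -/
theorem Net.Iso.everywhere {P : (I O : List VLab) → Net S I O → Prop}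
    (hP : ∀ I O (G H : Net S I O), Net.Iso G H → P I O G → P I O H)
    {G H : Net S I O} (h : Net.Iso G H) (hG : Net.Everywhere P G) : Net.Everywhere P H := by
  induction h with
  | @intro I O G H fV fE hV hE hsrc htgt hbox ih =>
    refine .intro (hP _ _ _ _ (.intro fV fE hV hE hsrc htgt hbox) hG.here) ?_
    intro e m cs os h
    obtain ⟨e, rfl⟩ := fE.surjective e
    exact ih e m cs os ((hE e).symm.trans h) h (hG.deep _ _ _ _ _)

/-- Properties of all edge labels, at any depth. -/
def Net.AllLabs (R : Lab S → Prop) (G : Net S I O) : Prop :=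
  Net.Everywhere (fun _ _ G => ∀ e, R (G.lab e)) G

theorem Net.Iso.allLabs {R : Lab S → Prop} {G H : Net S I O} (h : Net.Iso G H)
    (hG : G.AllLabs R) : H.AllLabs R := by
  refine h.everywhere ?_ hG
  intro I O G H h hG e
  cases h with
  | intro fV fE hV hE hsrc htgt hbox =>
    obtain ⟨e, rfl⟩ := fE.surjective e
    rw [hE]
    exact hG e

theorem Net.focusFree_iff {G : Net S I O} : G.FocusFree ↔ G.AllLabs (fun l => ∀ t, l ≠ .tok t) :=
  Iff.rfl

theorem Net.holeFree_iff {G : Net S I O} : G.HoleFree ↔ G.AllLabs (fun l => ∀ χ, l ≠ .hole χ) :=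
  Iff.rfl

theorem Net.Iso.isLevel {G H : Net S I O} (h : Net.Iso G H) (hG : G.IsLevel) : H.IsLevel := by
  cases h with
  | intro fV fE hV hE hsrc htgt hbox =>
    have hlab : ∀ v : G.Vert, H.vertLab (v.map fV) = G.vertLab v := by
      intro v; cases v
      · exact hV _
      · rfl
      · rfl
    have hget : ∀ {l l' : List VLab} (_ : l = l') (i : Fin l.length) (i' : Fin l'.length),
        i.val = i'.val → l.get i = l'.get i' := by
      intro l l' h i i' hi; subst h; obtain rfl := Fin.ext hi; rfl
    have hmap : Function.Injective (Vtx.map fV : G.Vert → H.Vert) := Vtx.map_injective fV.injective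
    refine ⟨?_, ?_, ?_, ?_, ?_, ?_, ?_, ?_, ?_⟩
    · have := hG.finiteV; exact Finite.of_equiv _ fV
    · have := hG.finiteE; exact Finite.of_equiv _ fE
    · intro e i
      obtain ⟨e, rfl⟩ := fE.surjective e
      rw [hsrc e (i.cast (by rw [hE])) i rfl, hlab, hG.src_lab]
      exact hget (by rw [hE]) _ _ rfl
    · intro e i
      obtain ⟨e, rfl⟩ := fE.surjective e
      rw [htgt e (i.cast (by rw [hE])) i rfl, hlab, hG.tgt_lab]
      exact hget (by rw [hE]) _ _ rfl
    · rintro ⟨e, i⟩ ⟨e', i'⟩ h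
      obtain ⟨e, rfl⟩ := fE.surjective e
      obtain ⟨e', rfl⟩ := fE.surjective e'
      dsimp only at h
      rw [hsrc e (i.cast (by rw [hE])) i rfl, hsrc e' (i'.cast (by rw [hE])) i' rfl] at h
      have := @hG.src_inj ⟨e, _⟩ ⟨e', _⟩ (hmap h)
      obtain ⟨h1, h2⟩ := Sigma.mk.inj_iff.1 this
      subst h1
      simpa [Fin.ext_iff] using h2
    · rintro ⟨e, i⟩ ⟨e', i'⟩ h
      obtain ⟨e, rfl⟩ := fE.surjective e
      obtain ⟨e', rfl⟩ := fE.surjective e'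
      dsimp only at h
      rw [htgt e (i.cast (by rw [hE])) i rfl, htgt e' (i'.cast (by rw [hE])) i' rfl] at h
      have := @hG.tgt_inj ⟨e, _⟩ ⟨e', _⟩ (hmap h)
      obtain ⟨h1, h2⟩ := Sigma.mk.inj_iff.1 this
      subst h1
      simpa [Fin.ext_iff] using h2
    · intro v
      have hv : v = (v.map fV.symm).map fV := (Vtx.map_equiv_apply fV v).symm
      have := hG.input_iff (v.map fV.symm)
      simp only [Vtx.map_eq_inp] at this
      rw [this, not_iff_not]
      constructor
      · rintro ⟨e, j, h⟩
        exact ⟨fE e, j.cast (by rw [hE]), by rw [htgt e j _ rfl, h, ← hv]⟩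
      · rintro ⟨e, j, h⟩
        obtain ⟨e, rfl⟩ := fE.surjective e
        refine ⟨e, j.cast (by rw [hE]), ?_⟩
        apply hmap
        rw [← htgt e _ j rfl, h, ← hv]
    · intro v
      have hv : v = (v.map fV.symm).map fV := (Vtx.map_equiv_apply fV v).symm
      have := hG.output_iff (v.map fV.symm)
      simp only [Vtx.map_eq_out] at this
      rw [this, not_iff_not]
      constructor
      · rintro ⟨e, j, h⟩
        exact ⟨fE e, j.cast (by rw [hE]), by rw [hsrc e j _ rfl, h, ← hv]⟩
      · rintro ⟨e, j, h⟩
        obtain ⟨e, rfl⟩ := fE.surjective e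
        refine ⟨e, j.cast (by rw [hE]), ?_⟩
        apply hmap
        rw [← hsrc e _ j rfl, h, ← hv]
    · intro e m cs os h
      obtain ⟨e, rfl⟩ := fE.surjective e
      exact hG.box_ty e m cs os ((hE e).symm.trans h)

theorem Net.Iso.isHypernet {G H : Net S I O} (h : Net.Iso G H) (hG : G.IsHypernet) :
    H.IsHypernet :=
  h.everywhere (fun _ _ _ _ h => h.isLevel) hG

theorem Net.Iso.focussed {G H : Net S I O} (h : Net.Iso G H) (hG : G.Focussed) :
    H.Focussed := by
  cases h with
  | intro fV fE hV hE hsrc htgt hbox =>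
    obtain ⟨⟨e, t, he, huniq, hloop, hexp⟩, hdeep⟩ := hG
    refine ⟨⟨fE e, t, (hE e).trans he, ?_, ?_, ?_⟩, ?_⟩
    · intro e' t' h'
      obtain ⟨e', rfl⟩ := fE.surjective e'
      rw [huniq e' t' ((hE e').symm.trans h')]
    · intro i j h
      rw [hsrc e (i.cast (by rw [hE])) i rfl, htgt e (j.cast (by rw [hE])) j rfl] at h
      exact hloop _ _ (Vtx.map_injective fV.injective h)
    · rintro ⟨h1, h2⟩
      refine hexp ⟨fun i => ?_, fun j => ?_⟩
      · obtain ⟨n, hn⟩ := h1 (i.cast (by rw [hE]))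
        rw [hsrc e i _ rfl, Vtx.map_eq_inp] at hn
        exact ⟨n, hn⟩
      · obtain ⟨n, hn⟩ := h2 (j.cast (by rw [hE]))
        rw [htgt e j _ rfl, Vtx.map_eq_out] at hn
        exact ⟨n, hn⟩
    · intro e m cs os h
      obtain ⟨e, rfl⟩ := fE.surjective e
      exact (hbox e m cs os ((hE e).symm.trans h) h).allLabs
        (Net.focusFree_iff.1 (hdeep e m cs os ((hE e).symm.trans h)))

theorem Net.Iso.isState {G H : Prog S} (h : Net.Iso G H) (hG : IsState G) : IsState H :=
  ⟨h.isHypernet hG.1, h.allLabs (Net.holeFree_iff.1 hG.2.1), h.focussed hG.2.2⟩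

theorem Net.Iso.isFinal {G H : Prog S} (h : Net.Iso G H) (hG : IsFinal G) : IsFinal H := by
  obtain ⟨hs, K, hK, hGK⟩ := hG
  exact ⟨h.isState hs, K, hK, h.symm.trans hGK⟩

theorem Net.Iso.tokenIn {G H : Net S I O} (h : Net.Iso G H) (t : Token) (i : Fin I.length) :
    Net.Iso (G.tokenIn t i) (H.tokenIn t i) := by
  cases h with
  | intro fV fE hV hE hsrc htgt hbox =>
    have hmap : ∀ (v : G.Vert) (w : H.Vert), w = v.map fV →
        (match w with
          | .inner v => .inner (.inl v)
          | .inp k => if k = i then .inner (.inr ()) else .inp k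
          | .out j => .out j : Vtx (H.V ⊕ Unit) I O) =
        (match v with
          | .inner v => .inner (.inl v)
          | .inp k => if k = i then .inner (.inr ()) else .inp k
          | .out j => .out j : Vtx (G.V ⊕ Unit) I O).map (Sum.map fV id) := by
      rintro v _ rfl
      cases v
      · rfl
      · simp only [Vtx.map]
        split_ifs <;> rfl
      · rfl
    refine .intro (Equiv.sumCongr fV (Equiv.refl _)) (Equiv.sumCongr fE (Equiv.refl _))
      ?_ ?_ ?_ ?_ ?_
    · rintro (v | v)
      · exact hV v
      · rfl
    · rintro (e | e)
      · exact hE e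
      · rfl
    · rintro (e | e) k k' hk
      · exact hmap _ _ (hsrc e k k' hk)
      · rfl
    · rintro (e | e) k k' hk
      · exact hmap _ _ (htgt e k k' hk)
      · rfl
    · rintro (e | e) m cs os h h'
      · exact hbox e m cs os h h'
      · cases h

/-- Each kind of transition reads its first state only up to isomorphism. -/
theorem Net.Iso.transition {B : Behaviour S} {G H M : Prog S} (h : Net.Iso G H)
    (hG : Transition B G M) : Transition B H M := by
  rcases hG with ⟨χ, K, K', C, h1, h2, h3, h4, h5, h6, h7⟩ | ⟨χ, K, K', C, h1, h2, h3, h4, h5, h6, h7⟩ |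
    ⟨K, K', h1, h2, h3⟩
  · exact .inl ⟨χ, K, K', C, h1, h2, h3, h4, h5, h.symm.trans h6, h7⟩
  · exact .inr (.inl ⟨χ, K, K', C, h1, h2, h3, h4, h5, h.symm.trans h6, h7⟩)
  · exact .inr (.inr ⟨K, K', h1, h.symm.trans h2, h3⟩)

/-- A run of length 0 is an equality, so there the final state itself has to be moved along the
isomorphism. In a longer run only the first transition sees the initial state, and the rest is kept.
-/
theorem Net.Iso.exists_final {B : Behaviour S} {G H M : Prog S} (h : Net.Iso G H) {k : ℕ}
    (hG : Transitions B k G M) (hM : IsFinal M) :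
    ∃ M', Transitions B k H M' ∧ IsFinal M' := by
  cases k with
  | zero =>
    obtain rfl : G = M := hG
    exact ⟨H, rfl, h.isFinal hM⟩
  | succ k =>
    obtain ⟨K, h1, h2⟩ := hG
    exact ⟨M, ⟨K, h.transition h1, h2⟩, hM⟩

theorem StateRefines.of_iso {B : Behaviour S} {Q : ℕ → ℕ → Prop} {G H G' H' : Prog S}
    (h : StateRefines B Q G H) (hG : Net.Iso G G') (hH : Net.Iso H H') :
    StateRefines B Q G' H' := by
  intro k M h1 hM
  obtain ⟨M₁, h2, hM₁⟩ := hG.symm.exists_final h1 hM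
  obtain ⟨k₂, M₂, hQ, h3, hM₂⟩ := h k M₁ h2 hM₁
  obtain ⟨M₃, h4, hM₃⟩ := hH.exists_final h3 hM₂
  exact ⟨k₂, M₃, hQ, h4, hM₃⟩

end IsoBasics

/-! ## Gluing hypernets along a skeleton -/

/-- A skeleton: a hypergraph with primitive edges `Q`, and with parts `P` to be filled with
hypernets of given types. -/
structure Skel (S : Sig.{u}) (I O : List VLab) : Type (max 1 u) where
  V : Type
  Q : Type
  P : Type
  vlab : V → VLab
  lab : Q → Lab S
  content : (q : Q) → (m : ℕ) → (cs os : List VLab) → lab q = .box m cs os → Net S [star] cs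
  src : (q : Q) → Fin (lab q).dom.length → Vtx V I O
  tgt : (q : Q) → Fin (lab q).cod.length → Vtx V I O
  ins : P → List VLab
  outs : P → List VLab
  psrc : (p : P) → Fin (ins p).length → Vtx V I O
  ptgt : (p : P) → Fin (outs p).length → Vtx V I O

section Glue

variable {S : Sig.{u}} {I O : List VLab}

/-- The embedding of the vertices of a part. -/
def Skel.emb (K : Skel S I O) (N : (p : K.P) → Net S (K.ins p) (K.outs p)) (p : K.P)
    (v : (N p).Vert) : Vtx (K.V ⊕ Σ p, (N p).V) I O :=
  match v with
  | .inner v => .inner (.inr ⟨p, v⟩)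
  | .inp i => (K.psrc p i).map .inl
  | .out j => (K.ptgt p j).map .inl

/-- The parts of a skeleton are filled. -/
def Skel.glue (K : Skel S I O) (N : (p : K.P) → Net S (K.ins p) (K.outs p)) : Net S I O :=
  .mk (K.V ⊕ Σ p, (N p).V) (K.Q ⊕ Σ p, (N p).E)
    (fun v => match v with
      | .inl v => K.vlab v
      | .inr v => (N v.1).vlab v.2)
    (fun e => match e with
      | .inl q => K.lab q
      | .inr e => (N e.1).lab e.2)
    (fun e => match e with
      | .inl q => fun m cs os h => K.content q m cs os h
      | .inr e => fun m cs os h => (N e.1).content e.2 m cs os h)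
    (fun e => match e with
      | .inl q => fun i => (K.src q i).map .inl
      | .inr e => fun i => K.emb N e.1 ((N e.1).src e.2 i))
    (fun e => match e with
      | .inl q => fun i => (K.tgt q i).map .inl
      | .inr e => fun i => K.emb N e.1 ((N e.1).tgt e.2 i))

/-- The contents of the boxes are replaced. -/
abbrev Skel.withContent (K : Skel S I O) (c : (q : K.Q) → (m : ℕ) → (cs os : List VLab) →
    K.lab q = .box m cs os → Net S [star] cs) : Skel S I O :=
  { K with content := c }

theorem Net.Iso.exists_equiv {G H : Net S I O} (h : Net.Iso G H) :
    ∃ (fV : G.V ≃ H.V) (fE : G.E ≃ H.E), (∀ v, H.vlab (fV v) = G.vlab v) ∧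
      (∀ e, H.lab (fE e) = G.lab e) ∧
      (∀ e i i', i.val = i'.val → H.src (fE e) i' = (G.src e i).map fV) ∧
      (∀ e i i', i.val = i'.val → H.tgt (fE e) i' = (G.tgt e i).map fV) ∧
      (∀ e m cs os h h', Net.Iso (G.content e m cs os h) (H.content (fE e) m cs os h')) := by
  cases h with
  | intro fV fE hV hE hsrc htgt hbox => exact ⟨fV, fE, hV, hE, hsrc, htgt, hbox⟩

/-- The vertices and edges of the parts form disjoint sums, so isomorphisms of the parts add up to
one of the whole. Box contents are allowed to change as well because plugging also acts inside the
boxes. -/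
theorem Skel.glue_congr (K : Skel S I O) {N N' : (p : K.P) → Net S (K.ins p) (K.outs p)}
    (c : (q : K.Q) → (m : ℕ) → (cs os : List VLab) → K.lab q = .box m cs os → Net S [star] cs)
    (hc : ∀ q m cs os h, Net.Iso (K.content q m cs os h) (c q m cs os h))
    (hN : ∀ p, Net.Iso (N p) (N' p)) : Net.Iso (K.glue N) ((K.withContent c).glue N') := by
  choose fV fE hV hE hsrc htgt hbox using fun p => (hN p).exists_equiv
  have hinl : ∀ v : Vtx K.V I O, (v.map .inl : Vtx (K.V ⊕ Σ p, (N' p).V) I O) =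
      (v.map .inl : Vtx (K.V ⊕ Σ p, (N p).V) I O).map
        (Sum.map id (Sigma.map id fun p => fV p)) := by
    intro v
    rw [Vtx.map_map]; rfl
  have hmap : ∀ (p : K.P) (v : (N p).Vert) (w : (N' p).Vert), w = v.map (fV p) →
      (K.withContent c).emb N' p w =
        (K.emb N p v).map (Sum.map id (Sigma.map id fun p => fV p)) := by
    rintro p v _ rfl
    cases v
    · rfl
    · exact hinl _
    · exact hinl _
  refine .intro (Equiv.sumCongr (Equiv.refl _) (Equiv.sigmaCongrRight fV))
    (Equiv.sumCongr (Equiv.refl _) (Equiv.sigmaCongrRight fE)) ?_ ?_ ?_ ?_ ?_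
  · rintro (v | ⟨p, v⟩)
    · rfl
    · exact hV p v
  · rintro (e | ⟨p, e⟩)
    · rfl
    · exact hE p e
  · rintro (e | ⟨p, e⟩) i i' h
    · obtain rfl : i = i' := Fin.ext h
      exact hinl _
    · exact hmap p _ _ (hsrc p e i i' h)
  · rintro (e | ⟨p, e⟩) i i' h
    · obtain rfl : i = i' := Fin.ext h
      exact hinl _
    · exact hmap p _ _ (htgt p e i i' h)
  · rintro (e | ⟨p, e⟩) m cs os h h'
    · exact hc e m cs os h
    · exact hbox p e m cs os h h'

/-! ### Plugging as gluing, and associativity of plugging -/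

section Plug

variable (χ : Hole) (H : Net S χ.ins χ.outs)

/-- The embedding of the vertices of the plugged hypernet. -/
def plugEmb {V E : Type} {lab : E → Lab S} (src : (e : E) → Fin (lab e).dom.length → Vtx V I O)
    (tgt : (e : E) → Fin (lab e).cod.length → Vtx V I O) (e : {e : E // lab e = .hole χ})
    (v : H.Vert) : Vtx (V ⊕ ({e : E // lab e = .hole χ} × H.V)) I O :=
  match v with
  | .inner v => .inner (.inr (e, v))
  | .inp i => (src e.1 (i.cast (by rw [e.2]; rfl))).map .inl
  | .out j => (tgt e.1 (j.cast (by rw [e.2]; rfl))).map .inl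

/-- One step of plugging. -/
def plugStep (V E : Type) (vlab : V → VLab) (lab : E → Lab S)
    (plugged : (e : E) → (m : ℕ) → (cs os : List VLab) → lab e = .box m cs os → Net S [star] cs)
    (src : (e : E) → Fin (lab e).dom.length → Vtx V I O)
    (tgt : (e : E) → Fin (lab e).cod.length → Vtx V I O) : Net S I O :=
  .mk (V ⊕ ({e : E // lab e = .hole χ} × H.V))
    ({e : E // lab e ≠ .hole χ} ⊕ ({e : E // lab e = .hole χ} × H.E))
    (fun v => match v with
      | .inl v => vlab v
      | .inr v => H.vlab v.2)
    (fun e => match e with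
      | .inl e => lab e.1
      | .inr e => H.lab e.2)
    (fun e => match e with
      | .inl e => fun m cs os h => plugged e.1 m cs os h
      | .inr e => fun m cs os h => H.content e.2 m cs os h)
    (fun e => match e with
      | .inl e => fun i => (src e.1 i).map .inl
      | .inr e => fun i => plugEmb χ H src tgt e.1 (H.src e.2 i))
    (fun e => match e with
      | .inl e => fun i => (tgt e.1 i).map .inl
      | .inr e => fun i => plugEmb χ H src tgt e.1 (H.tgt e.2 i))

/-- Unfolds the recursor once, so that plugging can be studied level by level. -/
theorem Net.plug_eq (C : Net S I O) :
    Net.plug χ H C = plugStep χ H C.V C.E C.vlab C.lab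
      (fun e m cs os h => Net.plug χ H (C.content e m cs os h)) C.src C.tgt := by
  cases C
  rfl

end Plug

/-- A context as a skeleton, its holes being the parts. -/
noncomputable def Net.plugSkel (C : Net S I O) (χ : Hole) (H : Net S χ.ins χ.outs) :
    Skel S I O where
  V := C.V
  Q := {e : C.E // C.lab e ≠ .hole χ}
  P := {e : C.E // C.lab e = .hole χ}
  vlab := C.vlab
  lab e := C.lab e.1
  content e m cs os h := Net.plug χ H (C.content e.1 m cs os h)
  src e i := C.src e.1 i
  tgt e i := C.tgt e.1 i
  ins _ := χ.ins
  outs _ := χ.outs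
  psrc e i := C.src e.1 (i.cast (by rw [e.2]; rfl))
  ptgt e j := C.tgt e.1 (j.cast (by rw [e.2]; rfl))

/-- The two sides differ only in that copies of `H` are indexed by a product on the left and by a
constant sigma type on the right. This transfers what is proved for gluing to plugging. -/
theorem Net.plug_iso_glue (χ : Hole) (H : Net S χ.ins χ.outs) (C : Net S I O) :
    Net.Iso (Net.plug χ H C) ((C.plugSkel χ H).glue fun _ => H) := by
  have hinl : ∀ v : C.Vert, (v.map .inl : Vtx (C.V ⊕
      Σ _ : {e : C.E // C.lab e = .hole χ}, H.V) I O) = (v.map .inl :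
        Vtx (C.V ⊕ ({e : C.E // C.lab e = .hole χ} × H.V)) I O).map
          (Sum.map id fun x => ⟨x.1, x.2⟩) := by
    intro v
    cases v <;> rfl
  have hemb : ∀ (e : {e : C.E // C.lab e = .hole χ}) (v : H.Vert),
      (C.plugSkel χ H).emb (fun _ => H) e v =
        (plugEmb χ H C.src C.tgt e v).map (Sum.map id fun x => ⟨x.1, x.2⟩) := by
    intro e v
    cases v
    · rfl
    · exact hinl _
    · exact hinl _
  rw [Net.plug_eq]
  refine .intro (Equiv.sumCongr (Equiv.refl _) (Equiv.sigmaEquivProd _ _).symm)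
    (Equiv.sumCongr (Equiv.refl _) (Equiv.sigmaEquivProd _ _).symm) ?_ ?_ ?_ ?_ ?_
  · rintro (v | v) <;> rfl
  · rintro (v | v) <;> rfl
  · rintro (e | ⟨e, d⟩) i i' h
    · obtain rfl : i = i' := Fin.ext h
      exact hinl (C.src e.1 i)
    · obtain rfl : i = i' := Fin.ext h
      exact hemb e (H.src d i)
  · rintro (e | ⟨e, d⟩) i i' h
    · obtain rfl : i = i' := Fin.ext h
      exact hinl (C.tgt e.1 i)
    · obtain rfl : i = i' := Fin.ext h
      exact hemb e (H.tgt d i)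
  · rintro (e | ⟨e, d⟩) m cs os h h'
    · exact .refl _
    · exact .refl _

theorem Net.Iso.plug {χ : Hole} {H H' : Net S χ.ins χ.outs} (h : Net.Iso H H')
    (C : Net S I O) : Net.Iso (Net.plug χ H C) (Net.plug χ H' C) := by
  induction C with
  | mk V E vlab lab content src tgt ih =>
    refine (Net.plug_iso_glue ..).trans (.trans ?_ (Net.plug_iso_glue ..).symm)
    exact Skel.glue_congr _ _ (fun q m cs os hq => ih q.1 m cs os hq) (fun _ => h)

/-- Here the skeleton itself varies, so `Skel.glue_congr` does not apply. Since labels are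
preserved, the bijection of edges restricts to hole edges and to the others. -/
theorem Net.Iso.plug_ctx {χ : Hole} (H : Net S χ.ins χ.outs) {C C' : Net S I O}
    (h : Net.Iso C C') : Net.Iso (Net.plug χ H C) (Net.plug χ H C') := by
  induction h with
  | @intro I O C C' fV fE hV hE hsrc htgt hbox ih =>
    rw [Net.plug_eq, Net.plug_eq]
    let f₁ : {e : C.E // C.lab e = .hole χ} ≃ {e : C'.E // C'.lab e = .hole χ} :=
      fE.subtypeEquiv fun e => by rw [hE]
    let f₂ : {e : C.E // C.lab e ≠ .hole χ} ≃ {e : C'.E // C'.lab e ≠ .hole χ} :=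
      fE.subtypeEquiv fun e => by rw [hE]
    have hinl : ∀ (v : C.Vert) (w : C'.Vert), w = v.map fV →
        (w.map .inl : Vtx (C'.V ⊕ ({e : C'.E // C'.lab e = .hole χ} × H.V)) I O) =
          (v.map .inl : Vtx (C.V ⊕ ({e : C.E // C.lab e = .hole χ} × H.V)) I O).map
          (Sum.map fV (Prod.map f₁ id)) := by
      rintro v _ rfl
      simp only [Vtx.map_map]; rfl
    have hemb : ∀ (e : {e : C.E // C.lab e = .hole χ}) (v : H.Vert),
        plugEmb χ H C'.src C'.tgt (f₁ e) v = (plugEmb χ H C.src C.tgt e v).map (Sum.map fV (Prod.map f₁ id)) := by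
      intro e v
      cases v
      · rfl
      · exact hinl _ _ (hsrc e.1 _ _ rfl)
      · exact hinl _ _ (htgt e.1 _ _ rfl)
    refine .intro (Equiv.sumCongr fV (Equiv.prodCongr f₁ (Equiv.refl _)))
      (Equiv.sumCongr f₂ (Equiv.prodCongr f₁ (Equiv.refl _))) ?_ ?_ ?_ ?_ ?_
    · rintro (v | v)
      · exact hV v
      · rfl
    · rintro (v | v)
      · exact hE v.1
      · rfl
    · rintro (e | ⟨e, d⟩) i i' h
      · exact hinl _ _ (hsrc e.1 i i' h)
      · obtain rfl : i = i' := Fin.ext h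
        exact hemb e _
    · rintro (e | ⟨e, d⟩) i i' h
      · exact hinl _ _ (htgt e.1 i i' h)
      · obtain rfl : i = i' := Fin.ext h
        exact hemb e _
    · rintro (e | ⟨e, d⟩) m cs os h h'
      · exact ih e.1 m cs os h h'
      · exact .refl _

/-- By `hK` all shallow holes `χ` lie in the parts, so the copies of `T` can be assigned to the
parts that contain them. The bijections only regroup the summands. -/
theorem Skel.plug_glue {χ : Hole} (T : Net S χ.ins χ.outs) (K : Skel S I O)
    (N : (p : K.P) → Net S (K.ins p) (K.outs p)) (hK : ∀ q, K.lab q ≠ .hole χ) :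
    Net.Iso (Net.plug χ T (K.glue N))
      ((K.withContent fun q m cs os h => Net.plug χ T (K.content q m cs os h)).glue
        fun p => Net.plug χ T (N p)) := by
  have hN : (fun p => Net.plug χ T (N p)) = _ := funext fun p => Net.plug_eq χ T (N p)
  rw [hN, Net.plug_eq]
  let fV : (K.V ⊕ Σ p, (N p).V) ⊕ ({e : (K.glue N).E // (K.glue N).lab e = .hole χ} × T.V) ≃
      K.V ⊕ Σ p, ((N p).V ⊕ ({e : (N p).E // (N p).lab e = .hole χ} × T.V)) :=
    { toFun := fun x => match x with
        | .inl (.inl v) => .inl v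
        | .inl (.inr ⟨p, v⟩) => .inr ⟨p, .inl v⟩
        | .inr (⟨.inl q, h⟩, _) => (hK q h).elim
        | .inr (⟨.inr ⟨p, e⟩, h⟩, v) => .inr ⟨p, .inr (⟨e, h⟩, v)⟩
      invFun := fun x => match x with
        | .inl v => .inl (.inl v)
        | .inr ⟨p, .inl v⟩ => .inl (.inr ⟨p, v⟩)
        | .inr ⟨p, .inr (⟨e, h⟩, v)⟩ => .inr (⟨.inr ⟨p, e⟩, h⟩, v)
      left_inv := by
        rintro ((v | ⟨p, v⟩) | ⟨⟨q | ⟨p, e⟩, h⟩, v⟩)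
        · rfl
        · rfl
        · exact (hK q h).elim
        · rfl
      right_inv := by rintro (v | ⟨p, v | ⟨⟨e, h⟩, v⟩⟩) <;> rfl }
  let fE : {e : (K.glue N).E // (K.glue N).lab e ≠ .hole χ} ⊕
        ({e : (K.glue N).E // (K.glue N).lab e = .hole χ} × T.E) ≃
      K.Q ⊕ Σ p, ({e : (N p).E // (N p).lab e ≠ .hole χ} ⊕
        ({e : (N p).E // (N p).lab e = .hole χ} × T.E)) :=
    { toFun := fun x => match x with
        | .inl ⟨.inl q, _⟩ => .inl q
        | .inl ⟨.inr ⟨p, e⟩, h⟩ => .inr ⟨p, .inl ⟨e, h⟩⟩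
        | .inr (⟨.inl q, h⟩, _) => (hK q h).elim
        | .inr (⟨.inr ⟨p, e⟩, h⟩, d) => .inr ⟨p, .inr (⟨e, h⟩, d)⟩
      invFun := fun x => match x with
        | .inl q => .inl ⟨.inl q, hK q⟩
        | .inr ⟨p, .inl ⟨e, h⟩⟩ => .inl ⟨.inr ⟨p, e⟩, h⟩
        | .inr ⟨p, .inr (⟨e, h⟩, d)⟩ => .inr (⟨.inr ⟨p, e⟩, h⟩, d)
      left_inv := by
        rintro (⟨q | ⟨p, e⟩, h⟩ | ⟨⟨q | ⟨p, e⟩, h⟩, d⟩)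
        · rfl
        · rfl
        · exact (hK q h).elim
        · rfl
      right_inv := by rintro (q | ⟨p, ⟨e, h⟩ | ⟨⟨e, h⟩, d⟩⟩) <;> rfl }
  have hinl : ∀ v : Vtx K.V I O, (v.map .inl : Vtx (K.V ⊕ Σ p, ((N p).V ⊕
      ({e : (N p).E // (N p).lab e = .hole χ} × T.V))) I O) =
        ((v.map .inl : (K.glue N).Vert).map .inl).map fV := by
    intro v
    cases v <;> rfl
  have hN : ∀ p (v : (N p).Vert),
      (K.withContent fun q m cs os h => Net.plug χ T (K.content q m cs os h)).emb
        (fun p => plugStep χ T (N p).V (N p).E (N p).vlab (N p).lab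
          (fun e m cs os h => Net.plug χ T ((N p).content e m cs os h)) (N p).src (N p).tgt) p (v.map .inl) = ((K.emb N p v : (K.glue N).Vert).map .inl).map fV := by
    intro p v
    cases v
    · rfl
    · exact hinl _
    · exact hinl _
  have hT : ∀ p e (h : (N p).lab e = .hole χ) (v : T.Vert),
      (K.withContent fun q m cs os h => Net.plug χ T (K.content q m cs os h)).emb
        (fun p => plugStep χ T (N p).V (N p).E (N p).vlab (N p).lab
          (fun e m cs os h => Net.plug χ T ((N p).content e m cs os h)) (N p).src (N p).tgt) p (plugEmb χ T (N p).src (N p).tgt ⟨e, h⟩ v) =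
        (plugEmb χ T (K.glue N).src (K.glue N).tgt ⟨.inr ⟨p, e⟩, h⟩ v).map fV := by
    intro p e h v
    cases v
    · rfl
    · exact hN _ _
    · exact hN _ _
  refine .intro fV fE ?_ ?_ ?_ ?_ ?_
  · rintro ((v | ⟨p, v⟩) | ⟨⟨q | ⟨p, e⟩, h⟩, v⟩)
    · rfl
    · rfl
    · exact (hK q h).elim
    · rfl
  · rintro (⟨q | ⟨p, e⟩, h⟩ | ⟨⟨q | ⟨p, e⟩, h⟩, d⟩)
    · rfl
    · rfl
    · exact (hK q h).elim
    · rfl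
  · rintro (⟨q | ⟨p, e⟩, h⟩ | ⟨⟨q | ⟨p, e⟩, h⟩, d⟩) i i' hi
    · obtain rfl : i = i' := Fin.ext hi
      exact hinl _
    · obtain rfl : i = i' := Fin.ext hi
      exact hN _ _
    · exact (hK q h).elim
    · obtain rfl : i = i' := Fin.ext hi
      exact hT _ _ _ _
  · rintro (⟨q | ⟨p, e⟩, h⟩ | ⟨⟨q | ⟨p, e⟩, h⟩, d⟩) i i' hi
    · obtain rfl : i = i' := Fin.ext hi
      exact hinl _
    · obtain rfl : i = i' := Fin.ext hi
      exact hN _ _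
    · exact (hK q h).elim
    · obtain rfl : i = i' := Fin.ext hi
      exact hT _ _ _ _
  · rintro (⟨q | ⟨p, e⟩, h⟩ | ⟨⟨q | ⟨p, e⟩, h⟩, d⟩) m cs os h1 h2
    · exact .refl _
    · exact .refl _
    · exact (hK q h).elim
    · exact .refl _

/-- With `C` seen as a skeleton whose parts are its holes, plugging `T` passes to the copies of `D`
by `Skel.plug_glue`, and to the boxes of `C` by induction. All holes of `C` have the label `χ'`, so
after plugging `D` the holes `χ` are exactly those of the copies of `D`. -/
theorem Net.plug_plug {χ χ' : Hole} (T : Net S χ.ins χ.outs) (D : Net S χ'.ins χ'.outs)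
    (C : Net S I O) (hC : C.AllLabs fun l => ∀ χ, l = .hole χ → χ = χ') :
    Net.Iso (Net.plug χ T (Net.plug χ' D C)) (Net.plug χ' (Net.plug χ T D) C) := by
  induction C with
  | mk V E vlab lab content src tgt ih =>
    -- An edge of `C` not labelled `χ'` is no hole at all. This holds whether or not `χ` and `χ'`
    -- coincide.
    have hK : ∀ q, ((Net.mk V E vlab lab content src tgt).plugSkel χ' D).lab q ≠ .hole χ := by
      intro q h
      exact q.2 (Eq.trans h (congrArg Lab.hole (hC.here q.1 χ h)))
    refine (Net.Iso.plug_ctx T (Net.plug_iso_glue ..)).trans ((Skel.plug_glue T _ _ hK).trans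
      (.trans ?_ (Net.plug_iso_glue ..).symm))
    exact Skel.glue_congr _ _ (fun q m cs os hq => ih q.1 m cs os hq (hC.deep q.1 m cs os hq))
      (fun _ => .refl _)

theorem Net.plug_of_ne {χ : Hole} (T : Net S χ.ins χ.outs) (N : Net S I O)
    (hN : N.AllLabs (· ≠ .hole χ)) : Net.Iso (Net.plug χ T N) N := by
  induction N with
  | mk V E vlab lab content src tgt ih =>
    rw [Net.plug_eq]
    have h0 : ∀ e, lab e ≠ .hole χ := hN.here
    have : IsEmpty {e // lab e = .hole χ} := ⟨fun e => h0 e.1 e.2⟩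
    apply Net.Iso.symm
    refine .intro (Equiv.sumEmpty V ({e // lab e = .hole χ} × T.V)).symm
      ((Equiv.subtypeUnivEquiv h0).symm.trans
        (Equiv.sumEmpty {e // lab e ≠ .hole χ} ({e // lab e = .hole χ} × T.E)).symm)
        ?_ ?_ ?_ ?_ ?_
    · intro v; rfl
    · intro e; rfl
    · intro e i i' h
      obtain rfl : i = i' := Fin.ext h
      rfl
    · intro e i i' h
      obtain rfl : i = i' := Fin.ext h
      rfl
    · intro e m cs os h h'
      exact (ih e m cs os h (hN.deep e m cs os h)).symm

theorem Net.plug_edge {χ : Hole} (T : Net S χ.ins χ.outs) :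
    Net.Iso (Net.plug χ T (Net.edge (.hole χ) nofun)) T := by
  rw [Net.plug_eq]
  let u : {e : Unit // (.hole χ : Lab S) = .hole χ} := ⟨(), rfl⟩
  apply Net.Iso.symm
  have hemb : ∀ v : T.Vert, plugEmb χ T (Net.edge (S := S) (.hole χ) nofun).src
      (Net.edge (S := S) (.hole χ) nofun).tgt u v = v.map fun v => .inr (u, v) := by
    intro v
    cases v <;> rfl
  have he : ∀ e : {e : Unit // (.hole χ : Lab S) ≠ .hole χ}, False := fun e => e.2 rfl
  refine .intro
    { toFun := fun v => .inr (u, v)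
      invFun := fun v => match v with
        | .inl v => v.elim
        | .inr v => v.2
      left_inv := fun _ => rfl
      right_inv := by
        rintro (v | ⟨u, v⟩)
        · exact v.elim
        · rfl }
    { toFun := fun e => .inr (u, e)
      invFun := fun v => match v with
        | .inl v => (he v).elim
        | .inr v => v.2
      left_inv := fun _ => rfl
      right_inv := by
        rintro (v | ⟨u, v⟩)
        · exact (he v).elim
        · rfl } ?_ ?_ ?_ ?_ ?_
  · intro v; rfl
  · intro e; rfl
  · intro e i i' h
    obtain rfl : i = i' := Fin.ext h
    exact hemb _
  · intro e i i' h
    obtain rfl : i = i' := Fin.ext h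
    exact hemb _
  · intro e m cs os h h'
    exact .refl _

/-! ### Gluing levels -/

theorem Net.IsLevel.src_ne_out {G : Net S I O} (h : G.IsLevel) (e i j) :
    G.src e i ≠ .out j := fun h' => (h.output_iff (.out j)).1 ⟨j, rfl⟩ ⟨e, i, h'⟩

theorem Net.IsLevel.tgt_ne_inp {G : Net S I O} (h : G.IsLevel) (e i j) :
    G.tgt e i ≠ .inp j := fun h' => (h.input_iff (.inp j)).1 ⟨j, rfl⟩ ⟨e, i, h'⟩

theorem Net.IsLevel.exists_src {G : Net S I O} (h : G.IsLevel) (v : G.Vert) :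
    (∃ j, v = .out j) ∨ ∃ e i, G.src e i = v := by
  rw [h.output_iff]
  exact (em _).symm

theorem Net.IsLevel.exists_tgt {G : Net S I O} (h : G.IsLevel) (v : G.Vert) :
    (∃ i, v = .inp i) ∨ ∃ e j, G.tgt e j = v := by
  rw [h.input_iff]
  exact (em _).symm

theorem iff_not_of_or {p q : Prop} (h : p ∨ q) (h' : p → ¬ q) : p ↔ ¬ q :=
  ⟨h', fun hq => h.resolve_right hq⟩

/-- The label of a vertex. -/
def Skel.vertLab (K : Skel S I O) : Vtx K.V I O → VLab
  | .inner v => K.vlab v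
  | .inp i => I.get i
  | .out j => O.get j

/-- All sources. -/
def Skel.srcs (K : Skel S I O) : (Σ q, Fin (K.lab q).dom.length) ⊕ (Σ p, Fin (K.ins p).length) →
    Vtx K.V I O :=
  Sum.elim (fun x => K.src x.1 x.2) (fun x => K.psrc x.1 x.2)

/-- All targets. -/
def Skel.tgts (K : Skel S I O) : (Σ q, Fin (K.lab q).cod.length) ⊕ (Σ p, Fin (K.outs p).length) →
    Vtx K.V I O :=
  Sum.elim (fun x => K.tgt x.1 x.2) (fun x => K.ptgt x.1 x.2)

/-- The conditions of `Net.IsLevel`, with the parts in the role of edges. -/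
structure Skel.IsLevel (K : Skel S I O) : Prop where
  finiteV : Finite K.V
  finiteQ : Finite K.Q
  finiteP : Finite K.P
  src_lab : ∀ q i, K.vertLab (K.src q i) = (K.lab q).dom.get i
  tgt_lab : ∀ q i, K.vertLab (K.tgt q i) = (K.lab q).cod.get i
  psrc_lab : ∀ p i, K.vertLab (K.psrc p i) = (K.ins p).get i
  ptgt_lab : ∀ p i, K.vertLab (K.ptgt p i) = (K.outs p).get i
  src_inj : Function.Injective K.srcs
  tgt_inj : Function.Injective K.tgts
  src_ne_out : ∀ a j, K.srcs a ≠ .out j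
  tgt_ne_inp : ∀ a i, K.tgts a ≠ .inp i
  exists_src : ∀ v, (∃ j, v = .out j) ∨ ∃ a, K.srcs a = v
  exists_tgt : ∀ v, (∃ i, v = .inp i) ∨ ∃ a, K.tgts a = v
  box_ty : ∀ q m cs os, K.lab q = .box m cs os →
    ∃ k h, os = ctxTy k h ∧ cs = ctxTy (m + k) h

section GlueLevel

variable {K : Skel S I O} {N : (p : K.P) → Net S (K.ins p) (K.outs p)}

theorem Vtx.map_inl_ne {V W : Type} (x : Vtx V I O) (y : W) :
    x.map Sum.inl ≠ .inner (.inr y) := by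
  cases x <;> simp [Vtx.map]

/-- The embeddings of the parts are not jointly injective: an output of one part can be glued to an
input of another. Without outputs this cannot happen, and injectivity of `K.srcs` suffices. Sources
of edges are never outputs; targets are treated dually. -/
theorem Skel.emb_inj_src (hK : K.IsLevel) {p p' : K.P} {x : (N p).Vert} {y : (N p').Vert}
    (hx : ∀ j, x ≠ .out j) (hy : ∀ j, y ≠ .out j) (h : K.emb N p x = K.emb N p' y) :
    (⟨p, x⟩ : Σ p, (N p).Vert) = ⟨p', y⟩ := by
  rcases x with x | x | x
  · rcases y with y | y | y
    · simp only [Skel.emb, Vtx.inner.injEq, Sum.inr.injEq] at h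
      cases h; rfl
    · exact (Vtx.map_inl_ne _ _ h.symm).elim
    · exact (hy _ rfl).elim
  · rcases y with y | y | y
    · exact (Vtx.map_inl_ne _ _ h).elim
    · have := @hK.src_inj (.inr ⟨p, x⟩) (.inr ⟨p', y⟩) (Vtx.map_injective Sum.inl_injective h)
      cases this; rfl
    · exact (hy _ rfl).elim
  · exact (hx _ rfl).elim

theorem Skel.emb_inj_tgt (hK : K.IsLevel) {p p' : K.P} {x : (N p).Vert} {y : (N p').Vert}
    (hx : ∀ j, x ≠ .inp j) (hy : ∀ j, y ≠ .inp j) (h : K.emb N p x = K.emb N p' y) :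
    (⟨p, x⟩ : Σ p, (N p).Vert) = ⟨p', y⟩ := by
  rcases x with x | x | x
  · rcases y with y | y | y
    · simp only [Skel.emb, Vtx.inner.injEq, Sum.inr.injEq] at h
      cases h; rfl
    · exact (hy _ rfl).elim
    · exact (Vtx.map_inl_ne _ _ h.symm).elim
  · exact (hx _ rfl).elim
  · rcases y with y | y | y
    · exact (Vtx.map_inl_ne _ _ h).elim
    · exact (hy _ rfl).elim
    · have := @hK.tgt_inj (.inr ⟨p, x⟩) (.inr ⟨p', y⟩) (Vtx.map_injective Sum.inl_injective h)
      cases this; rfl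

theorem Skel.src_ne_emb (hK : K.IsLevel) {p : K.P} {x : (N p).Vert} (hx : ∀ j, x ≠ .out j) (q i) :
    (K.src q i).map .inl ≠ K.emb N p x := by
  intro h
  rcases x with x | x | x
  · exact Vtx.map_inl_ne _ _ h
  · have := @hK.src_inj (.inl ⟨q, i⟩) (.inr ⟨p, x⟩) (Vtx.map_injective Sum.inl_injective h)
    cases this
  · exact hx _ rfl

theorem Skel.tgt_ne_emb (hK : K.IsLevel) {p : K.P} {x : (N p).Vert} (hx : ∀ j, x ≠ .inp j) (q i) :
    (K.tgt q i).map .inl ≠ K.emb N p x := by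
  intro h
  rcases x with x | x | x
  · exact Vtx.map_inl_ne _ _ h
  · exact hx _ rfl
  · have := @hK.tgt_inj (.inl ⟨q, i⟩) (.inr ⟨p, x⟩) (Vtx.map_injective Sum.inl_injective h)
    cases this

/-- A source of a part `p` in the skeleton becomes a source of an edge of `N p`: it is glued to an
input of `N p`, and an input, not being an output, is the source of some edge. Targets are dual. So
the parts behave as edges, and the incidence conditions of the skeleton and of the parts combine. -/
theorem Skel.glue_isLevel (hK : K.IsLevel) (hN : ∀ p, (N p).IsLevel) : (K.glue N).IsLevel := by
  have := hK.finiteV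
  have := hK.finiteQ
  have := hK.finiteP
  have := fun p => (hN p).finiteV
  have := fun p => (hN p).finiteE
  have hinl : ∀ v : Vtx K.V I O, (K.glue N).vertLab (v.map .inl) = K.vertLab v := by
    intro v; cases v <;> rfl
  have hemb : ∀ p (v : (N p).Vert), (K.glue N).vertLab (K.emb N p v) = (N p).vertLab v := by
    intro p v
    cases v
    · rfl
    · exact (hinl _).trans (hK.psrc_lab _ _)
    · exact (hinl _).trans (hK.ptgt_lab _ _)
  refine ⟨?_, ?_, ?_, ?_, ?_, ?_, ?_, ?_, ?_⟩
  · exact inferInstanceAs (Finite (K.V ⊕ Σ p, (N p).V))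
  · exact inferInstanceAs (Finite (K.Q ⊕ Σ p, (N p).E))
  · rintro (q | ⟨p, e⟩) i
    · exact (hinl _).trans (hK.src_lab q i)
    · exact (hemb _ _).trans ((hN p).src_lab e i)
  · rintro (q | ⟨p, e⟩) i
    · exact (hinl _).trans (hK.tgt_lab q i)
    · exact (hemb _ _).trans ((hN p).tgt_lab e i)
  · rintro ⟨q | ⟨p, e⟩, i⟩ ⟨q' | ⟨p', e'⟩, i'⟩ h
    · have := @hK.src_inj (.inl ⟨q, i⟩) (.inl ⟨q', i'⟩) (Vtx.map_injective Sum.inl_injective h)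
      cases this; rfl
    · exact (Skel.src_ne_emb hK ((hN _).src_ne_out _ _) _ _ h).elim
    · exact (Skel.src_ne_emb hK ((hN _).src_ne_out _ _) _ _ h.symm).elim
    · have := Skel.emb_inj_src hK ((hN _).src_ne_out e i) ((hN _).src_ne_out e' i') h
      obtain ⟨h1, h2⟩ := Sigma.mk.inj_iff.1 this
      subst h1
      have := @(hN p).src_inj ⟨e, i⟩ ⟨e', i'⟩ (eq_of_heq h2)
      cases this; rfl
  · rintro ⟨q | ⟨p, e⟩, i⟩ ⟨q' | ⟨p', e'⟩, i'⟩ h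
    · have := @hK.tgt_inj (.inl ⟨q, i⟩) (.inl ⟨q', i'⟩) (Vtx.map_injective Sum.inl_injective h)
      cases this; rfl
    · exact (Skel.tgt_ne_emb hK ((hN _).tgt_ne_inp _ _) _ _ h).elim
    · exact (Skel.tgt_ne_emb hK ((hN _).tgt_ne_inp _ _) _ _ h.symm).elim
    · have := Skel.emb_inj_tgt hK ((hN _).tgt_ne_inp e i) ((hN _).tgt_ne_inp e' i') h
      obtain ⟨h1, h2⟩ := Sigma.mk.inj_iff.1 this
      subst h1
      have := @(hN p).tgt_inj ⟨e, i⟩ ⟨e', i'⟩ (eq_of_heq h2)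
      cases this; rfl
  · intro v
    refine iff_not_of_or ?_ ?_
    · have key : ∀ w : Vtx K.V I O, w.map .inl = v → (∃ i, v = .inp i) ∨
          ∃ e j, (K.glue N).tgt e j = v := by
        rintro w rfl
        rcases hK.exists_tgt w with ⟨i, rfl⟩ | ⟨⟨q, i⟩ | ⟨p, i⟩, rfl⟩
        · exact .inl ⟨i, rfl⟩
        · exact .inr ⟨.inl q, i, rfl⟩
        · rcases (hN p).exists_tgt (.out i) with ⟨j, hj⟩ | ⟨e, j, hj⟩
          · cases hj
          · exact .inr ⟨.inr ⟨p, e⟩, j, congrArg (K.emb N p) hj⟩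
      rcases v with (v | ⟨p, v⟩) | v | v
      · exact key (.inner v) rfl
      · rcases (hN p).exists_tgt (.inner v) with ⟨j, hj⟩ | ⟨e, j, hj⟩
        · cases hj
        · exact .inr ⟨.inr ⟨p, e⟩, j, congrArg (K.emb N p) hj⟩
      · exact key (.inp v) rfl
      · exact key (.out v) rfl
    · rintro ⟨i, rfl⟩ ⟨q | ⟨p, e⟩, j, h⟩
      · exact hK.tgt_ne_inp (.inl ⟨q, j⟩) i (Vtx.map_eq_inp.1 h)
      · change K.emb N p ((N p).tgt e j) = _ at h
        rcases hx : (N p).tgt e j with x | x | x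
        · rw [hx] at h
          cases h
        · exact (hN p).tgt_ne_inp _ _ _ hx
        · rw [hx] at h
          exact hK.tgt_ne_inp (.inr ⟨p, x⟩) i (Vtx.map_eq_inp.1 h)
  · intro v
    refine iff_not_of_or ?_ ?_
    · have key : ∀ w : Vtx K.V I O, w.map .inl = v → (∃ i, v = .out i) ∨
          ∃ e j, (K.glue N).src e j = v := by
        rintro w rfl
        rcases hK.exists_src w with ⟨i, rfl⟩ | ⟨⟨q, i⟩ | ⟨p, i⟩, rfl⟩
        · exact .inl ⟨i, rfl⟩
        · exact .inr ⟨.inl q, i, rfl⟩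
        · rcases (hN p).exists_src (.inp i) with ⟨j, hj⟩ | ⟨e, j, hj⟩
          · cases hj
          · exact .inr ⟨.inr ⟨p, e⟩, j, congrArg (K.emb N p) hj⟩
      rcases v with (v | ⟨p, v⟩) | v | v
      · exact key (.inner v) rfl
      · rcases (hN p).exists_src (.inner v) with ⟨j, hj⟩ | ⟨e, j, hj⟩
        · cases hj
        · exact .inr ⟨.inr ⟨p, e⟩, j, congrArg (K.emb N p) hj⟩
      · exact key (.inp v) rfl
      · exact key (.out v) rfl
    · rintro ⟨i, rfl⟩ ⟨q | ⟨p, e⟩, j, h⟩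
      · exact hK.src_ne_out (.inl ⟨q, j⟩) i (Vtx.map_eq_out.1 h)
      · change K.emb N p ((N p).src e j) = _ at h
        rcases hx : (N p).src e j with x | x | x
        · rw [hx] at h
          cases h
        · rw [hx] at h
          exact hK.src_ne_out (.inr ⟨p, x⟩) i (Vtx.map_eq_out.1 h)
        · exact (hN p).src_ne_out _ _ _ hx
  · rintro (q | ⟨p, e⟩) m cs os h
    · exact hK.box_ty q m cs os h
    · exact (hN p).box_ty e m cs os h

theorem Skel.glue_isHypernet (hK : K.IsLevel)
    (hc : ∀ q m cs os h, (K.content q m cs os h).IsHypernet) (hN : ∀ p, (N p).IsHypernet) :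
    (K.glue N).IsHypernet := by
  refine .intro (Skel.glue_isLevel hK fun p => (hN p).here) ?_
  rintro (q | ⟨p, e⟩) m cs os h
  · exact hc q m cs os h
  · exact (hN p).deep e m cs os h

theorem Skel.glue_allLabs {R : Lab S → Prop} (hK : ∀ q, R (K.lab q))
    (hc : ∀ q m cs os h, (K.content q m cs os h).AllLabs R) (hN : ∀ p, (N p).AllLabs R) :
    (K.glue N).AllLabs R := by
  refine .intro ?_ ?_
  · rintro (q | ⟨p, e⟩)
    · exact hK q
    · exact (hN p).here e
  · rintro (q | ⟨p, e⟩) m cs os h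
    · exact hc q m cs os h
    · exact (hN p).deep e m cs os h

end GlueLevel

/-- The edges of `C` are split into holes and the rest, and the conditions of a skeleton treat both
alike. What remains are casts between the types of an edge and of its label `χ`. -/
theorem Net.IsLevel.plugSkel {χ : Hole} (H : Net S χ.ins χ.outs) {C : Net S I O}
    (hC : C.IsLevel) : (C.plugSkel χ H).IsLevel := by
  have := hC.finiteV
  have := hC.finiteE
  have hlab : ∀ v, (C.plugSkel χ H).vertLab v = C.vertLab v := by
    intro v; cases v <;> rfl
  have hget : ∀ {l l' : List VLab} (_ : l = l') (i : Fin l.length) (i' : Fin l'.length),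
      i.val = i'.val → l.get i = l'.get i' := by
    intro l l' h i i' hi; subst h; obtain rfl := Fin.ext hi; rfl
  refine ⟨hC.finiteV, ?_, ?_, ?_, ?_, ?_, ?_, ?_, ?_, ?_, ?_, ?_, ?_, ?_⟩
  · exact inferInstanceAs (Finite {e : C.E // C.lab e ≠ .hole χ})
  · exact inferInstanceAs (Finite {e : C.E // C.lab e = .hole χ})
  · intro q i
    exact (hlab _).trans (hC.src_lab q.1 i)
  · intro q i
    exact (hlab _).trans (hC.tgt_lab q.1 i)
  · intro p i
    refine (hlab _).trans ((hC.src_lab p.1 _).trans ?_)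
    exact hget (by rw [p.2]; rfl) _ _ rfl
  · intro p i
    refine (hlab _).trans ((hC.tgt_lab p.1 _).trans ?_)
    exact hget (by rw [p.2]; rfl) _ _ rfl
  · rintro (⟨⟨e, he⟩, i⟩ | ⟨⟨e, he⟩, i⟩) (⟨⟨e', he'⟩, i'⟩ | ⟨⟨e', he'⟩, i'⟩) h
    · cases @hC.src_inj ⟨e, i⟩ ⟨e', i'⟩ h; rfl
    · cases @hC.src_inj ⟨e, i⟩ ⟨e', i'.cast (by rw [he']; rfl)⟩ h
      exact (he he').elim
    · cases @hC.src_inj ⟨e, i.cast (by rw [he]; rfl)⟩ ⟨e', i'⟩ h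
      exact (he' he).elim
    · obtain ⟨h1, h2⟩ := Sigma.mk.inj_iff.1
        (@hC.src_inj ⟨e, i.cast (by rw [he]; rfl)⟩ ⟨e', i'.cast (by rw [he']; rfl)⟩ h)
      subst h1
      have : i = i' := by simpa [Fin.ext_iff] using h2
      rw [this]
  · rintro (⟨⟨e, he⟩, i⟩ | ⟨⟨e, he⟩, i⟩) (⟨⟨e', he'⟩, i'⟩ | ⟨⟨e', he'⟩, i'⟩) h
    · cases @hC.tgt_inj ⟨e, i⟩ ⟨e', i'⟩ h; rfl
    · cases @hC.tgt_inj ⟨e, i⟩ ⟨e', i'.cast (by rw [he']; rfl)⟩ h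
      exact (he he').elim
    · cases @hC.tgt_inj ⟨e, i.cast (by rw [he]; rfl)⟩ ⟨e', i'⟩ h
      exact (he' he).elim
    · obtain ⟨h1, h2⟩ := Sigma.mk.inj_iff.1
        (@hC.tgt_inj ⟨e, i.cast (by rw [he]; rfl)⟩ ⟨e', i'.cast (by rw [he']; rfl)⟩ h)
      subst h1
      have : i = i' := by simpa [Fin.ext_iff] using h2
      rw [this]
  · rintro (⟨q, i⟩ | ⟨p, i⟩) j
    · exact hC.src_ne_out _ _ _
    · exact hC.src_ne_out _ _ _
  · rintro (⟨q, i⟩ | ⟨p, i⟩) j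
    · exact hC.tgt_ne_inp _ _ _
    · exact hC.tgt_ne_inp _ _ _
  · intro v
    refine (hC.exists_src v).imp_right ?_
    rintro ⟨e, i, h⟩
    by_cases he : C.lab e = .hole χ
    · exact ⟨.inr ⟨⟨e, he⟩, i.cast (by rw [he]; rfl)⟩, h⟩
    · exact ⟨.inl ⟨⟨e, he⟩, i⟩, h⟩
  · intro v
    refine (hC.exists_tgt v).imp_right ?_
    rintro ⟨e, i, h⟩
    by_cases he : C.lab e = .hole χ
    · exact ⟨.inr ⟨⟨e, he⟩, i.cast (by rw [he]; rfl)⟩, h⟩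
    · exact ⟨.inl ⟨⟨e, he⟩, i⟩, h⟩
  · intro q m cs os h
    exact hC.box_ty q.1 m cs os h

theorem Net.IsHypernet.plug {χ : Hole} {H : Net S χ.ins χ.outs} (hH : H.IsHypernet)
    {C : Net S I O} (hC : C.IsHypernet) : (Net.plug χ H C).IsHypernet := by
  induction C with
  | mk V E vlab lab content src tgt ih =>
    refine (Net.plug_iso_glue ..).symm.isHypernet (Skel.glue_isHypernet (hC.here.plugSkel H) ?_
      fun _ => hH)
    exact fun q m cs os h => ih q.1 m cs os h (hC.deep q.1 m cs os h)

/-- The label `χ` is exempt in `C`, since its edges disappear. -/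
theorem Net.AllLabs.plug {R : Lab S → Prop} {χ : Hole} {H : Net S χ.ins χ.outs}
    (hH : H.AllLabs R) {C : Net S I O} (hC : C.AllLabs fun l => l = .hole χ ∨ R l) :
    (Net.plug χ H C).AllLabs R := by
  induction C with
  | mk V E vlab lab content src tgt ih =>
    refine (Net.plug_iso_glue ..).symm.allLabs (Skel.glue_allLabs ?_ ?_ fun _ => hH)
    · exact fun q => (hC.here q.1).resolve_left q.2
    · exact fun q m cs os h => ih q.1 m cs os h (hC.deep q.1 m cs os h)

end Glue

/-! ### Hole occurrences, and composition of contexts -/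

section Occurrences

variable {S : Sig.{u}} {I O : List VLab}

theorem Net.Occ.not_of_allLabs {χ : Hole} {G : Net S I O} (o : Net.Occ χ G)
    (h : G.AllLabs (· ≠ .hole χ)) : False := by
  induction o with
  | here e he => exact h.here e he
  | deep e m cs os he o ih => exact ih (h.deep _ _ _ _ _)

/-- All holes have the label `χ`. -/
abbrev Net.OnlyHole (χ : Hole) (G : Net S I O) : Prop :=
  G.AllLabs fun l => ∀ χ', l = .hole χ' → χ' = χ

theorem Net.onlyHole_of_occ {χ : Hole} {G : Net S I O}
    (h : ∀ χ', Nonempty (Net.Occ χ' G) → χ' = χ) : G.OnlyHole χ := by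
  induction G with
  | mk V E vlab lab content src tgt ih =>
    refine .intro (fun e χ' he => h χ' ⟨.here e he⟩) fun e m cs os he => ih e m cs os he ?_
    rintro χ' ⟨o⟩
    exact h χ' ⟨.deep e m cs os he o⟩

theorem Net.subsingleton_occ_content {χ : Hole} {G : Net S I O} (h : Subsingleton (Net.Occ χ G))
    (e m cs os he) : Subsingleton (Net.Occ χ (G.content e m cs os he)) := by
  refine ⟨fun o o' => ?_⟩
  have := h.elim (.deep e m cs os he o) (.deep e m cs os he o')
  cases this
  rfl

/-- The holes of `C` all disappear, so every occurrence in the result lies in a copy of `D`; that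
copy marks an occurrence of `χ'` in `C`. -/
theorem Net.Occ.of_plug {χ χ' : Hole} {D : Net S χ'.ins χ'.outs} {C : Net S I O}
    (hC : C.OnlyHole χ') (o : Net.Occ χ (Net.plug χ' D C)) :
    Nonempty (Net.Occ χ' C) ∧ Nonempty (Net.Occ χ D) := by
  induction C with
  | mk V E vlab lab content src tgt ih =>
    rw [Net.plug_eq] at o
    rcases o with ⟨⟨e, he⟩ | ⟨e, d⟩, h⟩ | ⟨⟨e, he⟩ | ⟨e, d⟩, m, cs, os, h, o⟩
    · exact (he (Eq.trans h (congrArg Lab.hole (hC.here e χ h)))).elim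
    · exact ⟨⟨.here e.1 e.2⟩, ⟨.here d h⟩⟩
    · obtain ⟨⟨o'⟩, h'⟩ := ih e m cs os h (hC.deep e m cs os h) o
      exact ⟨⟨.deep e m cs os h o'⟩, h'⟩
    · exact ⟨⟨.here e.1 e.2⟩, ⟨.deep d m cs os h o⟩⟩

theorem Net.Occ.plug {χ χ' : Hole} {D : Net S χ'.ins χ'.outs} {C : Net S I O}
    (o : Net.Occ χ' C) (o' : Net.Occ χ D) : Nonempty (Net.Occ χ (Net.plug χ' D C)) := by
  induction o with
  | @here I O C e h =>
    rw [Net.plug_eq]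
    cases o' with
    | here d h' => exact ⟨.here (.inr (⟨e, h⟩, d)) h'⟩
    | deep d m cs os h' o => exact ⟨.deep (.inr (⟨e, h⟩, d)) m cs os h' o⟩
  | @deep I O C e m cs os h o ih =>
    obtain ⟨o⟩ := ih
    rw [Net.plug_eq]
    exact ⟨.deep (.inl ⟨e, by rw [h]; nofun⟩) m cs os h o⟩

/-- An occurrence in the composite amounts to an occurrence of `χ'` in `C` together with one of `χ`
in `D`, and both are unique. The cases compare the shapes of two occurrences: mixed shapes would
give two different occurrences in `C` or in `D`. -/
theorem Net.subsingleton_occ_plug {χ χ' : Hole} {D : Net S χ'.ins χ'.outs} {C : Net S I O}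
    (hC : C.OnlyHole χ') (h : Subsingleton (Net.Occ χ' C)) (hD : Subsingleton (Net.Occ χ D)) :
    Subsingleton (Net.Occ χ (Net.plug χ' D C)) := by
  induction C with
  | mk V E vlab lab content src tgt ih =>
    have hne : ∀ e, lab e ≠ .hole χ' → lab e ≠ .hole χ := fun e he h =>
      he (Eq.trans h (congrArg Lab.hole (hC.here e χ h)))
    -- Turns an occurrence inside a box of `C` after plugging into an occurrence of `χ'` in that
    -- box, to be compared with the other occurrences of `χ'` in `C`.
    have hdeep : ∀ e m cs os he, Net.Occ χ (Net.plug χ' D (content e m cs os he)) →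
        Nonempty (Net.Occ χ' (content e m cs os he)) :=
      fun e m cs os he o => (o.of_plug (hC.deep e m cs os he)).1
    rw [Net.plug_eq]
    refine ⟨fun o₁ o₂ => ?_⟩
    rcases o₁ with ⟨⟨e, he⟩ | ⟨⟨e, hE⟩, d⟩, h₁⟩ | ⟨⟨e, he⟩ | ⟨⟨e, hE⟩, d⟩, m, cs, os, h₁, o₁⟩
    · exact (hne e he h₁).elim
    · rcases o₂ with ⟨⟨e', he'⟩ | ⟨⟨e', hE'⟩, d'⟩, h₂⟩ | ⟨⟨e', he'⟩ | ⟨⟨e', hE'⟩, d'⟩, m', cs', os', h₂, o₂⟩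
      · exact (hne e' he' h₂).elim
      · cases h.elim (.here e hE) (.here e' hE')
        cases hD.elim (.here d h₁) (.here d' h₂)
        rfl
      · obtain ⟨o⟩ := hdeep e' m' cs' os' h₂ o₂
        cases h.elim (.here e hE) (.deep e' m' cs' os' h₂ o)
      · cases hD.elim (.here d h₁) (.deep d' m' cs' os' h₂ o₂)
    · obtain ⟨o⟩ := hdeep e m cs os h₁ o₁
      rcases o₂ with ⟨⟨e', he'⟩ | ⟨⟨e', hE'⟩, d'⟩, h₂⟩ | ⟨⟨e', he'⟩ | ⟨⟨e', hE'⟩, d'⟩, m', cs', os', h₂, o₂⟩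
      · exact (hne e' he' h₂).elim
      · cases h.elim (.here e' hE') (.deep e m cs os h₁ o)
      · obtain ⟨o'⟩ := hdeep e' m' cs' os' h₂ o₂
        cases h.elim (.deep e m cs os h₁ o) (.deep e' m' cs' os' h₂ o')
        have := ih e m cs os h₁ (hC.deep e m cs os h₁)
          (Net.subsingleton_occ_content h e m cs os h₁)
        rw [this.elim o₁ o₂]
      · cases h.elim (.here e' hE') (.deep e m cs os h₁ o)
    · rcases o₂ with ⟨⟨e', he'⟩ | ⟨⟨e', hE'⟩, d'⟩, h₂⟩ | ⟨⟨e', he'⟩ | ⟨⟨e', hE'⟩, d'⟩, m', cs', os', h₂, o₂⟩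
      · exact (hne e' he' h₂).elim
      · cases hD.elim (.deep d m cs os h₁ o₁) (.here d' h₂)
      · obtain ⟨o⟩ := hdeep e' m' cs' os' h₂ o₂
        cases h.elim (.here e hE) (.deep e' m' cs' os' h₂ o)
      · cases h.elim (.here e hE) (.here e' hE')
        cases hD.elim (.deep d m cs os h₁ o₁) (.deep d' m' cs' os' h₂ o₂)
        rfl

theorem Net.IsContextOf.onlyHole {χ : Hole} {C : Net S I O} (h : C.IsContextOf χ) :
    C.OnlyHole χ := Net.onlyHole_of_occ fun χ' h' => (h.2 χ').1 h'

theorem Net.IsContextOf.plug {χ χ' : Hole} {D : Net S χ'.ins χ'.outs} (hD : D.IsContextOf χ)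
    {C : Net S I O} (hC : C.IsContextOf χ') : (Net.plug χ' D C).IsContextOf χ := by
  refine ⟨⟨hD.1.1.plug hC.1.1, fun χ'' =>
    Net.subsingleton_occ_plug hC.onlyHole (hC.1.2 χ') (hD.1.2 χ'')⟩, fun χ'' => ?_⟩
  rw [← hD.2]
  constructor
  · rintro ⟨o⟩
    exact (o.of_plug hC.onlyHole).2
  · rintro ⟨o'⟩
    obtain ⟨o⟩ := (hC.2 χ').2 rfl
    exact o.plug o'

/-- The hypernet of a hole edge. -/
abbrev Net.holeEdge (χ : Hole) : Net S χ.ins χ.outs := Net.edge (.hole χ) nofun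

theorem Net.edge_isHypernet (l : Lab S) (hl : ∀ m cs os, l ≠ .box m cs os) :
    (Net.edge l hl).IsHypernet := by
  refine .intro ⟨?_, ?_, ?_, ?_, ?_, ?_, ?_, ?_, ?_⟩ fun e m cs os h => (hl m cs os h).elim
  · exact inferInstanceAs (Finite Empty)
  · exact inferInstanceAs (Finite Unit)
  · intro e i; rfl
  · intro e i; rfl
  · rintro ⟨e, i⟩ ⟨e', i'⟩ h
    cases h; rfl
  · rintro ⟨e, i⟩ ⟨e', i'⟩ h
    cases h; rfl
  · rintro (v | v | v)
    · exact v.elim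
    · refine iff_of_true ⟨v, rfl⟩ ?_
      rintro ⟨e, i, h⟩
      cases h
    · refine iff_of_false ?_ (not_not.2 ⟨(), v, rfl⟩)
      rintro ⟨i, h⟩
      cases h
  · rintro (v | v | v)
    · exact v.elim
    · refine iff_of_false ?_ (not_not.2 ⟨(), v, rfl⟩)
      rintro ⟨i, h⟩
      cases h
    · refine iff_of_true ⟨v, rfl⟩ ?_
      rintro ⟨e, i, h⟩
      cases h
  · intro e m cs os h
    exact (hl m cs os h).elim

theorem Net.edge_allLabs {R : Lab S → Prop} (l : Lab S) (hl : ∀ m cs os, l ≠ .box m cs os)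
    (h : R l) : (Net.edge l hl).AllLabs R :=
  .intro (fun _ => h) fun _ m cs os h => (hl m cs os h).elim

theorem Net.holeEdge_isContextOf (χ : Hole) : (Net.holeEdge χ : Net S _ _).IsContextOf χ := by
  refine ⟨⟨Net.edge_isHypernet _ _, fun χ' => ⟨?_⟩⟩, fun χ' => ⟨?_, ?_⟩⟩
  · rintro (⟨e, h⟩ | ⟨e, m, cs, os, h, o⟩) (⟨e', h'⟩ | ⟨e', m', cs', os', h', o'⟩)
    · rfl
    · cases h'
    · cases h
    · cases h
  · rintro ⟨⟨e, h⟩ | ⟨e, m, cs, os, h, o⟩⟩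
    · cases h; rfl
    · cases h
  · rintro rfl
    exact ⟨.here () rfl⟩

/-- The occurrences in a part of a skeleton. -/
def Skel.glueOcc {K : Skel S I O} {N : (p : K.P) → Net S (K.ins p) (K.outs p)} {χ : Hole}
    (x : Σ p, Net.Occ χ (N p)) : Net.Occ χ (K.glue N) :=
  match x with
  | ⟨p, .here e h⟩ => .here (.inr ⟨p, e⟩) h
  | ⟨p, .deep e m cs os h o⟩ => .deep (.inr ⟨p, e⟩) m cs os h o

theorem Skel.glueOcc_surjective {K : Skel S I O} {N : (p : K.P) → Net S (K.ins p) (K.outs p)}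
    {χ : Hole} (hK : ∀ q, K.lab q ≠ .hole χ) (hK' : ∀ q m cs os, K.lab q ≠ .box m cs os) :
    Function.Surjective (Skel.glueOcc (K := K) (N := N) (χ := χ)) := by
  rintro (⟨q | ⟨p, e⟩, h⟩ | ⟨q | ⟨p, e⟩, m, cs, os, h, o⟩)
  · exact (hK q h).elim
  · exact ⟨⟨p, .here e h⟩, rfl⟩
  · exact (hK' q _ _ _ h).elim
  · exact ⟨⟨p, .deep e m cs os h o⟩, rfl⟩

/-- Only the part `p₀` has holes, at any depth, so occurrences in the glued hypernet are occurrences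
in `N p₀`. -/
theorem Skel.glue_isContextOf {K : Skel S I O} (hK : K.IsLevel) (hhole : ∀ q χ, K.lab q ≠ .hole χ)
    (hbox : ∀ q m cs os, K.lab q ≠ .box m cs os) {N : (p : K.P) → Net S (K.ins p) (K.outs p)}
    {p₀ : K.P} {χ : Hole} (h₀ : (N p₀).IsContextOf χ)
    (hN : ∀ p, p ≠ p₀ → (N p).IsHypernet ∧ (N p).HoleFree) : (K.glue N).IsContextOf χ := by
  have hp : ∀ χ' p, Net.Occ χ' (N p) → p = p₀ := by
    intro χ' p o
    by_contra h
    exact o.not_of_allLabs ((hN p h).2.imp fun _ _ _ h e => h e χ')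
  refine ⟨⟨Skel.glue_isHypernet hK (fun q m cs os h => (hbox q m cs os h).elim) ?_, ?_⟩, ?_⟩
  · intro p
    by_cases h : p = p₀
    · subst h; exact h₀.1.1
    · exact (hN p h).1
  · intro χ'
    have : Subsingleton (Σ p, Net.Occ χ' (N p)) := by
      refine ⟨?_⟩
      rintro ⟨p, o⟩ ⟨p', o'⟩
      obtain rfl := hp _ _ o
      obtain rfl := hp _ _ o'
      rw [(h₀.1.2 χ').elim o o']
    exact (Skel.glueOcc_surjective (fun q => hhole q χ') hbox).subsingleton
  · intro χ'
    rw [← h₀.2]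
    constructor
    · rintro ⟨o⟩
      obtain ⟨⟨p, o⟩, -⟩ := Skel.glueOcc_surjective (fun q => hhole q χ') hbox o
      obtain rfl := hp _ _ o
      exact ⟨o⟩
    · rintro ⟨o⟩
      exact ⟨Skel.glueOcc ⟨p₀, o⟩⟩

end Occurrences

/-! ### Binding-free contexts are closed under composition -/

section BindingFree

variable {S : Sig.{u}} {I O : List VLab}

/-- The condition on one level of a binding-free context. -/
def Net.BindingFreeLevel (G : Net S I O) : Prop :=
  ∀ e e' i j χ, (G.lab e).IsBinding → G.lab e' = .hole χ →
    ¬ Relation.TransGen G.Step (G.src e i) (G.src e' j)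

theorem Net.HoleFree.bindingFree {G : Net S I O} (h : G.HoleFree) :
    Net.Everywhere (fun _ _ G => G.BindingFreeLevel) G :=
  h.imp fun _ _ _ h _ e' _ _ χ _ he => (h e' χ he).elim

/-- A path to the hole of `D` is followed backwards. It stays in `D` until it reaches an input of
`D`, which is a source of the hole edge `e₀` of `C`; from there on it is a path of `C`. Re-entering
`D` through an output would give a cycle of `C` through `e₀`, and `hCb` excludes this because hole
edges are binding. So a path from a binding edge to the hole yields a path of the same kind in `D`
or in `C`. -/
theorem Net.bindingFreeLevel_plug {χ' : Hole} {D : Net S χ'.ins χ'.outs} {C : Net S I O}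
    (hD : D.IsLevel) (hC : C.IsLevel) (hDb : D.BindingFreeLevel) (hCb : C.BindingFreeLevel)
    (honly : ∀ e χ, C.lab e = .hole χ → χ = χ')
    (huniq : ∀ e e', C.lab e = .hole χ' → C.lab e' = .hole χ' → e = e')
    (plugged) : (plugStep χ' D C.V C.E C.vlab C.lab plugged C.src C.tgt).BindingFreeLevel := by
  set G := plugStep χ' D C.V C.E C.vlab C.lab plugged C.src C.tgt
  rintro f (⟨e₀, h₀⟩ | ⟨⟨e₀, h₀⟩, d₀⟩) fi j χ hf hd₀ hpath
  · exact h₀ (Eq.trans hd₀ (congrArg Lab.hole (honly e₀ χ hd₀)))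
  replace hd₀ : D.lab d₀ = .hole χ := hd₀
  have hbind : (C.lab e₀).IsBinding := by rw [h₀]; trivial
  let emb : D.Vert → G.Vert := plugEmb χ' D C.src C.tgt ⟨e₀, h₀⟩
  let inl : C.Vert → G.Vert := Vtx.map Sum.inl
  have hinl : Function.Injective inl := Vtx.map_injective Sum.inl_injective
  -- The hole edge in the role of the binding edge: there is no cycle through it.
  have hcyc : ∀ k l, ¬ Relation.TransGen C.Step (C.src e₀ k) (C.src e₀ l) := fun k l =>
    hCb e₀ e₀ k l χ' hbind h₀
  have hloop : ∀ k l, C.src e₀ k ≠ C.tgt e₀ l := by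
    intro k l h
    exact hcyc k k (.single ⟨e₀, k, l, rfl, h.symm⟩)
  -- An input and an output of `D` could only be identified if `e₀` were a loop.
  have hemb : Function.Injective emb := by
    rintro (x | x | x) (y | y | y) h
    · change Vtx.inner (Sum.inr (_, x)) = Vtx.inner (Sum.inr (_, y)) at h
      cases h; rfl
    · exact (Vtx.map_inl_ne _ _ h.symm).elim
    · exact (Vtx.map_inl_ne _ _ h.symm).elim
    · exact (Vtx.map_inl_ne _ _ h).elim
    · have := congrArg (fun s => (s.2 : ℕ))
        (@hC.src_inj ⟨e₀, x.cast (by rw [h₀]; rfl)⟩ ⟨e₀, y.cast (by rw [h₀]; rfl)⟩ (hinl h))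
      rw [Fin.ext (a := x) (b := y) this]
    · exact (hloop _ _ (hinl h)).elim
    · exact (Vtx.map_inl_ne _ _ h).elim
    · exact (hloop _ _ (hinl h).symm).elim
    · have := congrArg (fun s => (s.2 : ℕ))
        (@hC.tgt_inj ⟨e₀, x.cast (by rw [h₀]; rfl)⟩ ⟨e₀, y.cast (by rw [h₀]; rfl)⟩ (hinl h))
      rw [Fin.ext (a := x) (b := y) this]
  have hedge : ∀ e : {e : C.E // C.lab e = .hole χ'}, e = ⟨e₀, h₀⟩ := fun e =>
    Subtype.ext (huniq e.1 e₀ e.2 h₀)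
  -- the paths to the source of the hole stay in `D`, or come from a source of the hole of `C`
  have hout : ∀ k, ¬ Relation.ReflTransGen D.Step (.out k) (D.src d₀ j) := by
    intro k h
    rcases Relation.ReflTransGen.cases_head h with h | ⟨_, ⟨d, i, _, h, -⟩, -⟩
    · exact hD.src_ne_out _ _ _ h.symm
    · exact hD.src_ne_out _ _ _ h
  -- One step backwards. The invariant: the current vertex lies in `D` with a path of `D` to its
  -- hole, or in `C` with a path of `C` to a source of `e₀`. A path in `D` may be empty, as it is at
  -- the start; a path in `C` is not.
  have hstep : ∀ v v', G.Step v v' →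
      ((∃ x, v' = emb x ∧ Relation.ReflTransGen D.Step x (D.src d₀ j)) ∨
        ∃ c k, v' = inl c ∧ Relation.TransGen C.Step c (C.src e₀ k)) →
      (∃ x, v = emb x ∧ Relation.TransGen D.Step x (D.src d₀ j)) ∨
        ∃ c k, v = inl c ∧ Relation.TransGen C.Step c (C.src e₀ k) := by
    rintro v v' ⟨⟨e, he⟩ | ⟨e, d⟩, a, b, hs, ht⟩ h
    · right
      replace hs : inl (C.src e a) = v := hs
      replace ht : inl (C.tgt e b) = v' := ht
      rcases h with ⟨x, hx, hp⟩ | ⟨c, k, hx, hp⟩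
      · rcases x with x | x | x
        · exact (Vtx.map_inl_ne _ _ (ht.trans hx)).elim
        · exact ⟨_, _, hs.symm, .single ⟨e, a, b, rfl, hinl (ht.trans hx)⟩⟩
        · exact (hout _ hp).elim
      · exact ⟨_, k, hs.symm, .head ⟨e, a, b, rfl, hinl (ht.trans hx)⟩ hp⟩
    · left
      obtain rfl := hedge e
      replace hs : emb (D.src d a) = v := hs
      replace ht : emb (D.tgt d b) = v' := ht
      rcases h with ⟨x, hx, hp⟩ | ⟨c, k, hx, hp⟩
      · exact ⟨_, hs.symm, .head' ⟨d, a, b, rfl, hemb (ht.trans hx)⟩ hp⟩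
      · rcases hy : D.tgt d b with y | y | y
        · rw [hy] at ht
          exact (Vtx.map_inl_ne _ _ (hx.symm.trans ht.symm)).elim
        · exact (hD.tgt_ne_inp _ _ _ hy).elim
        · rw [hy] at ht
          have := hinl (ht.trans hx)
          -- The step ends in an output of `D`, which is a target of `e₀`; prefixed by `e₀`, the
          -- path in `C` becomes a cycle.
          exact (hcyc k k (.head ⟨e₀, k, _, rfl, this⟩ hp)).elim
  have hclaim : ∀ v, Relation.TransGen G.Step v (emb (D.src d₀ j)) →
      (∃ x, v = emb x ∧ Relation.TransGen D.Step x (D.src d₀ j)) ∨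
        ∃ c k, v = inl c ∧ Relation.TransGen C.Step c (C.src e₀ k) := by
    intro v h
    induction h using Relation.TransGen.head_induction_on with
    | single h => exact hstep _ _ h (.inl ⟨_, rfl, .refl⟩)
    | head h _ ih => exact hstep _ _ h (ih.imp_left fun ⟨x, hx, hp⟩ => ⟨x, hx, hp.to_reflTransGen⟩)
  -- The binding edge `f` lies in `C` or in `D`. If `f` and the path found are on different sides,
  -- they meet at a source of `e₀`: then `f` would be `e₀`, or there would be a cycle through `e₀`.
  rcases hclaim _ hpath with ⟨x, hx, hp⟩ | ⟨c, k, hx, hp⟩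
  · rcases f with ⟨f, hf'⟩ | ⟨e, d⟩
    · replace hx : inl (C.src f fi) = emb x := hx
      rcases x with x | x | x
      · exact Vtx.map_inl_ne _ _ hx
      · cases @hC.src_inj ⟨f, fi⟩ ⟨e₀, x.cast (by rw [h₀]; rfl)⟩ (hinl hx)
        exact hf' h₀
      · exact hout _ hp.to_reflTransGen
    · obtain rfl := hedge e
      replace hx : emb (D.src d fi) = emb x := hx
      rw [← hemb hx] at hp
      exact hDb d d₀ fi j χ hf hd₀ hp
  · rcases f with ⟨f, hf'⟩ | ⟨e, d⟩
    · replace hx : inl (C.src f fi) = inl c := hx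
      rw [← hinl hx] at hp
      exact hCb f e₀ fi k χ' hf h₀ hp
    · obtain rfl := hedge e
      replace hx : emb (D.src d fi) = inl c := hx
      rcases hy : D.src d fi with y | y | y
      · rw [hy] at hx
        exact Vtx.map_inl_ne _ _ hx.symm
      · rw [hy] at hx
        rw [← hinl hx] at hp
        exact hcyc _ _ hp
      · exact hD.src_ne_out _ _ _ hy

theorem Net.bindingFree_plug {χ' : Hole} {D : Net S χ'.ins χ'.outs} {C : Net S I O}
    (hD : D.IsHypernet) (hC : C.IsHypernet) (honly : C.OnlyHole χ')
    (huniq : Subsingleton (Net.Occ χ' C))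
    (hDb : Net.Everywhere (fun _ _ G => G.BindingFreeLevel) D)
    (hCb : Net.Everywhere (fun _ _ G => G.BindingFreeLevel) C) :
    Net.Everywhere (fun _ _ G => G.BindingFreeLevel) (Net.plug χ' D C) := by
  induction C with
  | mk V E vlab lab content src tgt ih =>
    rw [Net.plug_eq]
    refine .intro (Net.bindingFreeLevel_plug hD.here hC.here hDb.here hCb.here honly.here ?_ _) ?_
    · intro e e' h h'
      cases huniq.elim (.here e h) (.here e' h')
      rfl
    · rintro (e | ⟨e, d⟩) m cs os h
      · exact ih e.1 m cs os h (hC.deep _ _ _ _ _) (honly.deep _ _ _ _ _)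
          (Net.subsingleton_occ_content huniq e.1 m cs os h) (hCb.deep _ _ _ _ _)
      · exact hDb.deep d m cs os h

/-- A source of the only edge is an input, and every step ends in an output. -/
theorem Net.holeEdge_bindingFree (χ : Hole) :
    Net.Everywhere (fun _ _ G => G.BindingFreeLevel) (Net.holeEdge χ : Net S _ _) := by
  refine .intro ?_ fun e m cs os h => by cases h
  intro e e' i j χ' _ _ h
  obtain ⟨_, -, ⟨_, _, _, -, h⟩⟩ := (Relation.TransGen.tail'_iff).1 h
  cases h

/-- A part whose sources are inputs, or targets of operation edges at the inputs. -/
def Skel.Accessible (K : Skel S I O) (p : K.P) : Prop :=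
  ∀ j, (∃ i, K.psrc p j = .inp i) ∨ ∃ q r φ, K.psrc p j = K.tgt q r ∧ K.lab q = .op φ ∧
    ∀ i, ∃ k, K.src q i = .inp k

/-- By `hsrc` the sources of the holes are sources of the part `p₀`. No path ends in an input, and a
path that ends in a target of an operation edge at the inputs is a single step along that edge. It
therefore starts at a source of the operation edge, which is not binding. -/
theorem Skel.glue_bindingFree {K : Skel S I O} (hK : K.IsLevel)
    (hhole : ∀ q χ, K.lab q ≠ .hole χ) (hbox : ∀ q m cs os, K.lab q ≠ .box m cs os)
    {N : (p : K.P) → Net S (K.ins p) (K.outs p)} {p₀ : K.P} (hp₀ : K.Accessible p₀)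
    (hN : ∀ p, (N p).IsHypernet)
    (h₀ : Net.Everywhere (fun _ _ G => G.BindingFreeLevel) (N p₀))
    (hsrc : ∀ e χ i, (N p₀).lab e = .hole χ → ∃ k, (N p₀).src e i = .inp k)
    (hN' : ∀ p, p ≠ p₀ → (N p).HoleFree) :
    Net.Everywhere (fun _ _ G => G.BindingFreeLevel) (K.glue N) := by
  have hlev := Skel.glue_isLevel hK fun p => (hN p).here
  refine .intro ?_ ?_
  · rintro f (q | ⟨p, e⟩) i j χ hf he h
    · exact hhole q χ he
    have hp : p = p₀ := by
      by_contra hp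
      exact (hN' p hp).here e χ he
    subst hp
    obtain ⟨k, hk⟩ := hsrc e χ j he
    have hsk : (K.glue N).src (.inr ⟨p, e⟩) j = (K.psrc p k).map .inl := by
      change K.emb N p ((N p).src e j) = _
      rw [hk]; rfl
    rw [hsk] at h
    obtain ⟨v, hv, ⟨g, a, b, hga, hgb⟩⟩ := (Relation.TransGen.tail'_iff).1 h
    rcases hp₀ k with ⟨i', hi'⟩ | ⟨q, r, φ, hr, hφ, hq⟩
    · rw [hi'] at hgb
      exact hlev.tgt_ne_inp _ _ _ hgb
    · rw [hr] at hgb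
      have := @hlev.tgt_inj ⟨g, b⟩ ⟨.inl q, r⟩ hgb
      obtain ⟨h1, -⟩ := Sigma.mk.inj_iff.1 this
      subst h1
      obtain ⟨k', hk'⟩ := hq a
      have hv' : v = .inp k' := by
        rw [← hga]
        exact congrArg (Vtx.map Sum.inl) hk'
      -- The path before the last step is empty, so that `f` is the operation edge, or it ends in an
      -- input, which is impossible.
      rcases Relation.ReflTransGen.cases_tail hv with hv | ⟨_, -, ⟨_, _, _, -, hv⟩⟩
      · have := @hlev.src_inj ⟨.inl q, a⟩ ⟨f, i⟩ (hga.trans hv)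
        obtain ⟨h1, -⟩ := Sigma.mk.inj_iff.1 this
        subst h1
        have : (K.lab q).IsBinding := hf
        rw [hφ] at this
        exact this
      · rw [hv'] at hv
        exact hlev.tgt_ne_inp _ _ _ hv
  · rintro (q | ⟨p, e⟩) m cs os h
    · exact (hbox q m cs os h).elim
    · by_cases hp : p = p₀
      · subst hp
        exact h₀.deep e m cs os h
      · exact (hN' p hp).bindingFree.deep e m cs os h

end BindingFree

/-! ### Closing by distributors -/

section Distribute

variable {S : Sig.{u}} {I : List VLab}

theorem ctxTy_get (k h : ℕ) (p : Fin (ctxTy k h).length) :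
    (ctxTy k h).get p = .wire (ctxWire k p.val) := by
  have key : ∀ (p : ℕ) (hp : p < (List.replicate k star ++ List.replicate h diam).length),
      (List.replicate k star ++ List.replicate h diam)[p] = .wire (ctxWire k p) := by
    intro p hp
    rw [List.getElem_append, ctxWire]
    simp only [List.length_replicate, List.getElem_replicate]
    split_ifs <;> rfl
  exact key p.1 p.2

/-- Vertices of a hypergraph without outputs, after the addition of outputs and inner vertices. -/
def Vtx.extend {V : Type} (O : List VLab) (W : Type) : Vtx V I [] → Vtx (V ⊕ W) I O
  | .inner v => .inner (.inl v)
  | .inp i => .inp i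
  | .out j => j.elim0

theorem Vtx.extend_injective {V : Type} (O : List VLab) (W : Type) :
    Function.Injective (Vtx.extend O W : Vtx V I [] → Vtx (V ⊕ W) I O) := by
  rintro (x | x | x) (y | y | y) h
  · cases h; rfl
  · cases h
  · exact y.elim0
  · cases h
  · cases h; rfl
  · exact y.elim0
  · exact x.elim0
  · exact x.elim0
  · exact x.elim0

variable {k h : ℕ}

/-- The node `c` of the distributor at the position `p`. -/
def distNode (V : Type) (mult : Fin (ctxTy k h).length → ℕ) (p : Fin (ctxTy k h).length)
    (c : ℕ) (hc : c ≤ mult p) : Vtx (V ⊕ Σ p, Fin (mult p)) I (ctxTy k h) :=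
  match c, hc with
  | 0, _ => .out p
  | c + 1, hc => .inner (.inr ⟨p, ⟨c, hc⟩⟩)

theorem distNode_inj {V : Type} {mult : Fin (ctxTy k h).length → ℕ} {p p' : Fin (ctxTy k h).length}
    {c c' : ℕ} {hc : c ≤ mult p} {hc' : c' ≤ mult p'}
    (he : (distNode V mult p c hc : Vtx _ I _) = distNode V mult p' c' hc') :
    p = p' ∧ c = c' := by
  rcases c with _ | c <;> rcases c' with _ | c'
  · cases he; exact ⟨rfl, rfl⟩
  · cases he
  · cases he
  · cases he; exact ⟨rfl, rfl⟩

theorem extend_ne_distNode {V : Type} {mult : Fin (ctxTy k h).length → ℕ} {p c hc}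
    {v : Vtx V I []} : v.extend _ _ ≠ distNode V mult p c hc := by
  intro he
  rcases c with _ | c <;> rcases v with v | v | v
  · cases he
  · cases he
  · exact v.elim0
  · cases he
  · cases he
  · exact v.elim0

/-- Closing a skeleton by distributors. -/
def Skel.distribute (K : Skel S I []) (k h : ℕ) (mult : Fin (ctxTy k h).length → ℕ)
    (feed : (p : Fin (ctxTy k h).length) → Fin (mult p) → Vtx K.V I []) :
    Skel S I (ctxTy k h) where
  V := K.V ⊕ Σ p, Fin (mult p)
  Q := K.Q ⊕ (Σ p, Fin (mult p)) ⊕ Fin (ctxTy k h).length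
  P := K.P
  vlab v := match v with
    | .inl v => K.vlab v
    | .inr w => .wire (ctxWire k w.1.val)
  lab e := match e with
    | .inl e => K.lab e
    | .inr (.inl w) => .contr (ctxWire k w.1.val)
    | .inr (.inr p) => .weak (ctxWire k p.val)
  content e := match e with
    | .inl e => fun m cs os h => K.content e m cs os h
    | .inr (.inl _) => fun _ _ _ h => nomatch h
    | .inr (.inr _) => fun _ _ _ h => nomatch h
  src e := match e with
    | .inl e => fun i => (K.src e i).extend _ _
    | .inr (.inl w) => fun i =>
      if i.val = 0 then (feed w.1 w.2).extend _ _ else .inner (.inr w)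
    | .inr (.inr _) => fun i => i.elim0
  tgt e := match e with
    | .inl e => fun i => (K.tgt e i).extend _ _
    | .inr (.inl w) => fun _ => distNode _ mult w.1 w.2.val w.2.isLt.le
    | .inr (.inr p) => fun _ => distNode _ mult p (mult p) le_rfl
  ins := K.ins
  outs := K.outs
  psrc p i := (K.psrc p i).extend _ _
  ptgt p i := (K.ptgt p i).extend _ _

/-- The embedding of vertices in `Net.distribute`. -/
def Net.distEmb (G : Net S I []) (mult : Fin (ctxTy k h).length → ℕ) (v : G.Vert) :
    Vtx (G.V ⊕ Σ p, Fin (mult p)) I (ctxTy k h) :=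
  match v with
  | .inner v => .inner (.inl v)
  | .inp i => .inp i
  | .out j => j.elim0

/-- Distributors commute with gluing. -/
theorem Skel.distribute_iso {G : Net S I []} {K : Skel S I []}
    {N : (p : K.P) → Net S (K.ins p) (K.outs p)} {mult : Fin (ctxTy k h).length → ℕ}
    {feed : (p : Fin (ctxTy k h).length) → Fin (mult p) → G.Vert}
    {feed' : (p : Fin (ctxTy k h).length) → Fin (mult p) → Vtx K.V I []}
    (fV : G.V ≃ (K.glue N).V) (fE : G.E ≃ (K.glue N).E)
    (hV : ∀ v, (K.glue N).vlab (fV v) = G.vlab v)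
    (hE : ∀ e, (K.glue N).lab (fE e) = G.lab e)
    (hsrc : ∀ e i i', i.val = i'.val → (K.glue N).src (fE e) i' = (G.src e i).map fV)
    (htgt : ∀ e i i', i.val = i'.val → (K.glue N).tgt (fE e) i' = (G.tgt e i).map fV)
    (hbox : ∀ e m cs os h h',
      Net.Iso (G.content e m cs os h) ((K.glue N).content (fE e) m cs os h'))
    (hfeed : ∀ p c, (feed' p c).map .inl = (feed p c).map fV) :
    Net.Iso (Net.distribute k h G mult feed) ((K.distribute k h mult feed').glue N) := by
  -- The distributors are added after the parts on the left, and before them on the right.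
  let swap : ∀ X Y Z : Type, (X ⊕ Y) ⊕ Z ≃ (X ⊕ Z) ⊕ Y := fun X Y Z =>
    { toFun := fun x => match x with
        | .inl (.inl x) => .inl (.inl x)
        | .inl (.inr y) => .inr y
        | .inr z => .inl (.inr z)
      invFun := fun x => match x with
        | .inl (.inl x) => .inl (.inl x)
        | .inl (.inr y) => .inr y
        | .inr z => .inl (.inr z)
      left_inv := by rintro ((x | x) | x) <;> rfl
      right_inv := by rintro ((x | x) | x) <;> rfl }
  let gV : G.V ⊕ (Σ p, Fin (mult p)) ≃
      (K.V ⊕ Σ p, Fin (mult p)) ⊕ Σ p, (N p).V :=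
    (Equiv.sumCongr fV (Equiv.refl _)).trans (swap _ _ _)
  let gE : G.E ⊕ ((Σ p, Fin (mult p)) ⊕ Fin (ctxTy k h).length) ≃
      (K.Q ⊕ ((Σ p, Fin (mult p)) ⊕ Fin (ctxTy k h).length)) ⊕ Σ p, (N p).E :=
    (Equiv.sumCongr fE (Equiv.refl _)).trans (swap _ _ _)
  have hemb : ∀ v : G.Vert, (G.distEmb mult v).map gV =
      ((v.map fV).extend (ctxTy k h) (Σ p, Fin (mult p))).map (swap _ _ _) := by
    rintro (v | v | v)
    · rfl
    · rfl
    · exact v.elim0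
  have hinl : ∀ v : Vtx K.V I [], (v.extend (ctxTy k h) (Σ p, Fin (mult p))).map Sum.inl =
      ((v.map Sum.inl : (K.glue N).Vert).extend (ctxTy k h) (Σ p, Fin (mult p))).map
        (swap _ _ _) := by
    rintro (v | v | v)
    · rfl
    · rfl
    · exact v.elim0
  have hpart : ∀ p (v : (N p).Vert), (K.distribute k h mult feed').emb N p v =
      ((K.emb N p v : (K.glue N).Vert).extend (ctxTy k h) (Σ p, Fin (mult p))).map
        (swap _ _ _) := by
    rintro p (v | v | v)
    · rfl
    · exact hinl _
    · exact hinl _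
  have hnode : ∀ p c hc, (distNode K.V mult p c hc : Vtx _ I _).map Sum.inl =
      (distNode G.V mult p c hc : Vtx _ I _).map gV := by
    intro p c hc
    rcases c with _ | c <;> rfl
  let M := (K.distribute k h mult feed').glue N
  let toM : (K.glue N).E → M.E := fun x => swap K.Q (Σ p, (N p).E) _ (.inl x)
  have hlabM : ∀ x, M.lab (toM x) = (K.glue N).lab x := by
    rintro (x | x) <;> rfl
  have hsrcM : ∀ x i' (i : Fin (M.lab (toM x)).dom.length), i'.val = i.val → M.src (toM x) i =
      (((K.glue N).src x i').extend (ctxTy k h) (Σ p, Fin (mult p))).map (swap _ _ _) := by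
    rintro (x | x) i' i hi
    · obtain rfl : i' = i := Fin.ext hi
      exact hinl _
    · obtain rfl : i' = i := Fin.ext hi
      exact hpart _ _
  have htgtM : ∀ x i' (i : Fin (M.lab (toM x)).cod.length), i'.val = i.val → M.tgt (toM x) i =
      (((K.glue N).tgt x i').extend (ctxTy k h) (Σ p, Fin (mult p))).map (swap _ _ _) := by
    rintro (x | x) i' i hi
    · obtain rfl : i' = i := Fin.ext hi
      exact hinl _
    · obtain rfl : i' = i := Fin.ext hi
      exact hpart _ _
  have hboxM : ∀ x m cs os h h', Net.Iso ((K.glue N).content x m cs os h)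
      (M.content (toM x) m cs os h') := by
    rintro (x | x) m cs os h h' <;> exact .refl _
  refine .intro gV gE ?_ ?_ ?_ ?_ ?_
  · have key : ∀ x : (K.glue N).V, M.vlab (swap K.V (Σ p, (N p).V) _ (.inl x)) =
        (K.glue N).vlab x := by rintro (x | x) <;> rfl
    rintro (v | v)
    · exact (key _).trans (hV v)
    · rfl
  · rintro (v | v | v)
    · exact (hlabM _).trans (hE v)
    · rfl
    · rfl
  · rintro (e | w | p) i i' hi
    · refine (hsrcM (fE e) (i.cast (by rw [hE]; rfl)) i' hi).trans ?_
      rw [hsrc e i _ rfl, ← hemb]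
      rfl
    · obtain rfl : i = i' := Fin.ext hi
      change (if i.val = 0 then (feed' w.1 w.2).extend _ _ else _).map _ =
        (if i.val = 0 then G.distEmb mult (feed w.1 w.2) else .inner (.inr w)).map gV
      split_ifs
      · exact (hinl _).trans ((congrArg (fun v => (Vtx.extend _ _ v).map (swap _ _ _))
          (hfeed w.1 w.2)).trans (hemb _).symm)
      · rfl
    · exact i.elim0
  · rintro (e | w | p) i i' hi
    · refine (htgtM (fE e) (i.cast (by rw [hE]; rfl)) i' hi).trans ?_
      rw [htgt e i _ rfl, ← hemb]
      rfl
    · exact hnode _ _ _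
    · exact hnode _ _ _
  · rintro (e | w | p) m cs os hl hl'
    · exact (hbox e m cs os hl ((hE e).trans hl)).trans (hboxM _ _ _ _ _ _)
    · cases hl
    · cases hl

/-- The conditions on a skeleton without outputs, to be closed by distributors. -/
structure Skel.IsOpenLevel (K : Skel S I []) (k h : ℕ) (mult : Fin (ctxTy k h).length → ℕ)
    (feed : (p : Fin (ctxTy k h).length) → Fin (mult p) → Vtx K.V I []) : Prop where
  finiteV : Finite K.V
  finiteQ : Finite K.Q
  finiteP : Finite K.P
  src_lab : ∀ q i, K.vertLab (K.src q i) = (K.lab q).dom.get i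
  tgt_lab : ∀ q i, K.vertLab (K.tgt q i) = (K.lab q).cod.get i
  psrc_lab : ∀ p i, K.vertLab (K.psrc p i) = (K.ins p).get i
  ptgt_lab : ∀ p i, K.vertLab (K.ptgt p i) = (K.outs p).get i
  feed_lab : ∀ p c, K.vertLab (feed p c) = (ctxTy k h).get p
  src_bij : Function.Bijective (Sum.elim K.srcs fun w : Σ p, Fin (mult p) => feed w.1 w.2)
  tgt_inj : Function.Injective K.tgts
  tgt_ne_inp : ∀ a i, K.tgts a ≠ .inp i
  exists_tgt : ∀ v, (∃ i, v = .inp i) ∨ ∃ a, K.tgts a = v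
  no_box : ∀ q m cs os, K.lab q ≠ .box m cs os

/-- The vertices of `K` fed to the distributors are precisely those that are a source of nothing
yet, each fed once (`src_bij`), and they become first sources of contractions. In the distributor at
`p`, node `c + 1` is the second source of contraction `c`, node `c` is its target, and the last node
is the target of the weakening; node 0 is the output `p`. -/
theorem Skel.IsOpenLevel.distribute {K : Skel S I []} {mult : Fin (ctxTy k h).length → ℕ}
    {feed : (p : Fin (ctxTy k h).length) → Fin (mult p) → Vtx K.V I []}
    (hK : K.IsOpenLevel k h mult feed) : (K.distribute k h mult feed).IsLevel := by
  have := hK.finiteV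
  have := hK.finiteQ
  have := hK.finiteP
  let W := Σ p, Fin (mult p)
  let M := K.distribute k h mult feed
  have hlab : ∀ v : Vtx K.V I [], M.vertLab (v.extend (ctxTy k h) W) = K.vertLab v := by
    rintro (v | v | v)
    · rfl
    · rfl
    · exact v.elim0
  have hnode : ∀ p c hc, M.vertLab (distNode _ mult p c hc) = .wire (ctxWire k p.val) := by
    intro p c hc
    rcases c with _ | c
    · exact ctxTy_get k h p
    · rfl
  have hext : Function.Injective (Vtx.extend (ctxTy k h) W : Vtx K.V I [] → _) :=
    Vtx.extend_injective _ _
  -- the sources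
  let sOld : (Σ q, Fin (K.lab q).dom.length) ⊕ (Σ p, Fin (K.ins p).length) →
      (Σ q, Fin (M.lab q).dom.length) ⊕ (Σ p, Fin (M.ins p).length) :=
    Sum.map (fun x => ⟨.inl x.1, x.2⟩) id
  let sFeed : W → (Σ q, Fin (M.lab q).dom.length) ⊕ (Σ p, Fin (M.ins p).length) :=
    fun w => .inl ⟨.inr (.inl w), (0 : Fin 2)⟩
  let sNode : W → (Σ q, Fin (M.lab q).dom.length) ⊕ (Σ p, Fin (M.ins p).length) :=
    fun w => .inl ⟨.inr (.inl w), (1 : Fin 2)⟩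
  have sOld_eq : ∀ x, M.srcs (sOld x) = (K.srcs x).extend _ _ := by
    rintro (x | x) <;> rfl
  have sFeed_eq : ∀ w, M.srcs (sFeed w) = (feed w.1 w.2).extend _ _ := fun _ => rfl
  have sNode_eq : ∀ w, M.srcs (sNode w) = .inner (.inr w) := fun _ => rfl
  have sCases : ∀ x, (∃ y, x = sOld y) ∨ (∃ w, x = sFeed w) ∨ ∃ w, x = sNode w := by
    rintro (⟨q | w | p, i⟩ | x)
    · exact .inl ⟨.inl ⟨q, i⟩, rfl⟩
    · rcases (by decide : ∀ i : Fin 2, i = 0 ∨ i = 1) i with hi | hi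
      · exact .inr (.inl ⟨w, by rw [show i = (0 : Fin 2) from hi]⟩)
      · exact .inr (.inr ⟨w, by rw [show i = (1 : Fin 2) from hi]⟩)
    · exact i.elim0
    · exact .inl ⟨.inr x, rfl⟩
  have hextne : ∀ (v : Vtx K.V I []) (w : W), v.extend (ctxTy k h) W ≠ .inner (.inr w) := by
    rintro (v | v | v) w hw
    · cases hw
    · cases hw
    · exact v.elim0
  have hextout : ∀ (v : Vtx K.V I []) j, v.extend (ctxTy k h) W ≠ .out j := by
    rintro (v | v | v) w hw
    · cases hw
    · cases hw
    · exact v.elim0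
  have hextinp : ∀ (v : Vtx K.V I []) j, v.extend (ctxTy k h) W = .inp j → v = .inp j := by
    rintro (v | v | v) w hw
    · cases hw
    · cases hw; rfl
    · exact v.elim0
  -- the targets
  let tOld : (Σ q, Fin (K.lab q).cod.length) ⊕ (Σ p, Fin (K.outs p).length) →
      (Σ q, Fin (M.lab q).cod.length) ⊕ (Σ p, Fin (M.outs p).length) :=
    Sum.map (fun x => ⟨.inl x.1, x.2⟩) id
  -- The edge with target node `c`: contraction `c`, or the weakening at the end, when `c = mult p`.
  let tNode : (p : _) → (c : ℕ) → c ≤ mult p →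
      (Σ q, Fin (M.lab q).cod.length) ⊕ (Σ p, Fin (M.outs p).length) :=
    fun p c hc => if hc : c < mult p then .inl ⟨.inr (.inl ⟨p, ⟨c, hc⟩⟩), (0 : Fin 1)⟩
      else .inl ⟨.inr (.inr p), (0 : Fin 1)⟩
  have tOld_eq : ∀ x, M.tgts (tOld x) = (K.tgts x).extend _ _ := by
    rintro (x | x) <;> rfl
  have tNode_eq : ∀ p c hc, M.tgts (tNode p c hc) = distNode _ mult p c hc := by
    intro p c hc
    by_cases hc' : c < mult p
    · simp only [tNode, dif_pos hc']
      rfl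
    · obtain rfl : c = mult p := by omega
      simp only [tNode, dif_neg hc']
      rfl
  have tCases : ∀ x, (∃ y, x = tOld y) ∨ ∃ p c hc, x = tNode p c hc := by
    rintro (⟨q | w | p, i⟩ | x)
    · exact .inl ⟨.inl ⟨q, i⟩, rfl⟩
    · refine .inr ⟨w.1, w.2.val, w.2.isLt.le, ?_⟩
      simp only [tNode, dif_pos w.2.isLt]
      rw [show i = (0 : Fin 1) from Subsingleton.elim (α := Fin 1) _ _]
    · refine .inr ⟨p, mult p, le_rfl, ?_⟩
      simp only [tNode, dif_neg (lt_irrefl _)]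
      rw [show i = (0 : Fin 1) from Subsingleton.elim (α := Fin 1) _ _]
    · exact .inl ⟨.inr x, rfl⟩
  refine ⟨?_, ?_, hK.finiteP, ?_, ?_, ?_, ?_, ?_, ?_, ?_, ?_, ?_, ?_, ?_⟩
  · exact inferInstanceAs (Finite (K.V ⊕ Σ p, Fin (mult p)))
  · exact inferInstanceAs (Finite (K.Q ⊕ (Σ p, Fin (mult p)) ⊕ Fin (ctxTy k h).length))
  · rintro (q | w | p) i
    · exact (hlab _).trans (hK.src_lab q i)
    · rcases (by decide : ∀ i : Fin 2, i = 0 ∨ i = 1) i with hi | hi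
      · rw [show i = (0 : Fin 2) from hi]
        exact (hlab _).trans ((hK.feed_lab _ _).trans (ctxTy_get k h w.1))
      · rw [show i = (1 : Fin 2) from hi]
        rfl
    · exact i.elim0
  · rintro (q | w | p) i
    · exact (hlab _).trans (hK.tgt_lab q i)
    · rw [show i = (0 : Fin 1) from Subsingleton.elim (α := Fin 1) _ _]
      exact hnode _ _ _
    · rw [show i = (0 : Fin 1) from Subsingleton.elim (α := Fin 1) _ _]
      exact hnode _ _ _
  · intro p i
    exact (hlab _).trans (hK.psrc_lab p i)
  · intro p i
    exact (hlab _).trans (hK.ptgt_lab p i)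
  · intro x y hxy
    replace hxy : M.srcs x = M.srcs y := hxy
    rcases sCases x with ⟨x, rfl⟩ | ⟨x, rfl⟩ | ⟨x, rfl⟩ <;>
      rcases sCases y with ⟨y, rfl⟩ | ⟨y, rfl⟩ | ⟨y, rfl⟩ <;>
      simp only [sOld_eq, sFeed_eq, sNode_eq] at hxy
    · cases @hK.src_bij.1 (.inl x) (.inl y) (hext hxy); rfl
    · cases @hK.src_bij.1 (.inl x) (.inr y) (hext hxy)
    · exact (hextne _ _ hxy).elim
    · cases @hK.src_bij.1 (.inr x) (.inl y) (hext hxy)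
    · cases @hK.src_bij.1 (.inr x) (.inr y) (hext hxy); rfl
    · exact (hextne _ _ hxy).elim
    · exact (hextne _ _ hxy.symm).elim
    · exact (hextne _ _ hxy.symm).elim
    · cases hxy; rfl
  · intro x y hxy
    replace hxy : M.tgts x = M.tgts y := hxy
    rcases tCases x with ⟨x, rfl⟩ | ⟨p, c, hc, rfl⟩ <;>
      rcases tCases y with ⟨y, rfl⟩ | ⟨p', c', hc', rfl⟩ <;>
      simp only [tOld_eq, tNode_eq] at hxy
    · cases hK.tgt_inj (hext hxy); rfl
    · exact (extend_ne_distNode hxy).elim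
    · exact (extend_ne_distNode hxy.symm).elim
    · obtain ⟨rfl, rfl⟩ := distNode_inj hxy; rfl
  · intro x j hx
    replace hx : M.srcs x = .out j := hx
    rcases sCases x with ⟨x, rfl⟩ | ⟨x, rfl⟩ | ⟨x, rfl⟩ <;>
      simp only [sOld_eq, sFeed_eq, sNode_eq] at hx
    · exact hextout _ _ hx
    · exact hextout _ _ hx
    · cases hx
  · intro x j hx
    replace hx : M.tgts x = .inp j := hx
    rcases tCases x with ⟨x, rfl⟩ | ⟨p, c, hc, rfl⟩ <;> simp only [tOld_eq, tNode_eq] at hx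
    · exact hK.tgt_ne_inp _ _ (hextinp _ _ hx)
    · rcases c with _ | c <;> cases hx
  · have key : ∀ v : Vtx K.V I [], ∃ a, M.srcs a = v.extend _ _ := by
      intro v
      obtain ⟨x | w, hx⟩ := hK.src_bij.2 v
      · exact ⟨sOld x, by rw [sOld_eq]; exact congrArg _ hx⟩
      · exact ⟨sFeed w, by rw [sFeed_eq]; exact congrArg _ hx⟩
    rintro ((v | w) | v | v)
    · exact .inr (key (.inner v))
    · exact .inr ⟨sNode w, sNode_eq w⟩
    · exact .inr (key (.inp v))
    · exact .inl ⟨v, rfl⟩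
  · have key : ∀ v : Vtx K.V I [], (∃ i, v.extend (ctxTy k h) W = .inp i) ∨
        ∃ a, M.tgts a = v.extend _ _ := by
      intro v
      rcases hK.exists_tgt v with ⟨i, rfl⟩ | ⟨x, rfl⟩
      · exact .inl ⟨i, rfl⟩
      · exact .inr ⟨tOld x, tOld_eq x⟩
    rintro ((v | w) | v | v)
    · exact key (.inner v)
    · exact .inr ⟨tNode w.1 (w.2.val + 1) w.2.isLt, tNode_eq _ _ _⟩
    · exact key (.inp v)
    · exact .inr ⟨tNode v 0 (Nat.zero_le _), tNode_eq v 0 (Nat.zero_le _)⟩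
  · rintro (q | w | p) m cs os hl
    · exact (hK.no_box q m cs os hl).elim
    · cases hl
    · cases hl

end Distribute

/-! ### The term constructors as closed skeletons -/

section Constructors

variable {S : Sig.{u}}

/-! ### Variables and atoms -/

/-- The skeleton of a variable. -/
def varSkel (S : Sig.{u}) (τ : VLab) : Skel S [τ] [] where
  V := Empty
  Q := Empty
  P := Empty
  vlab v := v.elim
  lab q := q.elim
  content q := q.elim
  src q := q.elim
  tgt q := q.elim
  ins p := p.elim
  outs p := p.elim
  psrc p := p.elim
  ptgt p := p.elim

/-- The skeleton of an atom. -/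
def atomSkel (S : Sig.{u}) (τ : VLab) : Skel S [τ] [] where
  V := Unit
  Q := Unit
  P := Empty
  vlab _ := diam
  lab _ := .inst
  content _ _ _ _ h := nomatch h
  src _ _ := .inp ⟨0, Nat.one_pos⟩
  tgt _ _ := .inner ()
  ins p := p.elim
  outs p := p.elim
  psrc p := p.elim
  ptgt p := p.elim

section VarAtom

variable {X : Type v} {A : Type w}

open Classical in
theorem varNet_iso (τ : VLab) (xs : List X) (as : List A) (x : X) :
    Net.Iso (varNet τ xs as x : Net S _ _) (((varSkel S τ).distribute xs.length as.length
      (fun p => if xs[p.val]? = some x then 1 else 0)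
      (fun _ _ => .inp ⟨0, Nat.one_pos⟩)).glue fun p => p.elim) := by
  refine Skel.distribute_iso
    { toFun := fun v => v.elim
      invFun := fun v => match v with
        | .inl v => v
        | .inr ⟨p, _⟩ => p
      left_inv := fun v => v.elim
      right_inv := by rintro (v | ⟨v, _⟩) <;> exact v.elim }
    { toFun := fun v => v.elim
      invFun := fun v => match v with
        | .inl v => v
        | .inr ⟨p, _⟩ => p
      left_inv := fun v => v.elim
      right_inv := by rintro (v | ⟨v, _⟩) <;> exact v.elim }
    (fun v => v.elim) (fun e => e.elim) (fun e => e.elim) (fun e => e.elim) (fun e => e.elim) ?_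
  intro p c
  rfl

open Classical in
-- The input is the only vertex, and it must be fed to a distributor exactly once. Membership of `x`
-- gives a position, and distinctness of the variables makes it unique.
theorem varSkel_isOpenLevel {xs : List X} (as : List A) {x : X} (hxs : xs.Nodup) (hx : x ∈ xs) :
    (varSkel S star).IsOpenLevel xs.length as.length
      (fun p => if xs[p.val]? = some x then 1 else 0) (fun _ _ => .inp ⟨0, Nat.one_pos⟩) := by
  refine ⟨inferInstanceAs (Finite Empty), inferInstanceAs (Finite Empty),
    inferInstanceAs (Finite Empty), nofun, nofun, nofun, nofun, ?_, ⟨?_, ?_⟩, ?_, ?_, ?_, nofun⟩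
  · intro p c
    have hp : xs[p.val]? = some x := by
      by_contra hp
      have := c.isLt
      simp [hp] at this
    have hlt : p.val < xs.length := by
      by_contra h
      rw [List.getElem?_eq_none (by omega)] at hp
      cases hp
    rw [ctxTy_get, ctxWire, if_pos hlt]
    rfl
  · rintro ((⟨z, -⟩ | ⟨z, -⟩) | ⟨p, c⟩) ((⟨z', -⟩ | ⟨z', -⟩) | ⟨p', c'⟩) -
    all_goals try exact z.elim
    all_goals try exact z'.elim
    -- The multiplicity is positive only at the position of `x`.
    have hp : ∀ (p : Fin (ctxTy xs.length as.length).length)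
        (_ : Fin (if xs[p.val]? = some x then 1 else 0)), xs[p.val]? = some x := by
      intro p c
      by_contra hp
      have := c.isLt
      simp [hp] at this
    have h1 := hp p c
    have h2 := hp p' c'
    have hpp : p = p' := by
      obtain ⟨i1, j1⟩ := List.getElem?_eq_some_iff.1 h1
      obtain ⟨i2, j2⟩ := List.getElem?_eq_some_iff.1 h2
      exact Fin.ext ((hxs.getElem_inj_iff).1 (j1.trans j2.symm))
    subst hpp
    have hsub : Subsingleton (Fin (if xs[p.val]? = some x then 1 else 0)) := by
      rw [if_pos h1]; infer_instance
    rw [hsub.elim c c']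
  · rintro (v | v | v)
    · exact v.elim
    · obtain ⟨i, hi, hix⟩ := List.getElem_of_mem hx
      have hx' : xs[i]? = some x := List.getElem?_eq_some_iff.2 ⟨hi, hix⟩
      refine ⟨.inr ⟨⟨i, by rw [ctxTy_length]; omega⟩, ⟨0, ?_⟩⟩, ?_⟩
      · simp [hx']
      · exact congrArg Vtx.inp (Subsingleton.elim (α := Fin 1) _ _)
    · exact v.elim0
  · rintro (⟨z, -⟩ | ⟨z, -⟩) <;> exact z.elim
  · rintro (⟨z, -⟩ | ⟨z, -⟩) <;> exact z.elim
  · rintro (v | v | v)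
    · exact v.elim
    · exact .inl ⟨v, rfl⟩
    · exact v.elim0

open Classical in
theorem atomNet_iso (τ : VLab) (xs : List X) (as : List A) (a : A) :
    Net.Iso (atomNet τ xs as a : Net S _ _) (((atomSkel S τ).distribute xs.length as.length
      (fun p => if xs.length ≤ p.val ∧ as[p.val - xs.length]? = some a then 1 else 0)
      (fun _ _ => .inner ())).glue fun p => p.elim) := by
  refine Skel.distribute_iso
    { toFun := fun v => .inl v
      invFun := fun v => match v with
        | .inl v => v
        | .inr ⟨p, _⟩ => p.elim
      left_inv := fun v => rfl
      right_inv := by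
        rintro (v | ⟨v, _⟩)
        · rfl
        · exact v.elim }
    { toFun := fun v => .inl v
      invFun := fun v => match v with
        | .inl v => v
        | .inr ⟨p, _⟩ => p.elim
      left_inv := fun v => rfl
      right_inv := by
        rintro (v | ⟨v, _⟩)
        · rfl
        · exact v.elim }
    (fun v => rfl) (fun e => rfl) (fun e _ _ _ => rfl) (fun e _ _ _ => rfl)
    (fun e _ _ _ h => nomatch h) ?_
  intro p c
  rfl

open Classical in
-- The input is the source of the instance edge. The target of that edge is fed exactly once, at the
-- unique position of `a`, which comes after the `xs.length` positions of the variables.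
theorem atomSkel_isOpenLevel (xs : List X) {as : List A} {a : A} (has : as.Nodup) (ha : a ∈ as) :
    (atomSkel S star).IsOpenLevel xs.length as.length
      (fun p => if xs.length ≤ p.val ∧ as[p.val - xs.length]? = some a then 1 else 0)
      (fun _ _ => .inner ()) := by
  have hp : ∀ (p : Fin (ctxTy xs.length as.length).length)
      (_ : Fin (if xs.length ≤ p.val ∧ as[p.val - xs.length]? = some a then 1 else 0)),
      xs.length ≤ p.val ∧ as[p.val - xs.length]? = some a := by
    intro p c
    by_contra hp
    have := c.isLt
    simp [hp] at this
  refine ⟨inferInstanceAs (Finite Unit), inferInstanceAs (Finite Unit),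
    inferInstanceAs (Finite Empty), fun _ i => ?_, fun _ i => ?_, nofun, nofun, ?_, ⟨?_, ?_⟩,
    ?_, ?_, ?_, nofun⟩
  · rw [show i = (0 : Fin 1) from Subsingleton.elim (α := Fin 1) _ _]; rfl
  · rw [show i = (0 : Fin 1) from Subsingleton.elim (α := Fin 1) _ _]; rfl
  · intro p c
    rw [ctxTy_get, ctxWire, if_neg (by have := (hp p c).1; omega)]
    rfl
  · rintro ((⟨⟨⟩, i⟩ | ⟨z, -⟩) | ⟨p, c⟩) ((⟨⟨⟩, i'⟩ | ⟨z', -⟩) | ⟨p', c'⟩) hh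
    all_goals try exact z.elim
    all_goals try exact z'.elim
    · rw [show i = i' from Subsingleton.elim (α := Fin 1) _ _]
    · cases hh
    · cases hh
    have h1 := hp p c
    have h2 := hp p' c'
    have hpp : p = p' := by
      obtain ⟨i1, j1⟩ := List.getElem?_eq_some_iff.1 h1.2
      obtain ⟨i2, j2⟩ := List.getElem?_eq_some_iff.1 h2.2
      have := (has.getElem_inj_iff).1 (j1.trans j2.symm)
      exact Fin.ext (by omega)
    subst hpp
    have hsub : Subsingleton
        (Fin (if xs.length ≤ p.val ∧ as[p.val - xs.length]? = some a then 1 else 0)) := by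
      rw [if_pos h1]; infer_instance
    rw [hsub.elim c c']
  · rintro (v | v | v)
    · obtain ⟨i, hi, hix⟩ := List.getElem_of_mem ha
      have hx' : as[i]? = some a := List.getElem?_eq_some_iff.2 ⟨hi, hix⟩
      refine ⟨.inr ⟨⟨xs.length + i, by rw [ctxTy_length]; omega⟩, ⟨0, ?_⟩⟩, rfl⟩
      simp [hx']
    · refine ⟨.inl (.inl ⟨(), (0 : Fin 1)⟩), ?_⟩
      exact congrArg Vtx.inp (Subsingleton.elim (α := Fin 1) _ _)
    · exact v.elim0
  · rintro (⟨⟨⟩, i⟩ | ⟨z, -⟩) (⟨⟨⟩, i'⟩ | ⟨z', -⟩) hh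
    all_goals try exact z.elim
    all_goals try exact z'.elim
    rw [show i = i' from Subsingleton.elim (α := Fin 1) _ _]
  · rintro (⟨⟨⟩, i⟩ | ⟨z, -⟩) j hj
    · cases hj
    · exact z.elim
  · rintro (v | v | v)
    · exact .inr ⟨.inl ⟨(), (0 : Fin 1)⟩, rfl⟩
    · exact .inl ⟨v, rfl⟩
    · exact v.elim0

end VarAtom

/-! ### Binders -/

/-- With `dropPos_surjective`: one output of the body goes to the binder (`none`) and the others
correspond bijectively to the outputs of the whole. -/
theorem dropPos_injective {k N M : ℕ} (hk : k ≤ M) (hN : N = M + 1) :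
    Function.Injective (dropPos k hk hN) := by
  intro p q h
  have := p.isLt
  have := q.isLt
  unfold dropPos at h
  apply Fin.ext
  split_ifs at h <;> simp_all <;> omega

theorem dropPos_surjective {k N M : ℕ} (hk : k ≤ M) (hN : N = M + 1) :
    Function.Surjective (dropPos k hk hN) := by
  rintro (_ | p)
  · exact ⟨⟨k, by omega⟩, by simp [dropPos]⟩
  · have := p.isLt
    by_cases h : p.val < k
    · exact ⟨⟨p, by omega⟩, by simp [dropPos, h]⟩
    · refine ⟨⟨p + 1, by omega⟩, ?_⟩
      simp [dropPos, show ¬ (p.val + 1 < k) by omega, show ¬ (p.val + 1 = k) by omega]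

theorem le_ctxTy_length (k h : ℕ) : k ≤ (ctxTy k h).length := by simp [ctxTy_length]

variable {I O : List VLab} {k h : ℕ}

/-- The skeleton of a binder: the part `true` is the body, `false` is the bound term. -/
def linkSkel (S : Sig.{u}) (I : List VLab) (k h : ℕ) (J Y : Type) (jlab : J → VLab) (top bot : J)
    (hO : O.length = (ctxTy k h).length + 1) : Skel S I [] where
  V := J ⊕ (Fin (ctxTy k h).length × Fin 2)
  Q := Y
  P := Bool
  vlab v := match v with
    | .inl j => jlab j
    | .inr (p, _) => (ctxTy k h).get p
  lab _ := .atom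
  content _ _ _ _ h := nomatch h
  src _ _ := .inner (.inl top)
  tgt _ _ := .inner (.inl bot)
  ins b := match b with
    | true => I
    | false => [star]
  outs b := match b with
    | true => O
    | false => ctxTy k h
  psrc b := match b with
    | true => fun i => .inp i
    | false => fun _ => .inner (.inl bot)
  ptgt b := match b with
    | true => fun j => match dropPos k (le_ctxTy_length k h) hO j with
      | none => .inner (.inl top)
      | some p => .inner (.inr (p, 0))
    | false => fun p => .inner (.inr (p, 1))

/-- The parts of a binder. -/
def linkParts (J Y : Type) (jlab : J → VLab) (top bot : J)
    (hO : O.length = (ctxTy k h).length + 1) (G : Net S I O) (K : Net S [star] (ctxTy k h)) :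
    (b : (linkSkel S I k h J Y jlab top bot hO).P) →
      Net S ((linkSkel S I k h J Y jlab top bot hO).ins b)
        ((linkSkel S I k h J Y jlab top bot hO).outs b)
  | true => G
  | false => K

/-- The closed skeleton of a binder. -/
def linkSkel' (S : Sig.{u}) (I : List VLab) (k h : ℕ) (J Y : Type) (jlab : J → VLab) (top bot : J)
    (hO : O.length = (ctxTy k h).length + 1) : Skel S I (ctxTy k h) :=
  (linkSkel S I k h J Y jlab top bot hO).distribute k h (fun _ => 2)
    (fun p c => .inner (.inr (p, c)))

theorem linkNet_iso {J Y : Type} {jlab : J → VLab} {top bot : J}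
    (G : Net S I O) (hO : O.length = (ctxTy k h).length + 1) (K : Net S [star] (ctxTy k h)) :
    Net.Iso (linkNet k h J Y jlab top bot G hO K)
      ((linkSkel' S I k h J Y jlab top bot hO).glue (linkParts J Y jlab top bot hO G K)) := by
  let L := linkSkel S I k h J Y jlab top bot hO
  let N := linkParts J Y jlab top bot hO G K
  let D : Type := J ⊕ (Fin (ctxTy k h).length × Fin 2)
  let fV : G.V ⊕ K.V ⊕ D ≃ D ⊕ Σ b, (N b).V :=
    { toFun := fun v => match v with
        | .inl v => .inr ⟨true, v⟩
        | .inr (.inl v) => .inr ⟨false, v⟩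
        | .inr (.inr v) => .inl v
      invFun := fun v => match v with
        | .inl v => .inr (.inr v)
        | .inr ⟨true, v⟩ => .inl v
        | .inr ⟨false, v⟩ => .inr (.inl v)
      left_inv := by rintro (v | v | v) <;> rfl
      right_inv := by rintro (v | ⟨_ | _, v⟩) <;> rfl }
  let fE : G.E ⊕ K.E ⊕ Y ≃ Y ⊕ Σ b, (N b).E :=
    { toFun := fun v => match v with
        | .inl v => .inr ⟨true, v⟩
        | .inr (.inl v) => .inr ⟨false, v⟩
        | .inr (.inr v) => .inl v
      invFun := fun v => match v with
        | .inl v => .inr (.inr v)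
        | .inr ⟨true, v⟩ => .inl v
        | .inr ⟨false, v⟩ => .inr (.inl v)
      left_inv := by rintro (v | v | v) <;> rfl
      right_inv := by rintro (v | ⟨_ | _, v⟩) <;> rfl }
  have hG : ∀ v : G.Vert, L.emb N true v = (match v with
      | .inner v => .inner (.inl v)
      | .inp i => .inp i
      | .out j => match dropPos k (by simp [ctxTy_length]) hO j with
        | none => .inner (.inr (.inr (.inl top)))
        | some p => .inner (.inr (.inr (.inr (p, 0)))) :
          Vtx (G.V ⊕ K.V ⊕ J ⊕ (Fin (ctxTy k h).length × Fin 2)) I []).map fV := by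
    rintro (v | v | v)
    · rfl
    · rfl
    · change Vtx.map _ (match dropPos k (le_ctxTy_length k h) hO v with
        | none => .inner (.inl top)
        | some p => .inner (.inr (p, 0)) : Vtx D I []) = _
      dsimp only
      rcases dropPos k (le_ctxTy_length k h) hO v with _ | p <;> rfl
  have hK : ∀ v : K.Vert, L.emb N false v = (match v with
      | .inner v => .inner (.inr (.inl v))
      | .inp _ => .inner (.inr (.inr (.inl bot)))
      | .out p => .inner (.inr (.inr (.inr (p, 1)))) :
          Vtx (G.V ⊕ K.V ⊕ J ⊕ (Fin (ctxTy k h).length × Fin 2)) I []).map fV := by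
    rintro (v | v | v) <;> rfl
  unfold linkNet linkSkel'
  refine Skel.distribute_iso fV fE ?_ ?_ ?_ ?_ ?_ ?_
  · rintro (v | v | v | v) <;> rfl
  · rintro (v | v | v) <;> rfl
  · rintro (e | e | e) i i' hi
    · obtain rfl : i = i' := Fin.ext hi
      exact hG _
    · obtain rfl : i = i' := Fin.ext hi
      exact hK _
    · rfl
  · rintro (e | e | e) i i' hi
    · obtain rfl : i = i' := Fin.ext hi
      exact hG _
    · obtain rfl : i = i' := Fin.ext hi
      exact hK _
    · rfl
  · rintro (e | e | e) m cs os hl hl'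
    · exact .refl _
    · exact .refl _
    · cases hl
  · intro p c
    rfl

/-- Each vertex of `J` has to be a source exactly once and a target exactly once. The vertex `bot`
is the source of the bound term, and `top` of the atom edges (`hs`); `top` is a target of the body,
and `bot` of the atom edges (`ht`). In both, `none` stands for the part and `some y` for the atom
edge `y`. This covers a wire (`J` a point, `Y` empty) and an atom edge between two vertices. -/
theorem linkSkel_isOpenLevel {J Y : Type} [Finite J] [Finite Y] {jlab : J → VLab} {top bot : J}
    {hO : O.length = (ctxTy k h).length + 1}
    (hs : Function.Bijective fun y : Option Y => y.elim bot fun _ => top)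
    (ht : Function.Bijective fun y : Option Y => y.elim top fun _ => bot)
    (hbot : jlab bot = star) (htop : Y → jlab top = diam)
    (hlab : ∀ j, O.get j = (dropPos k (le_ctxTy_length k h) hO j).elim (jlab top) (ctxTy k h).get) :
    (linkSkel S I k h J Y jlab top bot hO).IsOpenLevel k h (fun _ => 2)
      (fun p c => .inner (.inr (p, c))) := by
  have hsub : ∀ i i' : Fin 1, i = i' := Subsingleton.elim
  have hss : ∀ y y' : Option Y, y.elim bot (fun _ => top) = y'.elim bot (fun _ => top) → y = y' :=
    fun y y' hy => hs.1 hy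
  have htt : ∀ y y' : Option Y, y.elim top (fun _ => bot) = y'.elim top (fun _ => bot) → y = y' :=
    fun y y' hy => ht.1 hy
  let L := linkSkel S I k h J Y jlab top bot hO
  have hinner : ∀ {x y : L.V}, (Vtx.inner x : Vtx L.V I []) = .inner y → x = y :=
    fun hh => by cases hh; rfl
  let tgtO : Option (Fin (ctxTy k h).length) → Vtx L.V I [] := fun o => match o with
    | none => .inner (.inl top)
    | some p => .inner (.inr (p, 0))
  have htgtO : ∀ j, L.ptgt true j = tgtO (dropPos k (le_ctxTy_length k h) hO j) := fun _ => rfl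
  have htgtO_inj : Function.Injective tgtO := by
    rintro (_ | p) (_ | q) hpq <;> cases hpq <;> rfl
  have hinp : ∀ o j, tgtO o ≠ .inp j := by
    rintro (_ | p) j hh <;> cases hh
  refine ⟨?_, inferInstanceAs (Finite Y), inferInstanceAs (Finite Bool), ?_, ?_, ?_, ?_, ?_,
    ⟨?_, ?_⟩, ?_, ?_, ?_, nofun⟩
  · exact inferInstanceAs (Finite (J ⊕ (Fin (ctxTy k h).length × Fin 2)))
  · intro y i
    rw [show i = (0 : Fin 1) from hsub _ _]
    exact htop y
  · intro y i
    rw [show i = (0 : Fin 1) from hsub _ _]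
    exact hbot
  · rintro (_ | _) i
    · rw [show i = (0 : Fin 1) from hsub _ _]
      exact hbot
    · rfl
  · rintro (_ | _) j
    · rfl
    · refine Eq.trans ?_ (hlab j).symm
      refine (congrArg L.vertLab (htgtO j)).trans ?_
      rcases dropPos k (le_ctxTy_length k h) hO j with _ | p <;> rfl
  · intro p c
    rfl
  · rintro ((⟨y, i⟩ | ⟨_ | _, i⟩) | ⟨p, c⟩) ((⟨y', i'⟩ | ⟨_ | _, i'⟩) | ⟨p', c'⟩) hh
    · cases hss (some y) (some y') rfl
      rw [show i = i' from hsub _ _]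
    · replace hh : (Vtx.inner (.inl top) : Vtx L.V I []) = .inner (.inl bot) := hh
      cases hss (some y) none (Sum.inl_injective (hinner hh))
    · cases hh
    · cases hh
    · replace hh : (Vtx.inner (.inl bot) : Vtx L.V I []) = .inner (.inl top) := hh
      cases hss none (some y') (Sum.inl_injective (hinner hh))
    · rw [show i = i' from hsub _ _]
    · cases hh
    · cases hh
    · cases hh
    · cases hh
    · cases hh; rfl
    · cases hh
    · cases hh
    · cases hh
    · cases hh
    · cases hh; rfl
  · rintro ((j | ⟨p, c⟩) | v | v)
    · obtain ⟨_ | y, hy⟩ := hs.2 j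
      · exact ⟨.inl (.inr ⟨false, (0 : Fin 1)⟩), congrArg (fun j => (Vtx.inner (Sum.inl j) : Vtx L.V I [])) hy⟩
      · exact ⟨.inl (.inl ⟨y, (0 : Fin 1)⟩), congrArg (fun j => (Vtx.inner (Sum.inl j) : Vtx L.V I [])) hy⟩
    · exact ⟨.inr ⟨p, c⟩, rfl⟩
    · exact ⟨.inl (.inr ⟨true, v⟩), rfl⟩
    · exact v.elim0
  -- The body and an atom edge never share a target: by injectivity of `ht`, an atom edge forces
  -- `top ≠ bot`.
  · have h1 : ∀ j, tgtO j ≠ .inner (.inl bot) ∨ IsEmpty Y := by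
      rintro (_ | p)
      · by_cases hY : IsEmpty Y
        · exact .inr hY
        · obtain ⟨y⟩ := not_isEmpty_iff.1 hY
          refine .inl fun hh => ?_
          cases htt none (some y) (Sum.inl_injective (hinner hh))
      · exact .inl nofun
    have h2 : ∀ j p, tgtO j ≠ .inner (.inr (p, 1)) := by
      rintro (_ | p) p' hp <;> cases hp
    have h3 : ∀ (y : Y) j, tgtO j ≠ .inner (.inl bot) := fun y j =>
      (h1 j).resolve_right fun hY => hY.false y
    rintro (⟨y, i⟩ | ⟨_ | _, i⟩) (⟨y', i'⟩ | ⟨_ | _, i'⟩) hh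
    · cases htt (some y) (some y') rfl
      rw [show i = i' from hsub _ _]
    · cases hh
    · exact (h3 y _ hh.symm).elim
    · cases hh
    · cases hh; rfl
    · exact (h2 _ _ hh.symm).elim
    · exact (h3 y' _ hh).elim
    · exact (h2 _ _ hh).elim
    · obtain rfl : i = i' := dropPos_injective _ _ (htgtO_inj hh)
      rfl
  · rintro (⟨y, i⟩ | ⟨_ | _, i⟩) j hh
    · cases hh
    · cases hh
    · exact hinp _ j hh
  · have htrue : ∀ o, ∃ a, L.tgts a = tgtO o := by
      intro o
      obtain ⟨j, hj⟩ := dropPos_surjective (le_ctxTy_length k h) hO o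
      exact ⟨.inr ⟨true, j⟩, (htgtO j).trans (congrArg tgtO hj)⟩
    rintro ((j | ⟨p, c⟩) | v | v)
    · right
      obtain ⟨_ | y, hy⟩ := ht.2 j
      · obtain ⟨a, ha⟩ := htrue none
        exact ⟨a, ha.trans (congrArg (fun j => (Vtx.inner (Sum.inl j) : Vtx L.V I [])) hy)⟩
      · exact ⟨.inl ⟨y, (0 : Fin 1)⟩, congrArg (fun j => (Vtx.inner (Sum.inl j) : Vtx L.V I [])) hy⟩
    · right
      rcases (by decide : ∀ i : Fin 2, i = 0 ∨ i = 1) c with rfl | rfl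
      · exact htrue (some p)
      · exact ⟨.inr ⟨false, p⟩, rfl⟩
    · exact .inl ⟨v, rfl⟩
    · exact v.elim0

/-! ### Operations -/

/-- The skeleton of an operation. -/
def opSkel (τ : VLab) (k h : ℕ) (φ : S.Op) : Skel S [τ] [] where
  V := Fin (Lab.cod (.op φ : Lab S)).length ⊕
    (Fin (ctxTy k h).length × Fin (S.eager φ + (S.deferred φ).length))
  Q := Unit
  P := Fin (S.eager φ) ⊕ Fin (S.deferred φ).length
  vlab v := match v with
    | .inl r => (Lab.cod (.op φ : Lab S)).get r
    | .inr (p, _) => (ctxTy k h).get p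
  lab _ := .op φ
  content _ _ _ _ h := nomatch h
  src _ _ := .inp ⟨0, Nat.one_pos⟩
  tgt _ r := .inner (.inl r)
  ins p := match p with
    | .inl _ => [star]
    | .inr j => [.thunk ((S.deferred φ).get j)]
  outs _ := ctxTy k h
  psrc p := match p with
    | .inl i => fun _ => .inner (.inl
        ((Fin.castAdd (S.deferred φ).length i).cast (cod_op_length φ).symm))
    | .inr j => fun _ => .inner (.inl
        ((Fin.natAdd (S.eager φ) j).cast (cod_op_length φ).symm))
  ptgt p := match p with
    | .inl i => fun p => .inner (.inr (p, Fin.castAdd (S.deferred φ).length i))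
    | .inr j => fun p => .inner (.inr (p, Fin.natAdd (S.eager φ) j))

/-- The parts of an operation. -/
def opParts (τ : VLab) (k h : ℕ) (φ : S.Op) (G : Fin (S.eager φ) → Net S [star] (ctxTy k h))
    (K : (j : Fin (S.deferred φ).length) → Net S [.thunk ((S.deferred φ).get j)] (ctxTy k h)) :
    (p : (opSkel τ k h φ).P) → Net S ((opSkel τ k h φ).ins p) ((opSkel τ k h φ).outs p)
  | .inl i => G i
  | .inr j => K j

/-- The closed skeleton of an operation. -/
def opSkel' (τ : VLab) (k h : ℕ) (φ : S.Op) : Skel S [τ] (ctxTy k h) :=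
  (opSkel τ k h φ).distribute k h (fun _ => S.eager φ + (S.deferred φ).length)
    (fun p c => .inner (.inr (p, c)))

theorem opNet_iso (τ : VLab) (k h : ℕ) (φ : S.Op) (G : Fin (S.eager φ) → Net S [star] (ctxTy k h))
    (K : (j : Fin (S.deferred φ).length) → Net S [.thunk ((S.deferred φ).get j)] (ctxTy k h)) :
    Net.Iso (opNet τ k h φ G K) ((opSkel' τ k h φ).glue (opParts τ k h φ G K)) := by
  let L := opSkel τ k h φ
  let N := opParts τ k h φ G K
  let D : Type := Fin (Lab.cod (.op φ : Lab S)).length ⊕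
    (Fin (ctxTy k h).length × Fin (S.eager φ + (S.deferred φ).length))
  let fV : (Σ i, (G i).V) ⊕ (Σ j, (K j).V) ⊕ D ≃ D ⊕ Σ b, (N b).V :=
    { toFun := fun v => match v with
        | .inl ⟨i, v⟩ => .inr ⟨.inl i, v⟩
        | .inr (.inl ⟨i, v⟩) => .inr ⟨.inr i, v⟩
        | .inr (.inr v) => .inl v
      invFun := fun v => match v with
        | .inl v => .inr (.inr v)
        | .inr ⟨.inl i, v⟩ => .inl ⟨i, v⟩
        | .inr ⟨.inr i, v⟩ => .inr (.inl ⟨i, v⟩)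
      left_inv := by rintro (v | v | v) <;> rfl
      right_inv := by rintro (v | ⟨_ | _, v⟩) <;> rfl }
  let fE : Unit ⊕ (Σ i, (G i).E) ⊕ (Σ j, (K j).E) ≃ Unit ⊕ Σ b, (N b).E :=
    { toFun := fun v => match v with
        | .inl v => .inl v
        | .inr (.inl ⟨i, v⟩) => .inr ⟨.inl i, v⟩
        | .inr (.inr ⟨i, v⟩) => .inr ⟨.inr i, v⟩
      invFun := fun v => match v with
        | .inl v => .inl v
        | .inr ⟨.inl i, v⟩ => .inr (.inl ⟨i, v⟩)
        | .inr ⟨.inr i, v⟩ => .inr (.inr ⟨i, v⟩)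
      left_inv := by rintro (v | v | v) <;> rfl
      right_inv := by rintro (v | ⟨_ | _, v⟩) <;> rfl }
  have hG : ∀ i (v : (G i).Vert), L.emb N (.inl i) v = (match v with
      | .inner v => .inner (.inl ⟨i, v⟩)
      | .inp _ => .inner (.inr (.inr (.inl
        ((Fin.castAdd (S.deferred φ).length i).cast (cod_op_length φ).symm))))
      | .out p => .inner (.inr (.inr (.inr (p, Fin.castAdd (S.deferred φ).length i)))) :
          Vtx ((Σ i, (G i).V) ⊕ (Σ j, (K j).V) ⊕ D) [τ] []).map fV := by
    rintro i (v | v | v) <;> rfl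
  have hK : ∀ j (v : (K j).Vert), L.emb N (.inr j) v = (match v with
      | .inner v => .inner (.inr (.inl ⟨j, v⟩))
      | .inp _ => .inner (.inr (.inr (.inl
        ((Fin.natAdd (S.eager φ) j).cast (cod_op_length φ).symm))))
      | .out p => .inner (.inr (.inr (.inr (p, Fin.natAdd (S.eager φ) j)))) :
          Vtx ((Σ i, (G i).V) ⊕ (Σ j, (K j).V) ⊕ D) [τ] []).map fV := by
    rintro j (v | v | v) <;> rfl
  unfold opNet opSkel'
  refine Skel.distribute_iso fV fE ?_ ?_ ?_ ?_ ?_ ?_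
  · rintro (v | v | v | v) <;> rfl
  · rintro (v | v | v) <;> rfl
  · rintro (e | e | e) i i' hi
    · rfl
    · obtain rfl : i = i' := Fin.ext hi
      exact hG _ _
    · obtain rfl : i = i' := Fin.ext hi
      exact hK _ _
  · rintro (e | e | e) i i' hi
    · obtain rfl : i = i' := Fin.ext hi
      rfl
    · obtain rfl : i = i' := Fin.ext hi
      exact hG _ _
    · obtain rfl : i = i' := Fin.ext hi
      exact hK _ _
  · rintro (e | e | e) m cs os hl hl'
    · cases hl
    · exact .refl _
    · exact .refl _
  · intro p c
    rfl

theorem cod_op_get_castAdd (φ : S.Op) (i : Fin (S.eager φ)) :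
    (Lab.cod (.op φ : Lab S)).get ((Fin.castAdd (S.deferred φ).length i).cast
      (cod_op_length φ).symm) = star := by
  have h : ∀ p : Fin (List.replicate (S.eager φ) star ++ (S.deferred φ).map VLab.thunk).length,
      p.val < S.eager φ → List.get _ p = star := fun p hp => by simp [hp]
  exact h _ i.isLt

theorem cod_op_get_natAdd (φ : S.Op) (j : Fin (S.deferred φ).length) :
    (Lab.cod (.op φ : Lab S)).get ((Fin.natAdd (S.eager φ) j).cast
      (cod_op_length φ).symm) = .thunk ((S.deferred φ).get j) := by
  have h : ∀ p : Fin (List.replicate (S.eager φ) star ++ (S.deferred φ).map VLab.thunk).length,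
      p.val = S.eager φ + j.val → List.get _ p = .thunk ((S.deferred φ).get j) :=
    fun p hp => by simp [hp]
  exact h _ rfl

/-- The targets of the operation edge are numbered by `Fin (n + m)`, and splitting this into the `n`
eager and `m` deferred positions matches them with the arguments. The same numbering matches the
inputs of each distributor with the arguments. -/
theorem opSkel_isOpenLevel (k h : ℕ) (φ : S.Op) :
    (opSkel star k h φ).IsOpenLevel k h (fun _ => S.eager φ + (S.deferred φ).length)
      (fun p c => .inner (.inr (p, c))) := by
  have hsub : ∀ i i' : Fin 1, i = i' := Subsingleton.elim
  let L := opSkel star k h φ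
  let n := S.eager φ
  let m := (S.deferred φ).length
  let R := Fin (Lab.cod (.op φ : Lab S)).length
  let toR : Fin (n + m) → R := Fin.cast (cod_op_length φ).symm
  have toR_inj : Function.Injective toR := Fin.cast_injective _
  have hcast : ∀ (i : Fin n) (j : Fin m), Fin.castAdd m i ≠ Fin.natAdd n j := by
    intro i j hij
    have := i.isLt
    have := congrArg Fin.val hij
    simp at this
    omega
  have hV : ∀ {x y : L.V}, (Vtx.inner x : Vtx L.V [star] []) = .inner y → x = y :=
    fun hh => by cases hh; rfl
  have hQ : ∀ y y' : L.Q, y = y' := fun _ _ => rfl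
  refine ⟨?_, inferInstanceAs (Finite Unit), ?_, ?_, ?_, ?_, ?_, ?_,
    ⟨?_, ?_⟩, ?_, ?_, ?_, nofun⟩
  · exact inferInstanceAs (Finite (R ⊕ (Fin (ctxTy k h).length × Fin (n + m))))
  · exact inferInstanceAs (Finite (Fin n ⊕ Fin m))
  · intro q i
    rw [show i = (0 : Fin 1) from hsub _ _]; rfl
  · intro q i
    rfl
  · rintro (p | p) i
    · rw [show i = (0 : Fin 1) from hsub _ _]
      exact cod_op_get_castAdd φ p
    · rw [show i = (0 : Fin 1) from hsub _ _]
      exact cod_op_get_natAdd φ p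
  · rintro (p | p) j <;> rfl
  · intro p c
    rfl
  · rintro ((⟨y, i⟩ | ⟨p | p, i⟩) | ⟨p, c⟩) ((⟨y', i'⟩ | ⟨p' | p', i'⟩) | ⟨p', c'⟩) hh
    · obtain rfl := hQ y y'
      rw [show i = i' from hsub _ _]
    · cases hh
    · cases hh
    · cases hh
    · cases hh
    · cases Fin.castAdd_injective n m (toR_inj (Sum.inl_injective (hV hh)))
      rw [show i = i' from hsub _ _]
    · exact (hcast _ _ (toR_inj (Sum.inl_injective (hV hh)))).elim
    · cases hh
    · cases hh
    · exact (hcast _ _ (toR_inj (Sum.inl_injective (hV hh))).symm).elim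
    · cases Fin.natAdd_injective m n (toR_inj (Sum.inl_injective (hV hh)))
      rw [show i = i' from hsub _ _]
    · cases hh
    · cases hh
    · cases hh
    · cases hh
    · cases hh; rfl
  · rintro ((r | ⟨p, c⟩) | v | v)
    · obtain ⟨x, rfl⟩ : ∃ x, toR x = r := ⟨r.cast (cod_op_length φ), rfl⟩
      induction x using Fin.addCases with
      | left i => exact ⟨.inl (.inr ⟨.inl i, (0 : Fin 1)⟩), rfl⟩
      | right j => exact ⟨.inl (.inr ⟨.inr j, (0 : Fin 1)⟩), rfl⟩
    · exact ⟨.inr ⟨p, c⟩, rfl⟩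
    · exact ⟨.inl (.inl ⟨(), (0 : Fin 1)⟩), congrArg Vtx.inp (hsub _ _)⟩
    · exact v.elim0
  · rintro (⟨y, i⟩ | ⟨p | p, i⟩) (⟨y', i'⟩ | ⟨p' | p', i'⟩) hh
    · cases hh; rfl
    · cases hh
    · cases hh
    · cases hh
    · have := Prod.mk.inj (Sum.inr_injective (hV hh))
      cases this.1
      cases Fin.castAdd_injective n m this.2
      rfl
    · exact (hcast _ _ (Prod.mk.inj (Sum.inr_injective (hV hh))).2).elim
    · cases hh
    · exact (hcast _ _ (Prod.mk.inj (Sum.inr_injective (hV hh))).2.symm).elim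
    · have := Prod.mk.inj (Sum.inr_injective (hV hh))
      cases this.1
      cases Fin.natAdd_injective m n this.2
      rfl
  · rintro (⟨y, i⟩ | ⟨p | p, i⟩) j hh <;> cases hh
  · rintro ((r | ⟨p, c⟩) | v | v)
    · exact .inr ⟨.inl ⟨(), r⟩, rfl⟩
    · right
      induction c using Fin.addCases with
      | left i => exact ⟨.inr ⟨.inl i, p⟩, rfl⟩
      | right j => exact ⟨.inr ⟨.inr j, p⟩, rfl⟩
    · exact .inl ⟨v, rfl⟩
    · exact v.elim0

end Constructors

/-! ### Well-formedness of the translation -/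

section TranslateWellFormed

variable {S : Sig.{u}} {I O : List VLab}

/-! ### Hypernets without holes and tokens -/

/-- Hypernets without holes and tokens. -/
structure Net.IsPlain (G : Net S I O) : Prop where
  isHypernet : G.IsHypernet
  holeFree : G.HoleFree
  focusFree : G.FocusFree

theorem Net.Iso.isPlain {G H : Net S I O} (h : Net.Iso G H) (hG : G.IsPlain) : H.IsPlain :=
  ⟨h.isHypernet hG.isHypernet, Net.holeFree_iff.2 (h.allLabs (Net.holeFree_iff.1 hG.holeFree)),
    Net.focusFree_iff.2 (h.allLabs (Net.focusFree_iff.1 hG.focusFree))⟩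

/-- Well-formed skeletons without holes, tokens and boxes. -/
structure Skel.IsFrame (K : Skel S I O) : Prop where
  isLevel : K.IsLevel
  no_hole : ∀ q χ, K.lab q ≠ .hole χ
  no_tok : ∀ q t, K.lab q ≠ .tok t
  no_box : ∀ q m cs os, K.lab q ≠ .box m cs os

theorem Skel.IsOpenLevel.isFrame {K : Skel S I []} {k h : ℕ} {mult : Fin (ctxTy k h).length → ℕ}
    {feed : (p : Fin (ctxTy k h).length) → Fin (mult p) → Vtx K.V I []}
    (hK : K.IsOpenLevel k h mult feed) (hhole : ∀ q χ, K.lab q ≠ .hole χ)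
    (htok : ∀ q t, K.lab q ≠ .tok t) : (K.distribute k h mult feed).IsFrame := by
  refine ⟨hK.distribute, ?_, ?_, ?_⟩
  · rintro (q | q | q) χ
    · exact hhole q χ
    · exact nofun
    · exact nofun
  · rintro (q | q | q) t
    · exact htok q t
    · exact nofun
    · exact nofun
  · rintro (q | q | q) m cs os
    · exact hK.no_box q m cs os
    · exact nofun
    · exact nofun

theorem Skel.IsFrame.glue_focusFree {K : Skel S I O} (hK : K.IsFrame)
    {N : (p : K.P) → Net S (K.ins p) (K.outs p)} (hN : ∀ p, (N p).FocusFree) :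
    (K.glue N).FocusFree :=
  Net.focusFree_iff.2 (Skel.glue_allLabs hK.no_tok
    (fun q m cs os h => (hK.no_box q m cs os h).elim) hN)

theorem Skel.IsFrame.glue_isPlain {K : Skel S I O} (hK : K.IsFrame)
    {N : (p : K.P) → Net S (K.ins p) (K.outs p)} (hN : ∀ p, (N p).IsPlain) :
    (K.glue N).IsPlain :=
  ⟨Skel.glue_isHypernet hK.isLevel (fun q m cs os h => (hK.no_box q m cs os h).elim)
      fun p => (hN p).isHypernet,
    Net.holeFree_iff.2 (Skel.glue_allLabs hK.no_hole
      (fun q m cs os h => (hK.no_box q m cs os h).elim) fun p => (hN p).holeFree),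
    hK.glue_focusFree fun p => (hN p).focusFree⟩

/-! ### Thunks -/

theorem Net.everywhere_thunkNet {P : (I O : List VLab) → Net S I O → Prop} {τ : VLab} {m : ℕ}
    {cs os : List VLab} {G : Net S [star] cs} (here : P _ _ (thunkNet τ m os G))
    (hG : Net.Everywhere P G) : Net.Everywhere P (thunkNet τ m os G) :=
  .intro here fun e m' cs' os' h => by cases h; exact hG

theorem Net.allLabs_thunkNet {R : Lab S → Prop} {τ : VLab} {m : ℕ}
    {cs os : List VLab} {G : Net S [star] cs} (hR : R (.box m cs os)) (hG : G.AllLabs R) :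
    (thunkNet τ m os G).AllLabs R :=
  Net.everywhere_thunkNet (fun _ => hR) hG

theorem thunkNet_isHypernet {m k k' h : ℕ} (hk : k' = m + k) {G : Net S [star] (ctxTy k' h)}
    (hG : G.IsHypernet) : (thunkNet (.thunk m) m (ctxTy k h) G).IsHypernet := by
  refine Net.everywhere_thunkNet ⟨?_, ?_, ?_, ?_, ?_, ?_, ?_, ?_, ?_⟩ hG
  · exact inferInstanceAs (Finite Empty)
  · exact inferInstanceAs (Finite Unit)
  · intro e i
    obtain rfl : i = (0 : Fin 1) := Subsingleton.elim (α := Fin 1) _ _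
    rfl
  · intro e i; rfl
  · rintro ⟨e, i⟩ ⟨e', i'⟩ _
    obtain rfl : i = i' := Subsingleton.elim (α := Fin 1) _ _
    rfl
  · rintro ⟨e, i⟩ ⟨e', i'⟩ h
    cases h; rfl
  · rintro (v | v | v)
    · exact v.elim
    · refine iff_of_true ⟨v, rfl⟩ ?_
      rintro ⟨e, i, h⟩
      cases h
    · refine iff_of_false ?_ (not_not.2 ⟨(), v, rfl⟩)
      rintro ⟨i, h⟩
      cases h
  · rintro (v | v | v)
    · exact v.elim
    · refine iff_of_false ?_ (not_not.2 ⟨(), (0 : Fin 1), ?_⟩)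
      · rintro ⟨i, h⟩
        cases h
      · exact congrArg Vtx.inp (Subsingleton.elim (α := Fin 1) _ _)
    · refine iff_of_true ⟨v, rfl⟩ ?_
      rintro ⟨e, i, h⟩
      cases h
  · intro e m' cs' os' h
    cases h
    exact ⟨k, _, rfl, hk ▸ rfl⟩

theorem thunkNet_isPlain {m k k' h : ℕ} (hk : k' = m + k) {G : Net S [star] (ctxTy k' h)}
    (hG : G.IsPlain) : (thunkNet (.thunk m) m (ctxTy k h) G).IsPlain :=
  ⟨thunkNet_isHypernet hk hG.isHypernet,
    Net.holeFree_iff.2 (Net.allLabs_thunkNet nofun (Net.holeFree_iff.1 hG.holeFree)),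
    Net.focusFree_iff.2 (Net.allLabs_thunkNet nofun (Net.focusFree_iff.1 hG.focusFree))⟩

/-- The box is not a hole, so the occurrences are exactly those in its content. -/
theorem thunkNet_isContextOf {χ : Hole} {m k k' h : ℕ} (hk : k' = m + k)
    {G : Net S [star] (ctxTy k' h)} (hG : G.IsContextOf χ) :
    (thunkNet (.thunk m) m (ctxTy k h) G).IsContextOf χ := by
  have hocc : ∀ {χ'} (o : Net.Occ χ' (thunkNet (.thunk m) m (ctxTy k h) G)),
      ∃ o' : Net.Occ χ' G, o = .deep (G := thunkNet (.thunk m) m (ctxTy k h) G) ()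
        m (ctxTy k' h) (ctxTy k h) rfl o' := by
    rintro χ' (⟨e, h⟩ | ⟨e, m', cs', os', h, o⟩)
    · cases h
    · cases h
      exact ⟨o, rfl⟩
  refine ⟨⟨thunkNet_isHypernet hk hG.1.1, fun χ' => ⟨?_⟩⟩, fun χ' => ?_⟩
  · intro o o'
    obtain ⟨o, rfl⟩ := hocc o
    obtain ⟨o', rfl⟩ := hocc o'
    have := hG.1.2 χ'
    rw [Subsingleton.elim o o']
  · rw [← hG.2]
    constructor
    · rintro ⟨o⟩
      exact ⟨(hocc o).choose⟩
    · rintro ⟨o⟩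
      exact ⟨.deep (G := thunkNet (.thunk m) m (ctxTy k h) G) () m (ctxTy k' h) (ctxTy k h) rfl o⟩

theorem Net.Iso.thunkNet {τ : VLab} {m : ℕ} {cs os : List VLab} {G H : Net S [star] cs}
    (h : Net.Iso G H) : Net.Iso (thunkNet τ m os G) (thunkNet τ m os H) := by
  refine .intro (Equiv.refl Empty) (Equiv.refl Unit) ?_ ?_ ?_ ?_ ?_
  · exact fun v => v.elim
  · exact fun _ => rfl
  · exact fun _ _ _ _ => rfl
  · intro e i i' hi
    obtain rfl : i = i' := Fin.ext hi
    rfl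
  · intro e m' cs' os' h₁ h₂
    cases h₁
    exact h

theorem plug_thunkNet {χ : Hole} (T : Net S χ.ins χ.outs) (τ : VLab) (m : ℕ) {cs os : List VLab}
    (G : Net S [star] cs) :
    Net.Iso (Net.plug χ T (thunkNet τ m os G)) (thunkNet τ m os (Net.plug χ T G)) := by
  rw [Net.plug_eq]
  have h0 : ∀ e : Unit, (.box m cs os : Lab S) ≠ .hole χ := nofun
  have : IsEmpty {e : Unit // (.box m cs os : Lab S) = .hole χ} := ⟨fun e => h0 e.1 e.2⟩
  refine .intro (Equiv.sumEmpty Empty ({e : Unit // (.box m cs os : Lab S) = .hole χ} × T.V))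
    ((Equiv.sumEmpty {e : Unit // (.box m cs os : Lab S) ≠ .hole χ}
      ({e : Unit // (.box m cs os : Lab S) = .hole χ} × T.E)).trans (Equiv.subtypeUnivEquiv h0))
    ?_ ?_ ?_ ?_ ?_
  · rintro (v | v)
    · exact v.elim
    · exact (h0 () v.1.2).elim
  · rintro (e | e)
    · rfl
    · exact (h0 () e.1.2).elim
  · rintro (e | e) i i' hi
    · rfl
    · exact (h0 () e.1.2).elim
  · rintro (e | e) i i' hi
    · obtain rfl : i = i' := Fin.ext hi
      rfl
    · exact (h0 () e.1.2).elim
  · rintro (e | e) m' cs' os' h₁ h₂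
    · cases h₂
      exact .refl _
    · exact (h0 () e.1.2).elim

/-! ### Binders and operations -/

/-- The bound variable is appended after the `k` variables, so output `k` of the body is the removed
one, and it is a `⋆`. The number `k'` is a separate parameter because `(xs ++ [x]).length` is only
propositionally `k + 1`. -/
theorem bindFrame (I : List VLab) (k h k' : ℕ) (hk : k' = k + 1)
    (hO : (ctxTy k' h).length = (ctxTy k h).length + 1) :
    (linkSkel' S I k h Unit Empty (fun _ => star) () () hO).IsFrame := by
  subst hk
  refine Skel.IsOpenLevel.isFrame (linkSkel_isOpenLevel ?_ ?_ rfl nofun ?_) nofun nofun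
  · refine ⟨?_, fun _ => ⟨none, rfl⟩⟩
    rintro (_ | y) (_ | y') _ <;> first | rfl | exact y.elim | exact y'.elim
  · refine ⟨?_, fun _ => ⟨none, rfl⟩⟩
    rintro (_ | y) (_ | y') _ <;> first | rfl | exact y.elim | exact y'.elim
  · intro j
    rw [ctxTy_get]
    unfold dropPos
    split_ifs with h₁ h₂
    · simp only [Option.elim_some, ctxTy_get]
      simp [ctxWire, h₁, Nat.lt_succ_of_lt h₁]
    · simp [ctxWire, h₂]
    · simp only [Option.elim_some, ctxTy_get]
      simp only [ctxWire]
      congr 1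
      rw [if_neg (by omega), if_neg (by omega)]

/-- The new atom is put in front of the other atoms, so its output again has position `k` and is now
a `⋄`. -/
theorem newFrame (I : List VLab) (k h h' : ℕ) (hh : h' = h + 1)
    (hO : (ctxTy k h').length = (ctxTy k h).length + 1) :
    (linkSkel' S I k h Bool Unit (fun b => if b then star else diam) false true hO).IsFrame := by
  subst hh
  refine Skel.IsOpenLevel.isFrame (linkSkel_isOpenLevel ?_ ?_ rfl (fun _ => rfl) ?_) nofun nofun
  · constructor
    · rintro (_ | y) (_ | y') hy <;> first | rfl | cases hy
    · rintro (_ | _)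
      · exact ⟨some (), rfl⟩
      · exact ⟨none, rfl⟩
  · constructor
    · rintro (_ | y) (_ | y') hy <;> first | rfl | cases hy
    · rintro (_ | _)
      · exact ⟨none, rfl⟩
      · exact ⟨some (), rfl⟩
  · intro j
    change _ = Option.elim _ diam _
    rw [ctxTy_get]
    unfold dropPos
    split_ifs with h₁ h₂
    · simp only [Option.elim_some, ctxTy_get]
    · simp [ctxWire, h₂]
    · simp only [Option.elim_some, ctxTy_get]
      simp only [ctxWire]
      congr 1
      rw [if_neg (by omega), if_neg (by omega)]

theorem opFrame (k h : ℕ) (φ : S.Op) : (opSkel' star k h φ).IsFrame :=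
  Skel.IsOpenLevel.isFrame (opSkel_isOpenLevel k h φ) nofun nofun

/-! ### The translation of a derivable judgement -/

variable {X : Type v} {A : Type w}

/-- The translation is defined on raw terms, and typing makes it well formed: a variable missing
from `xs` would leave its input connected to nothing. The freshness premises of the rules keep the
variables and atoms distinct throughout the induction. -/
theorem HasTy.translate_isPlain {xs : List X} {as : List A} {t : Term S X A} {τ : VLab}
    (ht : HasTy xs as t τ) (hxs : xs.Nodup) (has : as.Nodup) :
    (translate t τ xs as).IsPlain := by
  induction ht with
  | var hx =>
    exact (varNet_iso _ _ _ _).symm.isPlain (((varSkel_isOpenLevel _ hxs hx).isFrame nofun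
      nofun).glue_isPlain nofun)
  | atom ha =>
    exact (atomNet_iso _ _ _ _).symm.isPlain (((atomSkel_isOpenLevel _ has ha).isFrame nofun
      nofun).glue_isPlain nofun)
  | bind hx _ _ ihs iht =>
    refine (linkNet_iso _ _ _).symm.isPlain ((bindFrame _ _ _ _ (by simp) _).glue_isPlain ?_)
    rintro (_ | _)
    · exact ihs hxs has
    · exact iht (hxs.append (List.nodup_singleton _) (List.disjoint_singleton.2 hx)) has
  | new ha _ _ ihs iht =>
    refine (linkNet_iso _ _ _).symm.isPlain ((newFrame _ _ _ _ (by simp) _).glue_isPlain ?_)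
    rintro (_ | _)
    · exact ihs hxs has
    · exact iht hxs (List.nodup_cons.2 ⟨ha, has⟩)
  | thunk hn hd _ ih =>
    exact thunkNet_isPlain (by simp) (ih (hn.append hxs hd) has)
  | op _ _ ihts ihss =>
    refine (opNet_iso ..).symm.isPlain ((opFrame _ _ _).glue_isPlain ?_)
    rintro (i | j)
    · exact ihts i hxs has
    · exact ihss j hxs has

end TranslateWellFormed

/-! ### Congruence of refinement -/

section Congruence

variable {S : Sig.{u}} {I O : List VLab}

/-! ### Refinement is preserved by frames -/

/-- If `D[T₁]` and `D[T₂]` are `M₁` and `M₂`, and plugging `D` preserves the set of contexts, then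
refinement of `T₁` by `T₂` gives refinement of `M₁` by `M₂`. -/
theorem CtxRefines.of_context {B : Behaviour S} {𝒞 : ContextSet S} {Q : ℕ → ℕ → Prop}
    {I' O' : List VLab} {T₁ T₂ : Net S I O} {M₁ M₂ : Net S I' O'} {m : ℕ} {D : Net S I' O'}
    (hD : D.IsContextOf ⟨m, I, O⟩)
    (hcl : ∀ (n : ℕ) (C : Prog S), 𝒞 _ _ C → C.IsContextOf ⟨n, I', O'⟩ →
      𝒞 _ _ (Net.plug ⟨n, I', O'⟩ D C))
    (h₁ : Net.Iso (Net.plug ⟨m, I, O⟩ T₁ D) M₁) (h₂ : Net.Iso (Net.plug ⟨m, I, O⟩ T₂ D) M₂)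
    (h : CtxRefines B 𝒞 Q T₁ T₂) : CtxRefines B 𝒞 Q M₁ M₂ := by
  intro n C hC hCχ hs₁ hs₂
  have iso : ∀ {T : Net S I O} {M : Net S I' O'}, Net.Iso (Net.plug ⟨m, I, O⟩ T D) M →
      Net.Iso (withToken .search (Net.plug ⟨m, I, O⟩ T (Net.plug ⟨n, I', O'⟩ D C)))
        (withToken .search (Net.plug ⟨n, I', O'⟩ M C)) := fun {T M} hT =>
    Net.Iso.tokenIn ((Net.plug_plug (χ := ⟨m, I, O⟩) (χ' := ⟨n, I', O'⟩) T D C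
      hCχ.onlyHole).trans (Net.Iso.plug (χ := ⟨n, I', O'⟩) hT C)) _ _
  -- The hypothesis is applied to the composite context `C[D]`, whose only hole is that of `D`; the
  -- isomorphisms transfer both the conditions on states and the conclusion.
  exact (h m _ (hcl n C hC hCχ) (hD.plug (χ' := ⟨n, I', O'⟩) hCχ) ((iso h₁).symm.isState hs₁)
    ((iso h₂).symm.isState hs₂)).of_iso (iso h₁) (iso h₂)

theorem Net.FocusFree.plug {χ : Hole} {D : Net S χ.ins χ.outs} (hD : D.FocusFree) {C : Net S I O}
    (hC : C.FocusFree) : (Net.plug χ D C).FocusFree :=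
  Net.focusFree_iff.2 (Net.AllLabs.plug (Net.focusFree_iff.1 hD)
    ((Net.focusFree_iff.1 hC).imp fun _ _ _ h e => .inr (h e)))

theorem AllContexts.plug {χ χ' : Hole} {D : Net S χ'.ins χ'.outs} (hD : D.IsContextOf χ)
    (hDf : D.FocusFree) {C : Net S I O} (hC : AllContexts _ _ C) (hCχ : C.IsContextOf χ') :
    AllContexts _ _ (Net.plug χ' D C) :=
  ⟨(hD.plug hCχ).1, hDf.plug hC.2⟩

theorem BindingFreeContexts.plug {χ χ' : Hole} {D : Net S χ'.ins χ'.outs} (hD : D.IsContextOf χ)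
    (hDf : D.FocusFree) (hDb : Net.Everywhere (fun _ _ G => G.BindingFreeLevel) D)
    {C : Net S I O} (hC : BindingFreeContexts _ _ C) (hCχ : C.IsContextOf χ') :
    BindingFreeContexts _ _ (Net.plug χ' D C) :=
  ⟨AllContexts.plug hD hDf hC.1 hCχ,
    Net.bindingFree_plug hD.1.1 hCχ.1.1 hCχ.onlyHole (hCχ.1.2 _) hDb hC.2⟩

section Glue

variable {K : Skel S I O} {p₀ : K.P} {N₁ N₂ : (p : K.P) → Net S (K.ins p) (K.outs p)}

/-- The part `p₀` is replaced by a hole. -/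
noncomputable def Skel.punctured (p₀ : K.P) (N : (p : K.P) → Net S (K.ins p) (K.outs p)) :
    (p : K.P) → Net S (K.ins p) (K.outs p) :=
  haveI := Classical.decEq K.P
  Function.update N p₀ (Net.holeEdge ⟨0, K.ins p₀, K.outs p₀⟩)

theorem Skel.punctured_self (N : (p : K.P) → Net S (K.ins p) (K.outs p)) :
    Skel.punctured p₀ N p₀ = Net.holeEdge ⟨0, K.ins p₀, K.outs p₀⟩ :=
  letI := Classical.decEq K.P
  Function.update_self ..

theorem Skel.punctured_of_ne (N : (p : K.P) → Net S (K.ins p) (K.outs p)) {p : K.P}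
    (hp : p ≠ p₀) : Skel.punctured p₀ N p = N p :=
  letI := Classical.decEq K.P
  Function.update_of_ne hp ..

theorem Skel.IsFrame.punctured_isContextOf (hK : K.IsFrame) (hN : ∀ p, p ≠ p₀ → (N₁ p).IsPlain) :
    (K.glue (Skel.punctured p₀ N₁)).IsContextOf ⟨0, K.ins p₀, K.outs p₀⟩ := by
  refine Skel.glue_isContextOf (p₀ := p₀) hK.isLevel hK.no_hole hK.no_box ?_ fun p hp => ?_
  · rw [Skel.punctured_self]
    exact Net.holeEdge_isContextOf _
  · rw [Skel.punctured_of_ne _ hp]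
    exact ⟨(hN p hp).isHypernet, (hN p hp).holeFree⟩

theorem Skel.IsFrame.punctured_focusFree (hK : K.IsFrame) (hN : ∀ p, p ≠ p₀ → (N₁ p).IsPlain) :
    (K.glue (Skel.punctured p₀ N₁)).FocusFree := by
  refine hK.glue_focusFree fun p => ?_
  by_cases hp : p = p₀
  · subst hp
    rw [Skel.punctured_self]
    exact Net.focusFree_iff.2 (Net.edge_allLabs _ _ nofun)
  · rw [Skel.punctured_of_ne _ hp]
    exact (hN p hp).focusFree

theorem Skel.IsFrame.punctured_bindingFree (hK : K.IsFrame) (hp₀ : K.Accessible p₀)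
    (hN : ∀ p, p ≠ p₀ → (N₁ p).IsPlain) :
    Net.Everywhere (fun _ _ G => G.BindingFreeLevel) (K.glue (Skel.punctured p₀ N₁)) := by
  refine Skel.glue_bindingFree hK.isLevel hK.no_hole hK.no_box hp₀ (fun p => ?_) ?_ ?_
    fun p hp => ?_
  · by_cases hp : p = p₀
    · subst hp
      rw [Skel.punctured_self]
      exact (Net.holeEdge_isContextOf _).1.1
    · rw [Skel.punctured_of_ne _ hp]
      exact (hN p hp).isHypernet
  · rw [Skel.punctured_self]
    exact Net.holeEdge_bindingFree _
  · rw [Skel.punctured_self]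
    exact fun _ _ i _ => ⟨i, rfl⟩
  · rw [Skel.punctured_of_ne _ hp]
    exact (hN p hp).holeFree

/-- Plugging passes to the parts, where it fills the hole at `p₀` and leaves the other, hole-free
parts as they are. It is used for both families, with the same punctured frame. -/
theorem Skel.IsFrame.plug_punctured (hK : K.IsFrame) (hN : ∀ p, p ≠ p₀ → (N₁ p).IsPlain)
    (h : ∀ p, p ≠ p₀ → N₁ p = N₂ p) :
    Net.Iso (Net.plug ⟨0, K.ins p₀, K.outs p₀⟩ (N₂ p₀) (K.glue (Skel.punctured p₀ N₁)))
      (K.glue N₂) := by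
  refine (Skel.plug_glue (χ := ⟨0, K.ins p₀, K.outs p₀⟩) _ K _ fun q => hK.no_hole q _).trans
    (Net.Iso.symm (Skel.glue_congr K _ (fun q m cs os h => (hK.no_box q m cs os h).elim)
      fun p => Net.Iso.symm ?_))
  by_cases hp : p = p₀
  · subst hp
    rw [Skel.punctured_self]
    exact Net.plug_edge (χ := ⟨0, K.ins p, K.outs p⟩) _
  · rw [Skel.punctured_of_ne _ hp, ← h p hp]
    exact Net.plug_of_ne _ _ ((Net.holeFree_iff.1 (hN p hp).holeFree).imp fun _ _ _ h e => h e _)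

variable {B : Behaviour S} {Q : ℕ → ℕ → Prop} {M₁ M₂ : Net S I O}

/-- The inductive step for binders and operations: the frame with a hole at `p₀` is the context `D`
of `CtxRefines.of_context`. Accessibility of `p₀` is what makes it binding-free. -/
theorem CtxRefines.glue {𝒞 : ContextSet S} (K : Skel S I O) (p₀ : K.P)
    {N₁ N₂ : (p : K.P) → Net S (K.ins p) (K.outs p)}
    (h𝒞 : 𝒞 = AllContexts ∨ 𝒞 = BindingFreeContexts ∧ K.Accessible p₀)
    (hK : K.IsFrame) (h₁ : Net.Iso M₁ (K.glue N₁)) (h₂ : Net.Iso M₂ (K.glue N₂))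
    (hN : ∀ p, p ≠ p₀ → (N₁ p).IsPlain) (hNN : ∀ p, p ≠ p₀ → N₁ p = N₂ p)
    (h : CtxRefines B 𝒞 Q (N₁ p₀) (N₂ p₀)) : CtxRefines B 𝒞 Q M₁ M₂ := by
  have hD := hK.punctured_isContextOf hN
  have hDf := hK.punctured_focusFree hN
  refine h.of_context hD (fun n C hC hCχ => ?_)
    ((hK.plug_punctured hN fun _ _ => rfl).trans h₁.symm) ((hK.plug_punctured hN hNN).trans h₂.symm)
  rcases h𝒞 with rfl | ⟨rfl, hp₀⟩
  · exact AllContexts.plug (χ' := ⟨n, I, O⟩) hD hDf hC hCχ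
  · exact BindingFreeContexts.plug (χ' := ⟨n, I, O⟩) hD hDf (hK.punctured_bindingFree hp₀ hN) hC hCχ

end Glue

section Thunk

variable {m k k' h : ℕ}

/-- The thunk of a hole. -/
def holeThunk (S : Sig.{u}) (m k k' h : ℕ) : Net S [.thunk m] (ctxTy k h) :=
  thunkNet (.thunk m) m (ctxTy k h) (Net.holeEdge ⟨0, [star], ctxTy k' h⟩)

theorem holeThunk_isContextOf (hk : k' = m + k) :
    (holeThunk S m k k' h).IsContextOf ⟨0, [star], ctxTy k' h⟩ :=
  thunkNet_isContextOf hk (Net.holeEdge_isContextOf _)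

theorem holeThunk_focusFree : (holeThunk S m k k' h).FocusFree :=
  Net.focusFree_iff.2 (Net.allLabs_thunkNet nofun (Net.edge_allLabs _ _ nofun))

/-- The outer level has no hole edge, and paths do not cross the boundary of a box. -/
theorem holeThunk_bindingFree :
    Net.Everywhere (fun _ _ G => G.BindingFreeLevel) (holeThunk S m k k' h) :=
  Net.everywhere_thunkNet nofun (Net.holeEdge_bindingFree _)

theorem plug_holeThunk (T : Net S [star] (ctxTy k' h)) :
    Net.Iso (Net.plug ⟨0, [star], ctxTy k' h⟩ T (holeThunk S m k k' h))
      (thunkNet (.thunk m) m (ctxTy k h) T) :=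
  (plug_thunkNet (χ := ⟨0, [star], ctxTy k' h⟩) ..).trans
    (Net.Iso.thunkNet (Net.plug_edge (χ := ⟨0, [star], ctxTy k' h⟩) T))

variable {B : Behaviour S} {Q : ℕ → ℕ → Prop} {T₁ T₂ : Net S [star] (ctxTy k' h)}

/-- The argument of a thunk is the content of a box and not a part of a frame, so the context is
built directly. It is always binding-free. -/
theorem CtxRefines.thunk {𝒞 : ContextSet S} (h𝒞 : 𝒞 = AllContexts ∨ 𝒞 = BindingFreeContexts)
    (hk : k' = m + k) (H : CtxRefines B 𝒞 Q T₁ T₂) :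
    CtxRefines B 𝒞 Q (thunkNet (.thunk m) m (ctxTy k h) T₁)
      (thunkNet (.thunk m) m (ctxTy k h) T₂) := by
  have hD : (holeThunk S m k k' h).IsContextOf _ := holeThunk_isContextOf hk
  refine H.of_context hD (fun n C hC hCχ => ?_) (plug_holeThunk T₁) (plug_holeThunk T₂)
  rcases h𝒞 with rfl | rfl
  · exact AllContexts.plug (χ' := ⟨n, _, _⟩) hD holeThunk_focusFree hC hCχ
  · exact BindingFreeContexts.plug (χ' := ⟨n, _, _⟩) hD holeThunk_focusFree holeThunk_bindingFree
      hC hCχ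

end Thunk

/-! ### Accessible parts -/

/-- Only the body (`true`) shares its sources with the whole. The bound term hangs below the body or
below the atom edge. -/
theorem linkSkel'_accessible (I : List VLab) (k h : ℕ) {J Y : Type} (jlab : J → VLab) (top bot : J)
    (hO : O.length = (ctxTy k h).length + 1) :
    (linkSkel' S I k h J Y jlab top bot hO).Accessible true :=
  fun j => .inl ⟨j, rfl⟩

theorem opSkel'_accessible (τ : VLab) (k h : ℕ) (φ : S.Op) (p) :
    (opSkel' τ k h φ).Accessible p := by
  have hsrc : ∀ i, ∃ k', (opSkel' τ k h φ).src (.inl ()) i = .inp k' := fun _ => ⟨_, rfl⟩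
  rcases p with i | j
  · exact fun _ => .inr ⟨.inl (), (Fin.castAdd _ i).cast (cod_op_length φ).symm, φ, rfl, rfl, hsrc⟩
  · exact fun _ => .inr ⟨.inl (), (Fin.natAdd _ j).cast (cod_op_length φ).symm, φ, rfl, rfl, hsrc⟩

/-! ### Term-contexts -/

variable {X : Type v} {A : Type w}

theorem HasTyCtx.fill {xs xs' : List X} {as as' : List A} {C : TermCtx S X A} {τ : VLab}
    {t : Term S X A} (hC : HasTyCtx xs as xs' as' C τ) (ht : HasTy xs as t star) :
    HasTy xs' as' (C.fill t) τ := by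
  induction hC with
  | hole => exact ht
  | newBody h hs _ ih => exact .new h hs ih
  | bindBody h hs _ ih => exact .bind h hs ih
  | newArg h _ ht ih => exact .new h ih ht
  | bindArg h _ ht ih => exact .bind h ih ht
  | thunk hn h _ ih => exact .thunk hn h ih
  | opEager _ hts hss ih =>
    refine .op (fun k => ?_) hss
    split_ifs with hk
    · exact ih
    · exact hts ⟨k, hk⟩
  | opDeferred _ hts hss ih =>
    refine .op hts fun k => ?_
    split_ifs with hk
    · subst hk
      exact ih
    · exact hss ⟨k, hk⟩

/-- Induction on the typing of the context, one frame or thunk for each constructor. In the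
constructors allowed in binding-free contexts, `BindingFree` unfolds to that of the subcontext, so
`h𝒞` passes to the induction hypothesis unchanged. -/
theorem HasTyCtx.ctxRefines {B : Behaviour S} {𝒞 : ContextSet S} {Q : ℕ → ℕ → Prop}
    {xs xs' : List X} {as as' : List A} {C : TermCtx S X A} {τ : VLab} {t₁ t₂ : Term S X A}
    (hC : HasTyCtx xs as xs' as' C τ) (hxs : xs'.Nodup) (has : as'.Nodup)
    (h𝒞 : 𝒞 = AllContexts ∨ 𝒞 = BindingFreeContexts ∧ C.BindingFree)
    (h : CtxRefines B 𝒞 Q (translate t₁ star xs as) (translate t₂ star xs as)) :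
    CtxRefines B 𝒞 Q (translate (C.fill t₁) τ xs' as') (translate (C.fill t₂) τ xs' as') := by
  induction hC with
  | hole => exact h
  | newBody ha hs _ ih =>
    refine CtxRefines.glue (linkSkel' S _ _ _ Bool Unit _ false true _) true
      (h𝒞.imp_right fun h => ⟨h.1, linkSkel'_accessible _ _ _ _ _ _ _⟩) (newFrame _ _ _ _ (by simp) _)
      (linkNet_iso _ _ _) (linkNet_iso _ _ _) ?_ ?_ (ih hxs (List.nodup_cons.2 ⟨ha, has⟩) h𝒞)
    · rintro (_ | _) hp
      · exact hs.translate_isPlain hxs has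
      · exact (hp rfl).elim
    · rintro (_ | _) hp
      · rfl
      · exact (hp rfl).elim
  | bindBody hx hs _ ih =>
    refine CtxRefines.glue (linkSkel' S _ _ _ Unit Empty _ () () _) true
      (h𝒞.imp_right fun h => ⟨h.1, linkSkel'_accessible _ _ _ _ _ _ _⟩) (bindFrame _ _ _ _ (by simp) _)
      (linkNet_iso _ _ _) (linkNet_iso _ _ _) ?_ ?_
      (ih (hxs.append (List.nodup_singleton _) (List.disjoint_singleton.2 hx)) has h𝒞)
    · rintro (_ | _) hp
      · exact hs.translate_isPlain hxs has
      · exact (hp rfl).elim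
    · rintro (_ | _) hp
      · rfl
      · exact (hp rfl).elim
  | newArg ha _ ht ih =>
    -- A hole in the bound position is not binding-free, so no accessibility is needed.
    obtain rfl : 𝒞 = AllContexts := h𝒞.resolve_right fun h => h.2
    refine CtxRefines.glue (linkSkel' S _ _ _ Bool Unit _ false true _) false
      (.inl rfl) (newFrame _ _ _ _ (by simp) _)
      (linkNet_iso _ _ _) (linkNet_iso _ _ _) ?_ ?_ (ih hxs has (.inl rfl))
    · rintro (_ | _) hp
      · exact (hp rfl).elim
      · exact ht.translate_isPlain hxs (List.nodup_cons.2 ⟨ha, has⟩)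
    · rintro (_ | _) hp
      · exact (hp rfl).elim
      · rfl
  | bindArg hx _ ht ih =>
    obtain rfl : 𝒞 = AllContexts := h𝒞.resolve_right fun h => h.2
    refine CtxRefines.glue (linkSkel' S _ _ _ Unit Empty _ () () _) false
      (.inl rfl) (bindFrame _ _ _ _ (by simp) _)
      (linkNet_iso _ _ _) (linkNet_iso _ _ _) ?_ ?_ (ih hxs has (.inl rfl))
    · rintro (_ | _) hp
      · exact (hp rfl).elim
      · exact ht.translate_isPlain
          (hxs.append (List.nodup_singleton _) (List.disjoint_singleton.2 hx)) has
    · rintro (_ | _) hp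
      · exact (hp rfl).elim
      · rfl
  | thunk hn hd _ ih =>
    exact (ih (hn.append hxs hd) has h𝒞).thunk (h𝒞.imp_right And.left) (by simp)
  | @opEager xs' as' φ i C ts ss _ hts hss ih =>
    -- The eager arguments after filling with `s`: they depend on `s` only at the position `i`.
    let t (s k) : Term S X A := if h : k = i then C.fill s else ts ⟨k, h⟩
    have ht : ∀ s, t s i = C.fill s := fun s => dif_pos rfl
    have ht' : ∀ s {k} (hk : k ≠ i), t s k = ts ⟨k, hk⟩ := fun s k hk => dif_neg hk
    refine CtxRefines.glue (opSkel' star _ _ φ) (.inl i)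
      (h𝒞.imp_right fun h => ⟨h.1, opSkel'_accessible _ _ _ _ _⟩) (opFrame _ _ _)
      (opNet_iso _ _ _ φ (fun k => translate (t t₁ k) star xs' as') _)
      (opNet_iso _ _ _ φ (fun k => translate (t t₂ k) star xs' as') _) ?_ ?_ ?_
    · rintro (k | j) hp
      · have hk : k ≠ i := fun h => hp (congrArg Sum.inl h)
        change (translate (t t₁ k) star xs' as').IsPlain
        rw [ht' _ hk]
        exact (hts _).translate_isPlain hxs has
      · exact (hss j).translate_isPlain hxs has
    · rintro (k | j) hp
      · have hk : k ≠ i := fun h => hp (congrArg Sum.inl h)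
        change translate (t t₁ k) star xs' as' = translate (t t₂ k) star xs' as'
        rw [ht' _ hk, ht' _ hk]
      · rfl
    · change CtxRefines B 𝒞 Q (translate (t t₁ i) star xs' as') (translate (t t₂ i) star xs' as')
      rw [ht, ht]
      exact ih hxs has h𝒞
  | @opDeferred xs' as' φ j C ts ss _ hts hss ih =>
    let t (s k) : Term S X A := if h : k = j then C.fill s else ss ⟨k, h⟩
    have ht : ∀ s, t s j = C.fill s := fun s => dif_pos rfl
    have ht' : ∀ s {k} (hk : k ≠ j), t s k = ss ⟨k, hk⟩ := fun s k hk => dif_neg hk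
    refine CtxRefines.glue (opSkel' star _ _ φ) (.inr j)
      (h𝒞.imp_right fun h => ⟨h.1, opSkel'_accessible _ _ _ _ _⟩) (opFrame _ _ _)
      (opNet_iso _ _ _ φ _ (fun k => translate (t t₁ k) (.thunk ((S.deferred φ).get k)) xs' as'))
      (opNet_iso _ _ _ φ _ (fun k => translate (t t₂ k) (.thunk ((S.deferred φ).get k)) xs' as'))
      ?_ ?_ ?_
    · rintro (i | k) hp
      · exact (hts i).translate_isPlain hxs has
      · have hk : k ≠ j := fun h => hp (congrArg Sum.inr h)
        change (translate (t t₁ k) (.thunk ((S.deferred φ).get k)) xs' as').IsPlain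
        rw [ht' _ hk]
        exact (hss ⟨k, hk⟩).translate_isPlain hxs has
    · rintro (i | k) hp
      · rfl
      · have hk : k ≠ j := fun h => hp (congrArg Sum.inr h)
        change translate (t t₁ k) (.thunk ((S.deferred φ).get k)) xs' as' =
          translate (t t₂ k) (.thunk ((S.deferred φ).get k)) xs' as'
        rw [ht' _ hk, ht' _ hk]
    · change CtxRefines B 𝒞 Q (translate (t t₁ j) (.thunk ((S.deferred φ).get j)) xs' as')
        (translate (t t₂ j) (.thunk ((S.deferred φ).get j)) xs' as')
      rw [ht, ht]
      exact ih hxs has h𝒞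

theorem TermRefines.fill {B : Behaviour S} {𝒞 : ContextSet S} {xs xs' : List X}
    {as as' : List A} {C : TermCtx S X A} {t₁ t₂ : Term S X A}
    (hC : DerivableCtx xs as xs' as' C star)
    (h𝒞 : 𝒞 = AllContexts ∨ 𝒞 = BindingFreeContexts ∧ C.BindingFree)
    (h : TermRefines B 𝒞 xs as t₁ t₂) : TermRefines B 𝒞 xs' as' (C.fill t₁) (C.fill t₂) :=
  ⟨⟨hC.1, hC.2.1, hC.2.2.fill h.1.2.2⟩, ⟨hC.1, hC.2.1, hC.2.2.fill h.2.1.2.2⟩,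
    hC.2.2.ctxRefines hC.1 hC.2.1 h𝒞 h.2.2⟩

theorem TermEquiv.fill {B : Behaviour S} {𝒞 : ContextSet S} {xs xs' : List X}
    {as as' : List A} {C : TermCtx S X A} {t₁ t₂ : Term S X A}
    (hC : DerivableCtx xs as xs' as' C star)
    (h𝒞 : 𝒞 = AllContexts ∨ 𝒞 = BindingFreeContexts ∧ C.BindingFree)
    (h : TermEquiv B 𝒞 xs as t₁ t₂) : TermEquiv B 𝒞 xs' as' (C.fill t₁) (C.fill t₂) :=
  ⟨⟨hC.1, hC.2.1, hC.2.2.fill h.1.2.2⟩, ⟨hC.1, hC.2.1, hC.2.2.fill h.2.1.2.2⟩,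
    hC.2.2.ctxRefines hC.1 hC.2.1 h𝒞 h.2.2.1, hC.2.2.ctxRefines hC.1 hC.2.1 h𝒞 h.2.2.2⟩

end Congruence

end Spartan

open Spartan in
theorem mainTheorem6 {S : Sig} (B : Behaviour S) {X A : Type*}
    (xs : List X) (as : List A) (t₁ t₂ : Term S X A)
    (h₁ : Derivable xs as t₁ star) (h₂ : Derivable xs as t₂ star)
    (C : TermCtx S X A) (xs' : List X) (as' : List A)
    (hC : DerivableCtx xs as xs' as' C star) :
    (TermRefines B AllContexts xs as t₁ t₂ →
      TermRefines B AllContexts xs' as' (C.fill t₁) (C.fill t₂)) ∧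
    (TermEquiv B AllContexts xs as t₁ t₂ →
      TermEquiv B AllContexts xs' as' (C.fill t₁) (C.fill t₂)) ∧
    (TermRefines B BindingFreeContexts xs as t₁ t₂ → C.BindingFree →
      TermRefines B BindingFreeContexts xs' as' (C.fill t₁) (C.fill t₂)) ∧
    (TermEquiv B BindingFreeContexts xs as t₁ t₂ → C.BindingFree →
      TermEquiv B BindingFreeContexts xs' as' (C.fill t₁) (C.fill t₂)) :=
  ⟨fun h => h.fill hC (.inl rfl), fun h => h.fill hC (.inl rfl),
    fun h hb => h.fill hC (.inr ⟨rfl, hb⟩), fun h hb => h.fill hC (.inr ⟨rfl, hb⟩)⟩
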